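/- Let $K$ be a field and let $B=\bigoplus_{n\ge 0}B_n$ be a graded Hopf algebra over $K$: a Hopf algebra with a decomposition into subspaces such that $B_nB_m\subseteq B_{n+m}$, $1\in B_0$, $\Delta(B_n)\subseteq\sum_{i+j=n}B_i\otimes B_j$, $\varepsilon(B_n)=0$ for $n>0$, and $S(B_n)\subseteq B_n$. Then $B_0$ is a Hopf subalgebra, and $B_1$ is a $B_0$-Hopf bimodule, with both actions given by the multiplication of $B$ and with the coactions $\rho_l\colon B_1\to B_0\otimes B_1$ and $\rho_r\colon B_1\to B_1\otimes B_0$ determined by $\Delta(m)=\rho_l(m)+\rho_r(m)$ for $m\in B_1$. (An $H$-Hopf bimodule over a Hopf algebra $H$ is an $H$-bimodule and $H$-bicomodule $M$ with $\rho_l(h.m.h')=\sum h_1m_{-1}h'_1\otimes h_2.m_0.h'_2$ and $\rho_r(h.m.h')=\sum h_1.m_0.h'_1\otimes h_2m_1h'_2$.) The pair $(B_0,B_1)$ is called the couple associated with $B$. For a Hopf algebra $H$ and an $H$-Hopf bimodule $M$, let $\mathrm{Cot}_H(M)=H\oplus M\oplus (M\square_H M)\oplus\cdots\oplus M^{\square_H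 n}\oplus\cdots$ be the cotensor Hopf algebra, where for a right $H$-comodule $(X,\rho)$ one sets $X\square_H M=\ker(\rho\otimes \mathrm{id}-\mathrm{id}\otimes\rho_l)\subseteq X\otimes M$, and where $M^{\square_H n}\subseteq M^{\otimes n}$ has degree $n$ (with $M^{\square_H 0}=H$). Its comultiplication is $\Delta_H$ on $H$, is $\rho_l+\rho_r$ on $M$, and on $M^{\square_H n}$ is the sum of the left coaction on the first tensor factor, of all deconcatenations $M^{\square_H n}\to M^{\square_H i}\otimes M^{\square_H(n-i)}$, $0<i<n$, and of the right coaction on the last factor; its counit is $\varepsilon_H$ on $H$ and $0$ on $M^{\square_H n}$ for $n\ge1$; its unit is $1_H$; its multiplication is the unique graded coalgebra map $\mathrm{Cot}_H(M)\otimes \mathrm{Cot}_H(M)\to \mathrm{Cot}_H(M)$ that restricts to the multiplication of $H$ on $H\otimes H$ and to the left and right actions on $H\otimes M$ and $M\otimes H$; the resulting graded bialgebra has a (unique) antipode. A graded Hopf morphism is a bialgebra homomorphism that commutes with the antipodes and preserves the degrees. For subspaces $V,W$ of a coalgebra $C$ put $V\wedge_C W=\Delta_C^{-1}(V\otimes C+C\otimes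 W)$. **Proposition.** There is a unique graded Hopf morphism $i_B\colon B\to \mathrm{Cot}_{B_0}(B_1)$ whose restriction to $B_0\oplus B_1$ is the identity, i.e. the identification of $B_0$ and $B_1$ with the components of degree $0$ and $1$ of $\mathrm{Cot}_{B_0}(B_1)$. Moreover, $i_B$ is injective if and only if $B_0\wedge_B B_0=B_0\oplus B_1$. -/

import Mathlib

open scoped TensorProduct DirectSum
open Coalgebra

set_option linter.unusedSimpArgs false

set_option linter.unusedSectionVars false

universe w u

namespace CotHopf

section Tools

variable {K : Type*} [Field K] {X Y Z A : Type*}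
  [AddCommGroup X] [Module K X] [AddCommGroup Y] [Module K Y]
  [AddCommGroup Z] [Module K Z] [AddCommGroup A] [Module K A]

theorem rTensor_subtype_injective (N : Submodule K Y) (A : Type*) [AddCommGroup A] [Module K A] :
    Function.Injective (N.subtype.rTensor A) :=
  Module.Flat.rTensor_preserves_injective_linearMap _ N.injective_subtype

theorem lTensor_subtype_injective (N : Submodule K Y) (A : Type*) [AddCommGroup A] [Module K A] :
    Function.Injective (N.subtype.lTensor A) :=
  Module.Flat.lTensor_preserves_injective_linearMap _ N.injective_subtype

theorem mem_range_rTensor_ker (g : Y →ₗ[K] Z) (y : Y ⊗[K] A) (h : g.rTensor A y = 0) :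
    y ∈ LinearMap.range ((LinearMap.ker g).subtype.rTensor A) :=
  (Module.Flat.rTensor_exact A (LinearMap.exact_subtype_ker_map g) y).1 h

theorem mem_range_lTensor_ker (g : Y →ₗ[K] Z) (y : A ⊗[K] Y) (h : g.lTensor A y = 0) :
    y ∈ LinearMap.range ((LinearMap.ker g).subtype.lTensor A) :=
  (Module.Flat.lTensor_exact A (LinearMap.exact_subtype_ker_map g) y).1 h

/-- A linear map into `Y ⊗ A` that is killed by `g ⊗ A`, seen as a map into `ker g ⊗ A`. -/
noncomputable def corestrictR (g : Y →ₗ[K] Z) (f : X →ₗ[K] Y ⊗[K] A)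
    (h : ∀ x, g.rTensor A (f x) = 0) : X →ₗ[K] LinearMap.ker g ⊗[K] A :=
  (LinearEquiv.ofInjective _ (rTensor_subtype_injective (LinearMap.ker g) A)).symm.toLinearMap ∘ₗ
    f.codRestrict _ fun x => mem_range_rTensor_ker g (f x) (h x)

theorem corestrictR_spec (g : Y →ₗ[K] Z) (f : X →ₗ[K] Y ⊗[K] A)
    (h : ∀ x, g.rTensor A (f x) = 0) (x : X) :
    (LinearMap.ker g).subtype.rTensor A (corestrictR g f h x) = f x :=
  congrArg Subtype.val (LinearEquiv.apply_symm_apply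
    (LinearEquiv.ofInjective _ (rTensor_subtype_injective (LinearMap.ker g) A))
    (f.codRestrict _ (fun x => mem_range_rTensor_ker g (f x) (h x)) x))

/-- A linear map into `A ⊗ Y` that is killed by `A ⊗ g`, seen as a map into `A ⊗ ker g`. -/
noncomputable def corestrictL (g : Y →ₗ[K] Z) (f : X →ₗ[K] A ⊗[K] Y)
    (h : ∀ x, g.lTensor A (f x) = 0) : X →ₗ[K] A ⊗[K] LinearMap.ker g :=
  (LinearEquiv.ofInjective _ (lTensor_subtype_injective (LinearMap.ker g) A)).symm.toLinearMap ∘ₗ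
    f.codRestrict _ fun x => mem_range_lTensor_ker g (f x) (h x)

theorem corestrictL_spec (g : Y →ₗ[K] Z) (f : X →ₗ[K] A ⊗[K] Y)
    (h : ∀ x, g.lTensor A (f x) = 0) (x : X) :
    (LinearMap.ker g).subtype.lTensor A (corestrictL g f h x) = f x :=
  congrArg Subtype.val (LinearEquiv.apply_symm_apply
    (LinearEquiv.ofInjective _ (lTensor_subtype_injective (LinearMap.ker g) A))
    (f.codRestrict _ (fun x => mem_range_lTensor_ker g (f x) (h x)) x))

end Tools

/-- An `H`-Hopf bimodule `M`: an `H`-bimodule and an `H`-bicomodule such that both coactions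
are compatible with both actions. -/
class HopfBimodule (K : Type w) (H M : Type u) [Field K] [Ring H] [HopfAlgebra K H]
    [AddCommGroup M] [Module K M] where
  /-- the left action `h.m` -/
  lact : H →ₗ[K] M →ₗ[K] M
  /-- the right action `m.h` -/
  ract : M →ₗ[K] H →ₗ[K] M
  /-- the left coaction `ρ_l` -/
  lcoact : M →ₗ[K] H ⊗[K] M
  /-- the right coaction `ρ_r` -/
  rcoact : M →ₗ[K] M ⊗[K] H
  one_lact : ∀ m, lact 1 m = m
  mul_lact : ∀ g h m, lact (g * h) m = lact g (lact h m)
  ract_one : ∀ m, ract m 1 = m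
  ract_mul : ∀ m g h, ract m (g * h) = ract (ract m g) h
  lact_ract : ∀ g m h, ract (lact g m) h = lact g (ract m h)
  lcoact_coassoc : ∀ m, TensorProduct.assoc K H H M ((comul (R := K)).rTensor M (lcoact m)) =
    lcoact.lTensor H (lcoact m)
  lcoact_counit : ∀ m, TensorProduct.lid K M ((counit (R := K)).rTensor M (lcoact m)) = m
  rcoact_coassoc : ∀ m, TensorProduct.assoc K M H H (rcoact.rTensor H (rcoact m)) =
    (comul (R := K)).lTensor M (rcoact m)
  rcoact_counit : ∀ m, TensorProduct.rid K M ((counit (R := K)).lTensor M (rcoact m)) = m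
  lcoact_rcoact : ∀ m, TensorProduct.assoc K H M H (lcoact.rTensor H (rcoact m)) =
    rcoact.lTensor H (lcoact m)
  /-- `ρ_l(g.m.h) = ∑ g₁ m₋₁ h₁ ⊗ g₂.m₀.h₂` -/
  lcoact_act : ∀ g m h, lcoact (ract (lact g m) h) =
    TensorProduct.map₂ (LinearMap.mul K H) ract
      (TensorProduct.map₂ (LinearMap.mul K H) lact (comul g) (lcoact m)) (comul h)
  /-- `ρ_r(g.m.h) = ∑ g₁.m₀.h₁ ⊗ g₂ m₁ h₂` -/
  rcoact_act : ∀ g m h, rcoact (ract (lact g m) h) =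
    TensorProduct.map₂ ract (LinearMap.mul K H)
      (TensorProduct.map₂ lact (LinearMap.mul K H) (comul g) (rcoact m)) (comul h)


/-- A right comodule over a coalgebra `H`. -/
structure RightComodule (K : Type w) (H : Type u) [Field K] [AddCommGroup H] [Module K H]
    [Coalgebra K H] where
  carrier : Type u
  [addCommGroup : AddCommGroup carrier]
  [module : Module K carrier]
  coact : carrier →ₗ[K] carrier ⊗[K] H
  coassoc : ∀ x, TensorProduct.assoc K carrier H H (coact.rTensor H (coact x)) =
    (comul (R := K)).lTensor carrier (coact x)
  counit : ∀ x, TensorProduct.rid K carrier ((counit (R := K)).lTensor carrier (coact x)) = x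

attribute [instance] RightComodule.addCommGroup RightComodule.module

section Cotensor

variable {K : Type w} {H : Type u} (M : Type u) [Field K] [Ring H] [HopfAlgebra K H]
  [AddCommGroup M] [Module K M] [HopfBimodule K H M]

open HopfBimodule

/-- The map `X ⊗ M → X ⊗ H ⊗ M`, `x ⊗ m ↦ ρ(x) ⊗ m - x ⊗ ρ_l(m)`,
whose kernel is the cotensor product. -/
noncomputable def cotensorMap (X : RightComodule K H) :
    X.carrier ⊗[K] M →ₗ[K] X.carrier ⊗[K] (H ⊗[K] M) :=
  (TensorProduct.assoc K X.carrier H M).toLinearMap ∘ₗ X.coact.rTensor M -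
    (lcoact (K := K) (H := H) (M := M)).lTensor X.carrier

/-- The right coaction `x ⊗ m ↦ x ⊗ ρ_r(m)` of `X ⊗ M`. -/
noncomputable def tensorCoact (X : RightComodule K H) :
    X.carrier ⊗[K] M →ₗ[K] (X.carrier ⊗[K] M) ⊗[K] H :=
  (TensorProduct.assoc K X.carrier M H).symm.toLinearMap ∘ₗ
    (rcoact (K := K) (H := H) (M := M)).lTensor X.carrier

theorem cotensorMap_tensorCoact (X : RightComodule K H) (t : X.carrier ⊗[K] M) :
    (cotensorMap M X).rTensor H (tensorCoact M X t) =
    ((TensorProduct.assoc K _ _ _).symm.toLinearMap ∘ₗ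
      ((TensorProduct.assoc K _ _ _).symm.toLinearMap ∘ₗ
       (rcoact (K := K) (H := H) (M := M)).lTensor H).lTensor X.carrier) (cotensorMap M X t) := by
  induction t with
  | zero => simp only [LinearMap.map_zero, LinearEquiv.map_zero, TensorProduct.tmul_zero, TensorProduct.zero_tmul, sub_zero, Submodule.coe_zero]
  | add a b ha hb => simp only [LinearMap.map_add, LinearEquiv.map_add, ha, hb]
  | tmul x m =>
    have h1 : ∀ (u : X.carrier ⊗[K] H) (v : M ⊗[K] H) (f : X.carrier →ₗ[K] X.carrier ⊗[K] H)
        (_ : f x = u),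
        (((TensorProduct.assoc K X.carrier H M).toLinearMap ∘ₗ f.rTensor M).rTensor H)
          ((TensorProduct.assoc K X.carrier M H).symm (x ⊗ₜ v)) =
        (TensorProduct.assoc K _ _ _).symm ((TensorProduct.assoc K _ _ _).symm.toLinearMap.lTensor
          X.carrier (TensorProduct.assoc K X.carrier H (M ⊗[K] H) (u ⊗ₜ v))) := by
      intro u v f hf
      induction v with
      | zero => simp only [LinearMap.map_zero, LinearEquiv.map_zero, TensorProduct.tmul_zero, TensorProduct.zero_tmul, sub_zero, Submodule.coe_zero]
      | add a b ha hb => simp only [TensorProduct.tmul_add, LinearMap.map_add, LinearEquiv.map_add, ha, hb]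
      | tmul m h =>
        simp only [TensorProduct.assoc_symm_tmul, LinearMap.rTensor_tmul, LinearMap.comp_apply, hf,
          LinearEquiv.coe_coe]
        clear hf
        induction u with
        | zero => simp only [LinearMap.map_zero, LinearEquiv.map_zero, TensorProduct.tmul_zero, TensorProduct.zero_tmul, sub_zero, Submodule.coe_zero]
        | add a b ha hb => simp only [TensorProduct.add_tmul, LinearMap.map_add, LinearEquiv.map_add, ha, hb]
        | tmul y g => simp
    have h2 : ∀ (v : M ⊗[K] H),
        ((lcoact (K := K) (H := H) (M := M)).lTensor X.carrier).rTensor H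
          ((TensorProduct.assoc K X.carrier M H).symm (x ⊗ₜ v)) =
        (TensorProduct.assoc K _ _ _).symm (x ⊗ₜ (lcoact (K := K) (H := H) (M := M)).rTensor H v) := by
      intro v
      induction v with
      | zero => simp only [LinearMap.map_zero, LinearEquiv.map_zero, TensorProduct.tmul_zero, TensorProduct.zero_tmul, sub_zero, Submodule.coe_zero]
      | add a b ha hb => simp only [TensorProduct.tmul_add, LinearMap.map_add, LinearEquiv.map_add, ha, hb]
      | tmul m h => simp
    have h3 : (lcoact (K := K) (H := H) (M := M)).rTensor H (rcoact m) =
        (TensorProduct.assoc K H M H).symm ((rcoact (K := K) (H := H) (M := M)).lTensor H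
          (lcoact m)) := by
      rw [LinearEquiv.eq_symm_apply, lcoact_rcoact]
    have h4 : ∀ u : X.carrier ⊗[K] H,
        ((rcoact (K := K) (H := H) (M := M)).lTensor H).lTensor X.carrier
          (TensorProduct.assoc K X.carrier H M (u ⊗ₜ m)) =
        (TensorProduct.assoc K X.carrier H (M ⊗[K] H) (u ⊗ₜ rcoact m)) := by
      intro u
      induction u with
      | zero => simp only [LinearMap.map_zero, LinearEquiv.map_zero, TensorProduct.tmul_zero, TensorProduct.zero_tmul, sub_zero, Submodule.coe_zero]
      | add a b ha hb => simp only [TensorProduct.add_tmul, LinearMap.map_add, LinearEquiv.map_add, ha, hb]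
      | tmul y g => simp
    have h5 := h1 (X.coact x) (rcoact m) X.coact rfl
    rw [← h4] at h5
    simp only [cotensorMap, tensorCoact, LinearMap.rTensor_sub, LinearMap.comp_apply,
      LinearMap.sub_apply, LinearMap.lTensor_tmul, LinearEquiv.coe_coe, map_sub, h5, h2, h3,
      LinearMap.lTensor_comp, LinearMap.rTensor_tmul]

theorem tensorCoact_coassoc (X : RightComodule K H) (t : X.carrier ⊗[K] M) :
    TensorProduct.assoc K _ H H ((tensorCoact M X).rTensor H (tensorCoact M X t)) =
    (comul (R := K)).lTensor (X.carrier ⊗[K] M) (tensorCoact M X t) := by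
  induction t with
  | zero => simp only [LinearMap.map_zero, LinearEquiv.map_zero, TensorProduct.tmul_zero, TensorProduct.zero_tmul, sub_zero, Submodule.coe_zero]
  | add a b ha hb => simp only [LinearMap.map_add, LinearEquiv.map_add, ha, hb]
  | tmul x m =>
    have h1 : ∀ v : M ⊗[K] H, TensorProduct.assoc K _ H H ((tensorCoact M X).rTensor H
        ((TensorProduct.assoc K X.carrier M H).symm (x ⊗ₜ v))) =
        (TensorProduct.assoc K _ _ _).symm (x ⊗ₜ (TensorProduct.assoc K _ _ _)
          ((rcoact (K := K) (H := H) (M := M)).rTensor H v)) := by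
      intro v
      induction v with
      | zero => simp only [LinearMap.map_zero, LinearEquiv.map_zero, TensorProduct.tmul_zero, TensorProduct.zero_tmul, sub_zero, Submodule.coe_zero]
      | add a b ha hb => simp only [TensorProduct.tmul_add, LinearMap.map_add, LinearEquiv.map_add, ha, hb]
      | tmul m h =>
        simp only [tensorCoact, TensorProduct.assoc_symm_tmul, LinearMap.rTensor_tmul,
          LinearMap.comp_apply, LinearMap.lTensor_tmul, LinearEquiv.coe_coe]
        generalize (rcoact m : M ⊗[K] H) = w
        induction w with
        | zero => simp only [LinearMap.map_zero, LinearEquiv.map_zero, TensorProduct.tmul_zero, TensorProduct.zero_tmul, sub_zero, Submodule.coe_zero]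
        | add a b ha hb => simp only [TensorProduct.tmul_add, TensorProduct.add_tmul, LinearMap.map_add, LinearEquiv.map_add, ha, hb]
        | tmul m h => simp
    have h2 : ∀ v : M ⊗[K] H, (comul (R := K)).lTensor (X.carrier ⊗[K] M)
        ((TensorProduct.assoc K X.carrier M H).symm (x ⊗ₜ v)) =
        (TensorProduct.assoc K _ _ _).symm (x ⊗ₜ ((comul (R := K) (A := H)).lTensor M v)) := by
      intro v
      induction v with
      | zero => simp only [LinearMap.map_zero, LinearEquiv.map_zero, TensorProduct.tmul_zero, TensorProduct.zero_tmul, sub_zero, Submodule.coe_zero]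
      | add a b ha hb => simp only [TensorProduct.tmul_add, LinearMap.map_add, LinearEquiv.map_add, ha, hb]
      | tmul m h => simp
    have h0 : tensorCoact M X (x ⊗ₜ m) =
      (TensorProduct.assoc K X.carrier M H).symm (x ⊗ₜ rcoact m) := rfl
    rw [h0, h1, h2, rcoact_coassoc]

theorem tensorCoact_counit (X : RightComodule K H) (t : X.carrier ⊗[K] M) :
    TensorProduct.rid K _ ((counit (R := K)).lTensor (X.carrier ⊗[K] M) (tensorCoact M X t)) =
      t := by
  induction t with
  | zero => simp only [LinearMap.map_zero, LinearEquiv.map_zero, TensorProduct.tmul_zero, TensorProduct.zero_tmul, sub_zero, Submodule.coe_zero]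
  | add a b ha hb => simp only [LinearMap.map_add, LinearEquiv.map_add, ha, hb]
  | tmul x m =>
    have h1 : ∀ v : M ⊗[K] H,
        TensorProduct.rid K _ ((counit (R := K)).lTensor (X.carrier ⊗[K] M)
        ((TensorProduct.assoc K X.carrier M H).symm (x ⊗ₜ v))) =
        x ⊗ₜ TensorProduct.rid K _ ((counit (R := K) (A := H)).lTensor M v) := by
      intro v
      induction v with
      | zero => simp only [LinearMap.map_zero, LinearEquiv.map_zero, TensorProduct.tmul_zero, TensorProduct.zero_tmul, sub_zero, Submodule.coe_zero]
      | add a b ha hb => simp only [TensorProduct.tmul_add, LinearMap.map_add, LinearEquiv.map_add, ha, hb]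
      | tmul m h => simp
    have h0 : tensorCoact M X (x ⊗ₜ m) =
      (TensorProduct.assoc K X.carrier M H).symm (x ⊗ₜ rcoact m) := rfl
    rw [h0, h1, rcoact_counit]

theorem rTensor_injective {Y Z : Type*} [AddCommGroup Y] [Module K Y] [AddCommGroup Z] [Module K Z]
    (A : Type*) [AddCommGroup A] [Module K A] (f : Y →ₗ[K] Z) (hf : Function.Injective f) :
    Function.Injective (f.rTensor A) :=
  Module.Flat.rTensor_preserves_injective_linearMap _ hf

theorem lTensor_injective {Y Z : Type*} [AddCommGroup Y] [Module K Y] [AddCommGroup Z] [Module K Z]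
    (A : Type*) [AddCommGroup A] [Module K A] (f : Y →ₗ[K] Z) (hf : Function.Injective f) :
    Function.Injective (f.lTensor A) :=
  Module.Flat.lTensor_preserves_injective_linearMap _ hf

/-- The right coaction `x ⊗ m ↦ x ⊗ ρ_r(m)` restricted to the cotensor product. -/
noncomputable def cotensorCoact (X : RightComodule K H) :
    LinearMap.ker (cotensorMap M X) →ₗ[K] LinearMap.ker (cotensorMap M X) ⊗[K] H :=
  corestrictR (cotensorMap M X) (tensorCoact M X ∘ₗ (LinearMap.ker (cotensorMap M X)).subtype)
    fun x => by
      simp only [LinearMap.comp_apply, Submodule.subtype_apply]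
      rw [cotensorMap_tensorCoact, LinearMap.mem_ker.1 x.2, map_zero]

theorem cotensorCoact_spec (X : RightComodule K H) (x : LinearMap.ker (cotensorMap M X)) :
    (LinearMap.ker (cotensorMap M X)).subtype.rTensor H (cotensorCoact M X x) =
      tensorCoact M X (x : X.carrier ⊗[K] M) :=
  corestrictR_spec _ _ _ x

/-- The cotensor product `X □_H M`, a right comodule through the right coaction of `M`. -/
noncomputable def cotensor (X : RightComodule K H) : RightComodule K H where
  carrier := LinearMap.ker (cotensorMap M X)
  coact := cotensorCoact M X
  coassoc x := by
    apply rTensor_injective (H ⊗[K] H) _ (LinearMap.ker (cotensorMap M X)).injective_subtype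
    have h1 : ∀ u : LinearMap.ker (cotensorMap M X) ⊗[K] H,
        (LinearMap.ker (cotensorMap M X)).subtype.rTensor (H ⊗[K] H)
          (TensorProduct.assoc K _ H H ((cotensorCoact M X).rTensor H u)) =
        TensorProduct.assoc K _ H H ((tensorCoact M X).rTensor H
          ((LinearMap.ker (cotensorMap M X)).subtype.rTensor H u)) := by
      intro u
      induction u with
      | zero => simp only [LinearMap.map_zero, LinearEquiv.map_zero, TensorProduct.tmul_zero, TensorProduct.zero_tmul, sub_zero, Submodule.coe_zero]
      | add a b ha hb => simp only [LinearMap.map_add, LinearEquiv.map_add, ha, hb]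
      | tmul y h =>
        simp only [LinearMap.rTensor_tmul, Submodule.subtype_apply]
        rw [← cotensorCoact_spec]
        generalize cotensorCoact M X y = w
        induction w with
        | zero => simp only [LinearMap.map_zero, LinearEquiv.map_zero, TensorProduct.tmul_zero, TensorProduct.zero_tmul, sub_zero, Submodule.coe_zero]
        | add a b ha hb => simp only [TensorProduct.add_tmul, LinearMap.map_add, LinearEquiv.map_add, ha, hb]
        | tmul m h => simp
    rw [h1, cotensorCoact_spec, tensorCoact_coassoc, ← cotensorCoact_spec]
    generalize cotensorCoact M X x = w
    induction w with
    | zero => simp only [LinearMap.map_zero, LinearEquiv.map_zero, TensorProduct.tmul_zero, TensorProduct.zero_tmul, sub_zero, Submodule.coe_zero]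
    | add a b ha hb => simp only [LinearMap.map_add, LinearEquiv.map_add, ha, hb]
    | tmul m h => simp
  counit x := by
    apply (LinearMap.ker (cotensorMap M X)).injective_subtype
    rw [Submodule.subtype_apply, Submodule.subtype_apply, ← tensorCoact_counit M X x,
      ← cotensorCoact_spec]
    generalize cotensorCoact M X x = w
    induction w with
    | zero => simp only [LinearMap.map_zero, LinearEquiv.map_zero, TensorProduct.tmul_zero, TensorProduct.zero_tmul, sub_zero, Submodule.coe_zero]
    | add a b ha hb => simp only [LinearMap.map_add, LinearEquiv.map_add, Submodule.coe_add, ha, hb]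
    | tmul m h => simp

/-- The inclusion `X □_H M ⊆ X ⊗ M`. -/
noncomputable def cotensorIncl (X : RightComodule K H) :
    (cotensor M X).carrier →ₗ[K] X.carrier ⊗[K] M :=
  (LinearMap.ker (cotensorMap M X)).subtype

theorem cotensorIncl_injective (X : RightComodule K H) :
    Function.Injective (cotensorIncl M X) :=
  Submodule.injective_subtype _

theorem cotensorIncl_coact (X : RightComodule K H) (x : (cotensor M X).carrier) :
    (cotensorIncl M X).rTensor H ((cotensor M X).coact x) =
      tensorCoact M X (cotensorIncl M X x) :=
  cotensorCoact_spec M X x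

theorem cotensorMap_incl (X : RightComodule K H) (x : (cotensor M X).carrier) :
    cotensorMap M X (cotensorIncl M X x) = 0 :=
  LinearMap.mem_ker.1 x.2

variable (K H)

/-- The cotensor powers `M^{□ n}` as right comodules: `M^{□ 0} = H`, `M^{□ 1} = M` and
`M^{□ (n+2)} = M^{□ (n+1)} □_H M`. -/
noncomputable def cotPow : ℕ → RightComodule K H
  | 0 => ⟨H, comul, fun x => by simp, fun x => by simp⟩
  | 1 => ⟨M, rcoact, rcoact_coassoc, rcoact_counit⟩
  | n + 2 => cotensor M (cotPow (n + 1))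

/-- The carrier of the `n`-th cotensor power `M^{□ n}`. -/
abbrev CotPow (n : ℕ) : Type u := (cotPow K H M n).carrier

/-- The inclusion `M^{□ (n+2)} ⊆ M^{□ (n+1)} ⊗ M`. -/
noncomputable def incl (n : ℕ) : CotPow K H M (n + 2) →ₗ[K] CotPow K H M (n + 1) ⊗[K] M :=
  cotensorIncl M (cotPow K H M (n + 1))

theorem incl_injective (n : ℕ) : Function.Injective (incl K H M n) :=
  cotensorIncl_injective M _

/-- The carrier `H ⊕ M ⊕ (M □ M) ⊕ ⋯` of the cotensor coalgebra. -/
def Cot : Type u := ⨁ n, CotPow K H M n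

noncomputable instance : AddCommGroup (Cot K H M) :=
  inferInstanceAs (AddCommGroup (⨁ n, CotPow K H M n))

noncomputable instance : Module K (Cot K H M) :=
  inferInstanceAs (Module K (⨁ n, CotPow K H M n))

end Cotensor

section Deconcatenation

variable {K : Type w} {H M : Type u} [Field K] [Ring H] [HopfAlgebra K H]
  [AddCommGroup M] [Module K M] [HopfBimodule K H M]

open HopfBimodule

/-- The data on a space `X` needed to split off tensor factors from the right: a right coaction
of `H` and a compatible map `X → X ⊗ M` with values in `X □_H M`. -/
structure Splitting (K : Type w) (H M : Type u) [Field K] [Ring H] [HopfAlgebra K H]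
    [AddCommGroup M] [Module K M] [HopfBimodule K H M]
    (X : Type*) [AddCommGroup X] [Module K X] where
  rho : X →ₗ[K] X ⊗[K] H
  tau : X →ₗ[K] X ⊗[K] M
  rho_rho : ∀ x, TensorProduct.assoc K X H H (rho.rTensor H (rho x)) =
    (comul (R := K)).lTensor X (rho x)
  rho_tau : ∀ x, TensorProduct.assoc K X H M (rho.rTensor M (tau x)) =
    (lcoact (K := K) (H := H) (M := M)).lTensor X (tau x)
  tau_rho : ∀ x, TensorProduct.assoc K X M H (tau.rTensor H (rho x)) =
    (rcoact (K := K) (H := H) (M := M)).lTensor X (tau x)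

variable {X X' : Type*} [AddCommGroup X] [Module K X] [AddCommGroup X'] [Module K X']

namespace Splitting

theorem step_ker (s : Splitting K H M X) (P : RightComodule K H)
    (E : X →ₗ[K] X ⊗[K] P.carrier)
    (hE : ∀ x, P.coact.lTensor X (E x) = TensorProduct.assoc K X P.carrier H
      (E.rTensor H (s.rho x))) (x : X) :
    (cotensorMap M P).lTensor X
      (((TensorProduct.assoc K X P.carrier M).toLinearMap ∘ₗ E.rTensor M ∘ₗ s.tau) x) = 0 := by
  have h1 : ∀ t : X ⊗[K] M, (cotensorMap M P).lTensor X
      (TensorProduct.assoc K X P.carrier M (E.rTensor M t)) =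
      TensorProduct.assoc K X P.carrier _ (E.rTensor (H ⊗[K] M)
        (TensorProduct.assoc K X H M (s.rho.rTensor M t))) -
      TensorProduct.assoc K X P.carrier _ (E.rTensor (H ⊗[K] M)
        ((lcoact (K := K) (H := H) (M := M)).lTensor X t)) := by
    intro t
    induction t with
    | zero => simp only [LinearMap.map_zero, LinearEquiv.map_zero, TensorProduct.tmul_zero, TensorProduct.zero_tmul, sub_zero, Submodule.coe_zero]
    | add a b ha hb => simp only [LinearMap.map_add, LinearEquiv.map_add, ha, hb]; abel
    | tmul y m =>
      have h2 : ∀ v : X ⊗[K] P.carrier, (cotensorMap M P).lTensor X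
          (TensorProduct.assoc K X P.carrier M (v ⊗ₜ m)) =
          (TensorProduct.assoc K P.carrier H M).toLinearMap.lTensor X
            (TensorProduct.assoc K X _ M (P.coact.lTensor X v ⊗ₜ m)) -
          TensorProduct.assoc K X P.carrier _ (v ⊗ₜ lcoact m) := by
        intro v
        induction v with
        | zero => simp only [LinearMap.map_zero, LinearEquiv.map_zero, TensorProduct.tmul_zero, TensorProduct.zero_tmul, sub_zero, Submodule.coe_zero]
        | add a b ha hb => simp only [LinearMap.map_add, LinearEquiv.map_add, TensorProduct.add_tmul, ha, hb]; abel
        | tmul z p =>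
          simp only [cotensorMap, TensorProduct.assoc_tmul, LinearMap.lTensor_tmul,
            LinearMap.sub_apply, TensorProduct.tmul_sub, LinearMap.comp_apply,
            LinearMap.rTensor_tmul, LinearEquiv.coe_coe]
      rw [LinearMap.rTensor_tmul, h2, hE, LinearMap.rTensor_tmul, LinearMap.lTensor_tmul]
      congr 1
      · generalize s.rho y = w
        induction w with
        | zero => simp only [LinearMap.map_zero, LinearEquiv.map_zero, TensorProduct.tmul_zero, TensorProduct.zero_tmul, sub_zero, Submodule.coe_zero]
        | add a b ha hb => simp only [LinearMap.map_add, LinearEquiv.map_add, TensorProduct.add_tmul, ha, hb]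
        | tmul z h =>
          simp only [LinearMap.rTensor_tmul, TensorProduct.assoc_tmul]
          generalize E z = w
          induction w with
          | zero => simp only [LinearMap.map_zero, LinearEquiv.map_zero, TensorProduct.tmul_zero, TensorProduct.zero_tmul, sub_zero, Submodule.coe_zero]
          | add a b ha hb => simp only [LinearMap.map_add, LinearEquiv.map_add, TensorProduct.add_tmul, ha, hb]
          | tmul z h => simp
  simp only [LinearMap.comp_apply, LinearEquiv.coe_coe]
  rw [h1, s.rho_tau, sub_self]

/-- One step of the recursion defining `split`. -/
noncomputable def step (s : Splitting K H M X) (P : RightComodule K H)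
    (E : X →ₗ[K] X ⊗[K] P.carrier)
    (hE : ∀ x, P.coact.lTensor X (E x) = TensorProduct.assoc K X P.carrier H
      (E.rTensor H (s.rho x))) : X →ₗ[K] X ⊗[K] (cotensor M P).carrier :=
  corestrictL (cotensorMap M P)
    ((TensorProduct.assoc K X P.carrier M).toLinearMap ∘ₗ E.rTensor M ∘ₗ s.tau)
    (s.step_ker P E hE)

theorem step_spec (s : Splitting K H M X) (P : RightComodule K H)
    (E : X →ₗ[K] X ⊗[K] P.carrier)
    (hE : ∀ x, P.coact.lTensor X (E x) = TensorProduct.assoc K X P.carrier H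
      (E.rTensor H (s.rho x))) (x : X) :
    (cotensorIncl M P).lTensor X (s.step P E hE x) =
      TensorProduct.assoc K X P.carrier M (E.rTensor M (s.tau x)) :=
  corestrictL_spec _ _ _ x

theorem step_coact (s : Splitting K H M X) (P : RightComodule K H)
    (E : X →ₗ[K] X ⊗[K] P.carrier)
    (hE : ∀ x, P.coact.lTensor X (E x) = TensorProduct.assoc K X P.carrier H
      (E.rTensor H (s.rho x))) (x : X) :
    (cotensor M P).coact.lTensor X (s.step P E hE x) =
      TensorProduct.assoc K X (cotensor M P).carrier H ((s.step P E hE).rTensor H (s.rho x)) := by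
  have hinj : Function.Injective (((cotensorIncl M P).rTensor H).lTensor X) :=
    lTensor_injective X _ (rTensor_injective H _ (cotensorIncl_injective M P))
  apply hinj
  have h1 : ∀ v : X ⊗[K] (cotensor M P).carrier,
      ((cotensorIncl M P).rTensor H).lTensor X
        ((cotensor M P).coact.lTensor X v) =
      (tensorCoact M P).lTensor X ((cotensorIncl M P).lTensor X v) := by
    intro v
    induction v with
    | zero => simp only [LinearMap.map_zero, LinearEquiv.map_zero, TensorProduct.tmul_zero, TensorProduct.zero_tmul, sub_zero, Submodule.coe_zero]
    | add a b ha hb => simp only [LinearMap.map_add, LinearEquiv.map_add, ha, hb]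
    | tmul z p =>
      rw [LinearMap.lTensor_tmul, LinearMap.lTensor_tmul, LinearMap.lTensor_tmul,
        LinearMap.lTensor_tmul]
      rw [cotensorIncl_coact]
  have h2 : ∀ v : X ⊗[K] H,
      ((cotensorIncl M P).rTensor H).lTensor X
        (TensorProduct.assoc K X (cotensor M P).carrier H ((s.step P E hE).rTensor H v)) =
      TensorProduct.assoc K X _ H ((TensorProduct.assoc K X P.carrier M).toLinearMap.rTensor H
        ((E.rTensor M).rTensor H (s.tau.rTensor H v))) := by
    intro v
    induction v with
    | zero => simp only [LinearMap.map_zero, LinearEquiv.map_zero, TensorProduct.tmul_zero, TensorProduct.zero_tmul, sub_zero, Submodule.coe_zero]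
    | add a b ha hb => simp only [LinearMap.map_add, LinearEquiv.map_add, ha, hb]
    | tmul z p =>
      simp only [LinearMap.rTensor_tmul, LinearEquiv.coe_coe]
      rw [← s.step_spec P E hE]
      generalize s.step P E hE z = w
      induction w with
      | zero => simp only [LinearMap.map_zero, LinearEquiv.map_zero, TensorProduct.tmul_zero, TensorProduct.zero_tmul, sub_zero, Submodule.coe_zero]
      | add a b ha hb => simp only [LinearMap.map_add, LinearEquiv.map_add, TensorProduct.add_tmul, ha, hb]
      | tmul h m => simp
  have h3 : ∀ v : (X ⊗[K] M) ⊗[K] H,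
      TensorProduct.assoc K X _ H ((TensorProduct.assoc K X P.carrier M).toLinearMap.rTensor H
        ((E.rTensor M).rTensor H v)) = (TensorProduct.assoc K _ _ _).symm.toLinearMap.lTensor X
        (TensorProduct.assoc K _ _ _ (E.rTensor (M ⊗[K] H) (TensorProduct.assoc K _ _ _ v))) := by
    intro v
    induction v with
    | zero => simp only [LinearMap.map_zero, LinearEquiv.map_zero, TensorProduct.tmul_zero, TensorProduct.zero_tmul, sub_zero, Submodule.coe_zero]
    | add a b ha hb => simp only [LinearMap.map_add, LinearEquiv.map_add, ha, hb]
    | tmul z p =>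
      induction z with
      | zero => simp only [LinearMap.map_zero, LinearEquiv.map_zero, TensorProduct.tmul_zero, TensorProduct.zero_tmul, sub_zero, Submodule.coe_zero]
      | add a b ha hb => simp only [LinearMap.map_add, LinearEquiv.map_add, TensorProduct.add_tmul, ha, hb]
      | tmul h m =>
        simp only [LinearMap.rTensor_tmul, TensorProduct.assoc_tmul]
        generalize E h = w
        induction w with
        | zero => simp only [LinearMap.map_zero, LinearEquiv.map_zero, TensorProduct.tmul_zero, TensorProduct.zero_tmul, sub_zero, Submodule.coe_zero]
        | add a b ha hb => simp only [LinearMap.map_add, LinearEquiv.map_add, TensorProduct.add_tmul, ha, hb]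
        | tmul h m => simp
  have h4 : ∀ v : X ⊗[K] M, (tensorCoact M P).lTensor X
      (TensorProduct.assoc K X P.carrier M (E.rTensor M v)) =
      (TensorProduct.assoc K _ _ _).symm.toLinearMap.lTensor X
        (TensorProduct.assoc K _ _ _ (E.rTensor (M ⊗[K] H)
          ((rcoact (K := K) (H := H) (M := M)).lTensor X v))) := by
    intro v
    induction v with
    | zero => simp only [LinearMap.map_zero, LinearEquiv.map_zero, TensorProduct.tmul_zero, TensorProduct.zero_tmul, sub_zero, Submodule.coe_zero]
    | add a b ha hb => simp only [LinearMap.map_add, LinearEquiv.map_add, ha, hb]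
    | tmul z m =>
      simp only [LinearMap.rTensor_tmul, LinearMap.lTensor_tmul]
      generalize E z = w
      induction w with
      | zero => simp only [LinearMap.map_zero, LinearEquiv.map_zero, TensorProduct.tmul_zero, TensorProduct.zero_tmul, sub_zero, Submodule.coe_zero]
      | add a b ha hb => simp only [LinearMap.map_add, LinearEquiv.map_add, TensorProduct.add_tmul, ha, hb]
      | tmul h p =>
        simp only [TensorProduct.assoc_tmul, LinearMap.lTensor_tmul, tensorCoact,
          LinearMap.comp_apply, LinearEquiv.coe_coe]
  rw [h1, h2, h3, s.tau_rho, s.step_spec, h4]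

/-- Auxiliary recursion for `split`. -/
noncomputable def splitAux (s : Splitting K H M X) : (k : ℕ) →
    {E : X →ₗ[K] X ⊗[K] CotPow K H M k //
      ∀ x, (cotPow K H M k).coact.lTensor X (E x) =
        TensorProduct.assoc K X (CotPow K H M k) H (E.rTensor H (s.rho x))}
  | 0 => ⟨s.rho, fun x => (s.rho_rho x).symm⟩
  | 1 => ⟨s.tau, fun x => (s.tau_rho x).symm⟩
  | k + 2 => ⟨s.step (cotPow K H M (k + 1)) (s.splitAux (k + 1)).1 (s.splitAux (k + 1)).2,
      s.step_coact (cotPow K H M (k + 1)) (s.splitAux (k + 1)).1 (s.splitAux (k + 1)).2⟩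

/-- The map `X → X ⊗ M^{□ k}` that splits off the last `k` tensor factors: `rho` for `k = 0`,
`tau` for `k = 1`, and `split (k + 2) = (split (k + 1) ⊗ M) ∘ tau`. -/
noncomputable def split (s : Splitting K H M X) (k : ℕ) : X →ₗ[K] X ⊗[K] CotPow K H M k :=
  (s.splitAux k).1

theorem coact_split (s : Splitting K H M X) (k : ℕ) (x : X) :
    (cotPow K H M k).coact.lTensor X (s.split k x) =
      TensorProduct.assoc K X (CotPow K H M k) H ((s.split k).rTensor H (s.rho x)) :=
  (s.splitAux k).2 x

theorem split_zero (s : Splitting K H M X) : s.split 0 = s.rho := rfl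

theorem split_one (s : Splitting K H M X) : s.split 1 = s.tau := rfl

theorem incl_split (s : Splitting K H M X) (k : ℕ) (x : X) :
    (incl K H M k).lTensor X (s.split (k + 2) x) =
      TensorProduct.assoc K X (CotPow K H M (k + 1)) M ((s.split (k + 1)).rTensor M (s.tau x)) :=
  s.step_spec _ _ (s.splitAux (k + 1)).2 x

theorem split_naturality (s : Splitting K H M X) (s' : Splitting K H M X') (f : X →ₗ[K] X')
    (h0 : ∀ x, s'.rho (f x) = f.rTensor H (s.rho x))
    (h1 : ∀ x, s'.tau (f x) = f.rTensor M (s.tau x)) (k : ℕ) (x : X) :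
    s'.split k (f x) = f.rTensor (CotPow K H M k) (s.split k x) := by
  induction k generalizing x with
  | zero => exact h0 x
  | succ k ih =>
    cases k with
    | zero => exact h1 x
    | succ k =>
      apply lTensor_injective X' _ (incl_injective K H M k)
      have h2 : ∀ v : X ⊗[K] CotPow K H M (k + 2),
          (incl K H M k).lTensor X' (f.rTensor (CotPow K H M (k + 2)) v) =
          f.rTensor _ ((incl K H M k).lTensor X v) := by
        intro v
        induction v with
        | zero => simp only [LinearMap.map_zero, LinearEquiv.map_zero, TensorProduct.tmul_zero, TensorProduct.zero_tmul, sub_zero, Submodule.coe_zero]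
        | add a b ha hb => simp only [LinearMap.map_add, LinearEquiv.map_add, ha, hb]
        | tmul h m => simp
      have h3 : ∀ v : X ⊗[K] M,
          TensorProduct.assoc K X' (CotPow K H M (k + 1)) M
            ((s'.split (k + 1)).rTensor M (f.rTensor M v)) =
          f.rTensor _ (TensorProduct.assoc K X (CotPow K H M (k + 1)) M
            ((s.split (k + 1)).rTensor M v)) := by
        intro v
        induction v with
        | zero => simp only [LinearMap.map_zero, LinearEquiv.map_zero, TensorProduct.tmul_zero, TensorProduct.zero_tmul, sub_zero, Submodule.coe_zero]
        | add a b ha hb => simp only [LinearMap.map_add, LinearEquiv.map_add, ha, hb]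
        | tmul y m =>
          simp only [LinearMap.rTensor_tmul, ih]
          generalize s.split (k + 1) y = w
          induction w with
          | zero => simp only [LinearMap.map_zero, LinearEquiv.map_zero, TensorProduct.tmul_zero, TensorProduct.zero_tmul, sub_zero, Submodule.coe_zero]
          | add a b ha hb => simp only [LinearMap.map_add, LinearEquiv.map_add, TensorProduct.add_tmul, ha, hb]
          | tmul h m => simp
      rw [h2, incl_split, incl_split, h1, h3]

end Splitting

end Deconcatenation

section TensorDirectSum

variable {K : Type w} [Field K] {P : ℕ → Type u} [∀ n, AddCommGroup (P n)] [∀ n, Module K (P n)]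
  {A : Type*} [AddCommGroup A] [Module K A]

theorem tensor_directSum_ext (v w : A ⊗[K] (⨁ n, P n))
    (h : ∀ k, (DirectSum.component K ℕ P k).lTensor A v =
      (DirectSum.component K ℕ P k).lTensor A w) : v = w := by
  apply (TensorProduct.directSumRight K K A P).injective
  have h1 : ∀ (v : A ⊗[K] (⨁ n, P n)) (k : ℕ),
      TensorProduct.directSumRight K K A P v k = (DirectSum.component K ℕ P k).lTensor A v := by
    intro v k
    induction v with
    | zero => simp
    | add a b ha hb => rw [map_add, DirectSum.add_apply, ha, hb, map_add]
    | tmul a x => rw [TensorProduct.directSumRight_tmul]; rfl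
  ext1 k
  rw [h1, h1, h]

open Classical in
/-- A locally finite family of linear maps, as a map into the direct sum. -/
noncomputable def toDirectSum (g : ∀ k, A →ₗ[K] P k)
    (h : ∀ a, ∃ N : ℕ, ∀ k, N < k → g k a = 0) : A →ₗ[K] ⨁ k, P k :=
  have key : ∀ a k, DirectSum.component K ℕ P k
      (∑ j ∈ Finset.range ((h a).choose + 1), DirectSum.lof K ℕ P j (g j a)) = g k a := by
    intro a k
    rw [map_sum, Finset.sum_eq_single k]
    · exact DirectSum.component.lof_self K k _
    · intro j _ hj
      rw [DirectSum.component.of, dif_neg hj]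
    · intro hk
      rw [DirectSum.component.lof_self]
      exact (h a).choose_spec k (by simpa using hk)
  { toFun := fun a => ∑ j ∈ Finset.range ((h a).choose + 1), DirectSum.lof K ℕ P j (g j a)
    map_add' := fun a b => DirectSum.ext_component K fun k => by
      rw [map_add, key, key, key, map_add]
    map_smul' := fun c a => DirectSum.ext_component K fun k => by
      rw [map_smul, key, key, map_smul, RingHom.id_apply] }

theorem component_toDirectSum (g : ∀ k, A →ₗ[K] P k)
    (h : ∀ a, ∃ N : ℕ, ∀ k, N < k → g k a = 0) (a : A) (k : ℕ) :
    DirectSum.component K ℕ P k (toDirectSum g h a) = g k a := by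
  change DirectSum.component K ℕ P k
      (∑ j ∈ Finset.range ((h a).choose + 1), DirectSum.lof K ℕ P j (g j a)) = g k a
  rw [map_sum, Finset.sum_eq_single k]
  · exact DirectSum.component.lof_self K k _
  · intro j _ hj
    rw [DirectSum.component.of, dif_neg hj]
  · intro hk
    rw [DirectSum.component.lof_self]
    exact (h a).choose_spec k (by simpa using hk)

end TensorDirectSum

section Naturality

variable {K : Type*} [Field K] {X Y Z A B C : Type*}
  [AddCommGroup X] [Module K X] [AddCommGroup Y] [Module K Y]
  [AddCommGroup Z] [Module K Z] [AddCommGroup A] [Module K A]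
  [AddCommGroup B] [Module K B] [AddCommGroup C] [Module K C]

theorem assoc_rTensor_rTensor (f : X →ₗ[K] Y) (v : (X ⊗[K] A) ⊗[K] B) :
    TensorProduct.assoc K Y A B ((f.rTensor A).rTensor B v) =
      f.rTensor (A ⊗[K] B) (TensorProduct.assoc K X A B v) :=
  LinearMap.congr_fun (f := (TensorProduct.assoc K Y A B).toLinearMap ∘ₗ (f.rTensor A).rTensor B)
    (g := f.rTensor (A ⊗[K] B) ∘ₗ (TensorProduct.assoc K X A B).toLinearMap)
    (TensorProduct.ext_threefold fun _ _ _ => rfl) v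

theorem assoc_lTensor_rTensor (f : A →ₗ[K] B) (v : (X ⊗[K] A) ⊗[K] Y) :
    TensorProduct.assoc K X B Y ((f.lTensor X).rTensor Y v) =
      (f.rTensor Y).lTensor X (TensorProduct.assoc K X A Y v) :=
  LinearMap.congr_fun (f := (TensorProduct.assoc K X B Y).toLinearMap ∘ₗ (f.lTensor X).rTensor Y)
    (g := (f.rTensor Y).lTensor X ∘ₗ (TensorProduct.assoc K X A Y).toLinearMap)
    (TensorProduct.ext_threefold fun _ _ _ => rfl) v

theorem assoc_lTensor (f : A →ₗ[K] B) (v : (X ⊗[K] Y) ⊗[K] A) :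
    TensorProduct.assoc K X Y B (f.lTensor (X ⊗[K] Y) v) =
      (f.lTensor Y).lTensor X (TensorProduct.assoc K X Y A v) :=
  LinearMap.congr_fun (f := (TensorProduct.assoc K X Y B).toLinearMap ∘ₗ f.lTensor (X ⊗[K] Y))
    (g := (f.lTensor Y).lTensor X ∘ₗ (TensorProduct.assoc K X Y A).toLinearMap)
    (TensorProduct.ext_threefold fun _ _ _ => rfl) v

theorem lTensor_rTensor (f : X →ₗ[K] Y) (g : A →ₗ[K] B) (v : X ⊗[K] A) :
    g.lTensor Y (f.rTensor A v) = f.rTensor B (g.lTensor X v) :=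
  LinearMap.congr_fun (f := g.lTensor Y ∘ₗ f.rTensor A) (g := f.rTensor B ∘ₗ g.lTensor X)
    (TensorProduct.ext' fun _ _ => rfl) v

theorem rTensor_congr {F : Y →ₗ[K] Z} {f : X →ₗ[K] Y} {F' : A →ₗ[K] Z} {f' : X →ₗ[K] A}
    (h : ∀ x, F (f x) = F' (f' x)) (v : X ⊗[K] B) :
    F.rTensor B (f.rTensor B v) = F'.rTensor B (f'.rTensor B v) := by
  have : F ∘ₗ f = F' ∘ₗ f' := LinearMap.ext h
  rw [← LinearMap.comp_apply, ← LinearMap.comp_apply, ← LinearMap.rTensor_comp, this,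
    LinearMap.rTensor_comp]

theorem lTensor_congr {F : Y →ₗ[K] Z} {f : X →ₗ[K] Y} {F' : A →ₗ[K] Z} {f' : X →ₗ[K] A}
    (h : ∀ x, F (f x) = F' (f' x)) (v : B ⊗[K] X) :
    F.lTensor B (f.lTensor B v) = F'.lTensor B (f'.lTensor B v) := by
  have : F ∘ₗ f = F' ∘ₗ f' := LinearMap.ext h
  rw [← LinearMap.comp_apply, ← LinearMap.comp_apply, ← LinearMap.lTensor_comp, this,
    LinearMap.lTensor_comp]

end Naturality

section CotCoalgebra

variable (K : Type w) (H M : Type u) [Field K] [Ring H] [HopfAlgebra K H]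
  [AddCommGroup M] [Module K M] [HopfBimodule K H M]

open HopfBimodule

/-- The inclusion of `M^{□ n}` into `Cot_H(M)`. -/
noncomputable def cotOf (n : ℕ) : CotPow K H M n →ₗ[K] Cot K H M :=
  DirectSum.lof K ℕ (fun n => CotPow K H M n) n

/-- The projection of `Cot_H(M)` onto `M^{□ n}`. -/
noncomputable def cotComp (n : ℕ) : Cot K H M →ₗ[K] CotPow K H M n :=
  DirectSum.component K ℕ (fun n => CotPow K H M n) n

/-- The inclusion of `H = M^{□ 0}` into `Cot_H(M)`. -/
noncomputable def ofH : H →ₗ[K] Cot K H M := cotOf K H M 0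

/-- The inclusion of `M = M^{□ 1}` into `Cot_H(M)`. -/
noncomputable def ofM : M →ₗ[K] Cot K H M := cotOf K H M 1

/-- The projection of `Cot_H(M)` onto `H`. -/
noncomputable def compH : Cot K H M →ₗ[K] H := cotComp K H M 0

/-- The projection of `Cot_H(M)` onto `M`. -/
noncomputable def compM : Cot K H M →ₗ[K] M := cotComp K H M 1

variable {K H M}

theorem cotComp_cotOf (n : ℕ) (x : CotPow K H M n) : cotComp K H M n (cotOf K H M n x) = x :=
  DirectSum.component.lof_self K n x

theorem cotComp_cotOf_ne {m n : ℕ} (h : m ≠ n) (x : CotPow K H M n) :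
    cotComp K H M m (cotOf K H M n x) = 0 := by
  have := DirectSum.component.of (R := K) (M := fun n => CotPow K H M n) m n x
  rw [dif_neg (Ne.symm h)] at this
  exact this

theorem compH_ofH (x : H) : compH K H M (ofH K H M x) = x := cotComp_cotOf 0 x

theorem compM_ofM (x : M) : compM K H M (ofM K H M x) = x := cotComp_cotOf 1 x

theorem cotComp_ofH {k : ℕ} (h : k ≠ 0) (x : H) : cotComp K H M k (ofH K H M x) = 0 :=
  cotComp_cotOf_ne h x

theorem cotComp_ofM {k : ℕ} (h : k ≠ 1) (x : M) : cotComp K H M k (ofM K H M x) = 0 :=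
  cotComp_cotOf_ne h x

theorem compH_of {n : ℕ} (h : n ≠ 0) (x : CotPow K H M n) : compH K H M (cotOf K H M n x) = 0 :=
  cotComp_cotOf_ne h.symm x

theorem compM_of {n : ℕ} (h : n ≠ 1) (x : CotPow K H M n) : compM K H M (cotOf K H M n x) = 0 :=
  cotComp_cotOf_ne h.symm x

theorem compH_ofM (x : M) : compH K H M (ofM K H M x) = 0 := cotComp_ofM (by decide) x

theorem compM_ofH (x : H) : compM K H M (ofH K H M x) = 0 := cotComp_ofH (by decide) x

theorem cot_ext {x y : Cot K H M} (h : ∀ n, cotComp K H M n x = cotComp K H M n y) : x = y :=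
  DirectSum.ext_component K h

theorem cot_hom_ext {A : Type*} [AddCommGroup A] [Module K A] {f g : Cot K H M →ₗ[K] A}
    (h : ∀ n x, f (cotOf K H M n x) = g (cotOf K H M n x)) : f = g :=
  DirectSum.linearMap_ext K fun n => LinearMap.ext (h n)

theorem tensor_cot_ext {A : Type*} [AddCommGroup A] [Module K A] (v w : A ⊗[K] Cot K H M)
    (h : ∀ k, (cotComp K H M k).lTensor A v = (cotComp K H M k).lTensor A w) : v = w :=
  tensor_directSum_ext v w h

variable (K H M)

/-- The right coaction of `H` on `Cot_H(M)`. -/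
noncomputable def cotRho : Cot K H M →ₗ[K] Cot K H M ⊗[K] H :=
  DirectSum.toModule K ℕ _ fun n => (cotOf K H M n).rTensor H ∘ₗ (cotPow K H M n).coact

/-- The map `M^{□ n} → Cot_H(M) ⊗ M` splitting off the last tensor factor. -/
noncomputable def cotTauAux : (n : ℕ) → CotPow K H M n →ₗ[K] Cot K H M ⊗[K] M
  | 0 => 0
  | 1 => (ofH K H M).rTensor M ∘ₗ (lcoact : M →ₗ[K] H ⊗[K] M)
  | n + 2 => (cotOf K H M (n + 1)).rTensor M ∘ₗ incl K H M n

/-- The map `Cot_H(M) → Cot_H(M) ⊗ M` splitting off the last tensor factor: it is `0` on `H`,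
`ρ_l` on `M` and the inclusion `M^{□ (n+2)} ⊆ M^{□ (n+1)} ⊗ M` on `M^{□ (n+2)}`. -/
noncomputable def cotTau : Cot K H M →ₗ[K] Cot K H M ⊗[K] M :=
  DirectSum.toModule K ℕ _ (cotTauAux K H M)

variable {K H M}

theorem cotRho_of (n : ℕ) (x : CotPow K H M n) :
    cotRho K H M (cotOf K H M n x) = (cotOf K H M n).rTensor H ((cotPow K H M n).coact x) :=
  DirectSum.toModule_lof K n x

theorem cotRho_ofH (x : H) :
    cotRho K H M (ofH K H M x) = (ofH K H M).rTensor H (comul x) :=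
  cotRho_of 0 x

theorem cotRho_ofM (x : M) :
    cotRho K H M (ofM K H M x) = (ofM K H M).rTensor H (rcoact x) :=
  cotRho_of 1 x

theorem cotTau_ofH (x : H) : cotTau K H M (ofH K H M x) = 0 :=
  DirectSum.toModule_lof (φ := cotTauAux K H M) K 0 x

theorem cotTau_ofM (x : M) :
    cotTau K H M (ofM K H M x) = (ofH K H M).rTensor M (lcoact x) :=
  DirectSum.toModule_lof (φ := cotTauAux K H M) K 1 x

theorem cotTau_of (n : ℕ) (x : CotPow K H M (n + 2)) :
    cotTau K H M (cotOf K H M (n + 2) x) = (cotOf K H M (n + 1)).rTensor M (incl K H M n x) :=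
  DirectSum.toModule_lof (φ := cotTauAux K H M) K (n + 2) x

theorem cot_ind {p : Cot K H M → Prop} (x : Cot K H M) (hz : p 0)
    (ha : ∀ x y, p x → p y → p (x + y)) (ho : ∀ n x, p (cotOf K H M n x)) : p x :=
  DirectSum.induction_on x hz ho ha

theorem cot_ind_cases {p : Cot K H M → Prop} (x : Cot K H M) (hz : p 0)
    (ha : ∀ x y, p x → p y → p (x + y)) (h0 : ∀ x, p (ofH K H M x)) (h1 : ∀ x, p (ofM K H M x))
    (h2 : ∀ n x, p (cotOf K H M (n + 2) x)) : p x :=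
  cot_ind x hz ha fun n => match n with
    | 0 => h0
    | 1 => h1
    | n + 2 => h2 n

theorem cotRho_rho (x : Cot K H M) :
    TensorProduct.assoc K _ H H ((cotRho K H M).rTensor H (cotRho K H M x)) =
    (comul (R := K)).lTensor (Cot K H M) (cotRho K H M x) := by
  induction x using cot_ind with
  | hz => simp only [LinearMap.map_zero, LinearEquiv.map_zero]
  | ha a b ha hb => simp only [LinearMap.map_add, LinearEquiv.map_add, ha, hb]
  | ho n x =>
    rw [cotRho_of, rTensor_congr (cotRho_of n), assoc_rTensor_rTensor, RightComodule.coassoc,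
      lTensor_rTensor]

theorem cotRho_counit (x : Cot K H M) :
    (counit (R := K) (A := H)).lTensor (Cot K H M) (cotRho K H M x) = x ⊗ₜ 1 := by
  induction x using cot_ind with
  | hz => simp only [LinearMap.map_zero, TensorProduct.zero_tmul]
  | ha a b ha hb => simp only [LinearMap.map_add, TensorProduct.add_tmul, ha, hb]
  | ho n x =>
    have h := (cotPow K H M n).counit x
    rw [← LinearEquiv.eq_symm_apply, TensorProduct.rid_symm_apply] at h
    rw [cotRho_of, lTensor_rTensor, h, LinearMap.rTensor_tmul]

theorem cotRho_tau (x : Cot K H M) :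
    TensorProduct.assoc K _ H M ((cotRho K H M).rTensor M (cotTau K H M x)) =
    (lcoact (K := K) (H := H) (M := M)).lTensor (Cot K H M) (cotTau K H M x) := by
  induction x using cot_ind_cases with
  | hz => simp only [LinearMap.map_zero, LinearEquiv.map_zero]
  | ha a b ha hb => simp only [LinearMap.map_add, LinearEquiv.map_add, ha, hb]
  | h0 x => simp only [cotTau_ofH, LinearMap.map_zero, LinearEquiv.map_zero]
  | h1 x =>
    rw [cotTau_ofM, rTensor_congr cotRho_ofH, assoc_rTensor_rTensor, lcoact_coassoc,
      lTensor_rTensor]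
  | h2 n x =>
    have h := cotensorMap_incl M (cotPow K H M (n + 1)) x
    rw [cotensorMap, LinearMap.sub_apply, sub_eq_zero] at h
    rw [cotTau_of, rTensor_congr (cotRho_of (n + 1)), assoc_rTensor_rTensor, lTensor_rTensor]
    exact congrArg _ h

theorem cotTau_rho (x : Cot K H M) :
    TensorProduct.assoc K _ M H ((cotTau K H M).rTensor H (cotRho K H M x)) =
    (rcoact (K := K) (H := H) (M := M)).lTensor (Cot K H M) (cotTau K H M x) := by
  induction x using cot_ind_cases with
  | hz => simp only [LinearMap.map_zero, LinearEquiv.map_zero]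
  | ha a b ha hb => simp only [LinearMap.map_add, LinearEquiv.map_add, ha, hb]
  | h0 x =>
    rw [cotRho_ofH, cotTau_ofH, rTensor_congr (F' := (0 : H →ₗ[K] _)) (f' := LinearMap.id)
      (fun x => cotTau_ofH x)]
    simp only [LinearMap.rTensor_zero, LinearMap.zero_apply, LinearMap.map_zero,
      LinearEquiv.map_zero]
  | h1 x =>
    rw [cotRho_ofM, cotTau_ofM, rTensor_congr cotTau_ofM, assoc_rTensor_rTensor, lcoact_rcoact,
      lTensor_rTensor]
  | h2 n x =>
    have h := cotensorIncl_coact M (cotPow K H M (n + 1)) x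
    rw [tensorCoact, LinearMap.comp_apply, LinearEquiv.coe_coe, LinearEquiv.eq_symm_apply] at h
    rw [cotRho_of, cotTau_of, rTensor_congr (cotTau_of n), assoc_rTensor_rTensor,
      lTensor_rTensor]
    exact congrArg _ h

variable (K H M) in
/-- Splitting off tensor factors in `Cot_H(M)`. -/
noncomputable def cotSplitting : Splitting K H M (Cot K H M) where
  rho := cotRho K H M
  tau := cotTau K H M
  rho_rho := cotRho_rho
  rho_tau := cotRho_tau
  tau_rho := cotTau_rho

variable (K H M) in
/-- The map `Cot_H(M) → Cot_H(M) ⊗ M^{□ k}` splitting off the last `k` tensor factors. -/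
noncomputable def cotSplit (k : ℕ) : Cot K H M →ₗ[K] Cot K H M ⊗[K] CotPow K H M k :=
  (cotSplitting K H M).split k

theorem cotSplit_zero : cotSplit K H M 0 = cotRho K H M := rfl

theorem cotSplit_one : cotSplit K H M 1 = cotTau K H M := rfl

theorem incl_cotSplit (k : ℕ) (x : Cot K H M) :
    (incl K H M k).lTensor (Cot K H M) (cotSplit K H M (k + 2) x) =
      TensorProduct.assoc K (Cot K H M) (CotPow K H M (k + 1)) M
        ((cotSplit K H M (k + 1)).rTensor M (cotTau K H M x)) :=
  (cotSplitting K H M).incl_split k x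

theorem coact_cotSplit (k : ℕ) (x : Cot K H M) :
    (cotPow K H M k).coact.lTensor (Cot K H M) (cotSplit K H M k x) =
      TensorProduct.assoc K (Cot K H M) (CotPow K H M k) H
        ((cotSplit K H M k).rTensor H (cotRho K H M x)) :=
  (cotSplitting K H M).coact_split k x

theorem rTensor_eq_zero {X Y Z A : Type*} [AddCommGroup X] [Module K X] [AddCommGroup Y]
    [Module K Y] [AddCommGroup Z] [Module K Z] [AddCommGroup A] [Module K A]
    {F : Y →ₗ[K] Z} {f : X →ₗ[K] Y} (h : ∀ x, F (f x) = 0) (v : X ⊗[K] A) :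
    F.rTensor A (f.rTensor A v) = 0 := by
  have : F ∘ₗ f = 0 := LinearMap.ext h
  rw [← LinearMap.comp_apply, ← LinearMap.rTensor_comp, this, LinearMap.rTensor_zero,
    LinearMap.zero_apply]

theorem cotSplit_of_lt {k n : ℕ} (h : n < k) (x : CotPow K H M n) :
    cotSplit K H M k (cotOf K H M n x) = 0 := by
  induction k generalizing n with
  | zero => omega
  | succ k ih =>
    cases k with
    | zero =>
      obtain rfl : n = 0 := by omega
      exact cotTau_ofH (H := H) x
    | succ k =>
      apply lTensor_injective _ _ (incl_injective K H M k)
      rw [incl_cotSplit, LinearMap.map_zero, LinearEquiv.map_eq_zero_iff]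
      match n, h, x with
      | 0, h, x =>
        have h0 : cotTau K H M (cotOf K H M 0 x) = 0 := cotTau_ofH (K := K) (H := H) (M := M) x
        rw [h0, LinearMap.map_zero]
      | 1, h, x =>
        have h0 : cotTau K H M (cotOf K H M 1 x) = _ := cotTau_ofM (K := K) (H := H) (M := M) x
        rw [h0]
        have h1 : ∀ y : H, cotSplit K H M (k + 1) (ofH K H M y) = 0 :=
          fun y => ih (n := 0) (by omega) y
        exact rTensor_eq_zero h1 _
      | n + 2, h, x =>
        rw [cotTau_of]
        exact rTensor_eq_zero (fun x => ih (by omega) x) _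

variable (K H M) in
/-- The comultiplication of `Cot_H(M)`: on `M^{□ n}` it is the sum over `k ≤ n` of the maps
`M^{□ n} → M^{□ (n-k)} ⊗ M^{□ k}` that split off the last `k` tensor factors. -/
noncomputable def cotComul : Cot K H M →ₗ[K] Cot K H M ⊗[K] Cot K H M :=
  DirectSum.toModule K ℕ _ fun n => ∑ k ∈ Finset.range (n + 1),
    (cotOf K H M k).lTensor (Cot K H M) ∘ₗ cotSplit K H M k ∘ₗ cotOf K H M n

theorem cotComul_of (n : ℕ) (x : CotPow K H M n) :
    cotComul K H M (cotOf K H M n x) = ∑ k ∈ Finset.range (n + 1),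
      (cotOf K H M k).lTensor (Cot K H M) (cotSplit K H M k (cotOf K H M n x)) := by
  have := DirectSum.toModule_lof (φ := fun n => ∑ k ∈ Finset.range (n + 1),
    (cotOf K H M k).lTensor (Cot K H M) ∘ₗ cotSplit K H M k ∘ₗ cotOf K H M n) K n x
  refine this.trans ?_
  rw [LinearMap.sum_apply]
  rfl

theorem cotComp_comul (k : ℕ) (x : Cot K H M) :
    (cotComp K H M k).lTensor (Cot K H M) (cotComul K H M x) = cotSplit K H M k x := by
  induction x using cot_ind with
  | hz => simp only [LinearMap.map_zero]
  | ha a b ha hb => simp only [LinearMap.map_add, ha, hb]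
  | ho n x =>
    have hk : ∀ j (v : Cot K H M ⊗[K] CotPow K H M j), j ≠ k →
        (cotComp K H M k).lTensor (Cot K H M) ((cotOf K H M j).lTensor (Cot K H M) v) = 0 := by
      intro j v hj
      rw [lTensor_congr (F' := (0 : CotPow K H M j →ₗ[K] _)) (f' := LinearMap.id)
        (fun x => cotComp_cotOf_ne hj.symm x), LinearMap.lTensor_zero, LinearMap.zero_apply]
    have hk' : ∀ (v : Cot K H M ⊗[K] CotPow K H M k),
        (cotComp K H M k).lTensor (Cot K H M) ((cotOf K H M k).lTensor (Cot K H M) v) = v := by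
      intro v
      rw [lTensor_congr (F' := LinearMap.id) (f' := LinearMap.id)
        (fun x => cotComp_cotOf k x), LinearMap.lTensor_id, LinearMap.id_apply, LinearMap.id_apply]
    rw [cotComul_of, map_sum, Finset.sum_eq_single k]
    · rw [hk']
    · intro j _ hj
      exact hk j _ hj
    · intro h
      rw [cotSplit_of_lt (by simpa using h), LinearMap.map_zero, LinearMap.map_zero]

theorem cotComp_rho (k : ℕ) (x : Cot K H M) :
    (cotComp K H M k).rTensor H (cotRho K H M x) = (cotPow K H M k).coact (cotComp K H M k x) := by
  induction x using cot_ind with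
  | hz => simp only [LinearMap.map_zero]
  | ha a b ha hb => simp only [LinearMap.map_add, ha, hb]
  | ho n x =>
    rw [cotRho_of]
    by_cases h : k = n
    · subst h
      rw [cotComp_cotOf, rTensor_congr (F' := LinearMap.id) (f' := LinearMap.id)
        (fun x => cotComp_cotOf k x), LinearMap.rTensor_id, LinearMap.id_apply, LinearMap.id_apply]
    · rw [cotComp_cotOf_ne h, rTensor_eq_zero (fun x => cotComp_cotOf_ne h x), LinearMap.map_zero]

theorem compH_tau (x : Cot K H M) :
    (compH K H M).rTensor M (cotTau K H M x) = lcoact (compM K H M x) := by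
  induction x using cot_ind_cases with
  | hz => simp only [LinearMap.map_zero]
  | ha a b ha hb => simp only [LinearMap.map_add, ha, hb]
  | h0 x =>
    rw [cotTau_ofH, compM_ofH, LinearMap.map_zero, LinearMap.map_zero]
  | h1 x =>
    rw [cotTau_ofM, compM_ofM,
      rTensor_congr (F := compH K H M) (f := ofH K H M) (F' := LinearMap.id) (f' := LinearMap.id)
        (fun x => compH_ofH x), LinearMap.rTensor_id, LinearMap.id_apply, LinearMap.id_apply]
  | h2 n x =>
    rw [cotTau_of, compM_of (by omega), LinearMap.map_zero]
    exact rTensor_eq_zero (F := compH K H M) (fun x => compH_of (by omega) x) _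

theorem cotComp_tau (k : ℕ) (x : Cot K H M) :
    (cotComp K H M (k + 1)).rTensor M (cotTau K H M x) =
      incl K H M k (cotComp K H M (k + 2) x) := by
  induction x using cot_ind_cases with
  | hz => simp only [LinearMap.map_zero]
  | ha a b ha hb => simp only [LinearMap.map_add, ha, hb]
  | h0 x =>
    rw [cotTau_ofH, cotComp_ofH (by omega), LinearMap.map_zero, LinearMap.map_zero]
  | h1 x =>
    rw [cotTau_ofM, cotComp_ofM (by omega), LinearMap.map_zero]
    exact rTensor_eq_zero (f := ofH K H M) (fun x => cotComp_ofH (by omega) x) _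
  | h2 n x =>
    rw [cotTau_of]
    by_cases h : k = n
    · subst h
      rw [cotComp_cotOf, rTensor_congr (F' := LinearMap.id) (f' := LinearMap.id)
        (fun x => cotComp_cotOf _ x), LinearMap.rTensor_id, LinearMap.id_apply, LinearMap.id_apply]
    · rw [cotComp_cotOf_ne (by omega), rTensor_eq_zero (fun x => cotComp_cotOf_ne (by omega) x),
        LinearMap.map_zero]

end CotCoalgebra

section CotCoassoc

variable {K : Type w} {H M : Type u} [Field K] [Ring H] [HopfAlgebra K H]
  [AddCommGroup M] [Module K M] [HopfBimodule K H M]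

open HopfBimodule

theorem tensor_cot_ext_middle {A B : Type*} [AddCommGroup A] [Module K A] [AddCommGroup B]
    [Module K B] (v w : A ⊗[K] (Cot K H M ⊗[K] B))
    (h : ∀ k, ((cotComp K H M k).rTensor B).lTensor A v =
      ((cotComp K H M k).rTensor B).lTensor A w) : v = w := by
  have h1 : ∀ (v : A ⊗[K] (Cot K H M ⊗[K] B)) k, (cotComp K H M k).lTensor (A ⊗[K] B)
      ((TensorProduct.assoc K A B _).symm ((TensorProduct.comm K _ B).toLinearMap.lTensor A v)) =
      (TensorProduct.assoc K A B _).symm ((TensorProduct.comm K _ B).toLinearMap.lTensor A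
        (((cotComp K H M k).rTensor B).lTensor A v)) := by
    intro v k
    induction v with
    | zero => simp only [LinearMap.map_zero, LinearEquiv.map_zero]
    | add a b ha hb => simp only [LinearMap.map_add, LinearEquiv.map_add, ha, hb]
    | tmul a x =>
      induction x with
      | zero => simp only [LinearMap.map_zero, LinearEquiv.map_zero, TensorProduct.tmul_zero]
      | add a b ha hb =>
        simp only [LinearMap.map_add, LinearEquiv.map_add, TensorProduct.tmul_add, ha, hb]
      | tmul x b => rfl
  apply lTensor_injective A _ (TensorProduct.comm K (Cot K H M) B).injective
  apply (TensorProduct.assoc K A B _).symm.injective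
  apply tensor_cot_ext
  intro k
  rw [h1, h1, h]

theorem tensor_cot_ext_right {A B : Type*} [AddCommGroup A] [Module K A] [AddCommGroup B]
    [Module K B] (v w : A ⊗[K] (B ⊗[K] Cot K H M))
    (h : ∀ k, ((cotComp K H M k).lTensor B).lTensor A v =
      ((cotComp K H M k).lTensor B).lTensor A w) : v = w := by
  have h1 : ∀ (v : A ⊗[K] (B ⊗[K] Cot K H M)) k, (cotComp K H M k).lTensor (A ⊗[K] B)
      ((TensorProduct.assoc K A B _).symm v) =
      (TensorProduct.assoc K A B _).symm (((cotComp K H M k).lTensor B).lTensor A v) := by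
    intro v k
    rw [LinearEquiv.eq_symm_apply, assoc_lTensor, LinearEquiv.apply_symm_apply]
  apply (TensorProduct.assoc K A B _).symm.injective
  apply tensor_cot_ext
  intro k
  rw [h1, h1, h]

theorem cotRho_comul (x : Cot K H M) :
    TensorProduct.assoc K _ _ H ((cotComul K H M).rTensor H (cotRho K H M x)) =
      (cotRho K H M).lTensor (Cot K H M) (cotComul K H M x) := by
  apply tensor_cot_ext_middle
  intro k
  rw [← assoc_lTensor_rTensor, rTensor_congr (F' := cotSplit K H M k) (f' := LinearMap.id)
    (fun x => cotComp_comul k x), LinearMap.rTensor_id, LinearMap.id_apply, ← coact_cotSplit,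
    lTensor_congr (fun x => cotComp_rho k x), cotComp_comul]

theorem cotTau_comul (x : Cot K H M) :
    TensorProduct.assoc K _ _ M ((cotComul K H M).rTensor M (cotTau K H M x)) =
      (cotTau K H M).lTensor (Cot K H M) (cotComul K H M x) := by
  apply tensor_cot_ext_middle
  intro k
  rw [← assoc_lTensor_rTensor, rTensor_congr (F' := cotSplit K H M k) (f' := LinearMap.id)
    (fun x => cotComp_comul k x), LinearMap.rTensor_id, LinearMap.id_apply]
  cases k with
  | zero =>
    have h : ∀ y, (cotComp K H M 0).rTensor M (cotTau K H M y) =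
      (lcoact (K := K) (H := H) (M := M)) (compM K H M y) := fun y => compH_tau y
    rw [lTensor_congr h]
    exact (cotRho_tau x).trans (congrArg _ (cotComp_comul 1 x).symm)
  | succ k =>
    rw [lTensor_congr (fun x => cotComp_tau k x), cotComp_comul, incl_cotSplit]

theorem cotSplit_comul (k : ℕ) (x : Cot K H M) :
    TensorProduct.assoc K _ _ _ ((cotComul K H M).rTensor _ (cotSplit K H M k x)) =
      (cotSplit K H M k).lTensor (Cot K H M) (cotComul K H M x) := by
  induction k generalizing x with
  | zero => exact cotRho_comul x
  | succ k ih =>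
    cases k with
    | zero => exact cotTau_comul x
    | succ k =>
      apply lTensor_injective _ _ (lTensor_injective _ _ (incl_injective K H M k))
      have h1 : ∀ v : Cot K H M ⊗[K] M, (TensorProduct.assoc K _ _ _)
          ((cotComul K H M).rTensor _ (TensorProduct.assoc K _ _ M
            ((cotSplit K H M (k + 1)).rTensor M v))) =
          (TensorProduct.assoc K _ _ _).toLinearMap.lTensor (Cot K H M)
            (((cotSplit K H M (k + 1)).rTensor M).lTensor (Cot K H M)
              (TensorProduct.assoc K _ _ _ ((cotComul K H M).rTensor M v))) := by
        intro v
        rw [← assoc_lTensor_rTensor]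
        induction v with
        | zero => simp only [LinearMap.map_zero, LinearEquiv.map_zero]
        | add a b ha hb => simp only [LinearMap.map_add, LinearEquiv.map_add, ha, hb]
        | tmul y m =>
          simp only [LinearMap.rTensor_tmul]
          rw [← ih]
          generalize cotSplit K H M (k + 1) y = v
          induction v with
          | zero => simp only [LinearMap.map_zero, LinearEquiv.map_zero, TensorProduct.zero_tmul]
          | add a b ha hb =>
            simp only [LinearMap.map_add, LinearEquiv.map_add, TensorProduct.add_tmul, ha, hb]
          | tmul y p =>
            simp only [LinearMap.rTensor_tmul, TensorProduct.assoc_tmul]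
            generalize cotComul K H M y = v
            induction v with
            | zero => simp only [LinearMap.map_zero, LinearEquiv.map_zero, TensorProduct.zero_tmul]
            | add a b ha hb =>
              simp only [LinearMap.map_add, LinearEquiv.map_add, TensorProduct.add_tmul, ha, hb]
            | tmul y p => rfl
      rw [← assoc_lTensor, lTensor_rTensor, incl_cotSplit, h1, cotTau_comul]
      have h2 : ∀ y, (incl K H M k).lTensor (Cot K H M) (cotSplit K H M (k + 2) y) =
        ((TensorProduct.assoc K _ _ M).toLinearMap ∘ₗ (cotSplit K H M (k + 1)).rTensor M)
          (cotTau K H M y) := incl_cotSplit k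
      rw [lTensor_congr h2, LinearMap.lTensor_comp, LinearMap.comp_apply]

theorem cotComul_coassoc (x : Cot K H M) :
    TensorProduct.assoc K _ _ _ ((cotComul K H M).rTensor _ (cotComul K H M x)) =
      (cotComul K H M).lTensor _ (cotComul K H M x) := by
  apply tensor_cot_ext_right
  intro k
  rw [← assoc_lTensor, lTensor_rTensor, cotComp_comul, cotSplit_comul,
    lTensor_congr (F' := cotSplit K H M k) (f' := LinearMap.id) (fun x => cotComp_comul k x),
    LinearMap.lTensor_id, LinearMap.id_apply]

variable (K H M) in
/-- The counit of `Cot_H(M)`: the counit of `H` on `H`, and `0` on `M^{□ n}` for `n ≥ 1`. -/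
noncomputable def cotCounit : Cot K H M →ₗ[K] K := counit (R := K) (A := H) ∘ₗ compH K H M

theorem cotCounit_split (k : ℕ) (x : Cot K H M) :
    (cotCounit K H M).rTensor (CotPow K H M k) (cotSplit K H M k x) =
      1 ⊗ₜ cotComp K H M k x := by
  have hl : ∀ {A : Type u} [AddCommGroup A] [Module K A] (v : Cot K H M ⊗[K] A),
      (cotCounit K H M).rTensor A v =
        (counit (R := K) (A := H)).rTensor A ((compH K H M).rTensor A v) := by
    intro A _ _ v
    rw [cotCounit, LinearMap.rTensor_comp, LinearMap.comp_apply]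
  induction k generalizing x with
  | zero =>
    have h := cotComp_rho 0 x
    refine (hl _).trans ((congrArg _ h).trans ?_)
    exact rTensor_counit_comul (R := K) (A := H) (compH K H M x)
  | succ k ih =>
    cases k with
    | zero =>
      have h := compH_tau x
      refine (hl _).trans ((congrArg _ h).trans ?_)
      have h' := lcoact_counit (K := K) (H := H) (compM K H M x)
      rw [← LinearEquiv.eq_symm_apply, TensorProduct.lid_symm_apply] at h'
      exact h'
    | succ k =>
      apply lTensor_injective _ _ (incl_injective K H M k)
      rw [lTensor_rTensor, incl_cotSplit, ← assoc_rTensor_rTensor,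
        rTensor_congr (F' := TensorProduct.mk K K _ 1) ih, cotComp_tau, LinearMap.lTensor_tmul]
      generalize incl K H M k _ = v
      induction v with
      | zero => simp only [LinearMap.map_zero, LinearEquiv.map_zero, TensorProduct.tmul_zero]
      | add a b ha hb =>
        simp only [LinearMap.map_add, LinearEquiv.map_add, TensorProduct.tmul_add, ha, hb]
      | tmul y p => rfl

/-- The cotensor coalgebra: the comultiplication is the sum of the deconcatenations
`M^{□ n} → M^{□ (n-k)} ⊗ M^{□ k}`, with the coactions of `H` at both ends, and the counit is the
one of `H`, extended by zero. -/
noncomputable instance : Coalgebra K (Cot K H M) where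
  comul := cotComul K H M
  counit := cotCounit K H M
  coassoc := LinearMap.ext cotComul_coassoc
  rTensor_counit_comp_comul := by
    ext x
    apply tensor_cot_ext
    intro k
    rw [LinearMap.comp_apply, lTensor_rTensor, cotComp_comul, cotCounit_split]
    rfl
  lTensor_counit_comp_comul := by
    ext x
    rw [LinearMap.comp_apply, cotCounit, LinearMap.lTensor_comp, LinearMap.comp_apply]
    exact (congrArg _ (cotComp_comul 0 x)).trans (cotRho_counit x)

theorem cot_comul_def : (comul : Cot K H M →ₗ[K] _) = cotComul K H M := rfl

theorem cot_counit_def : (counit : Cot K H M →ₗ[K] K) = cotCounit K H M := rfl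

end CotCoassoc

section Lift

variable {K : Type w} {H M : Type u} [Field K] [Ring H] [HopfAlgebra K H]
  [AddCommGroup M] [Module K M] [HopfBimodule K H M]

open HopfBimodule

theorem tensor_cot_ext_left {B : Type*} [AddCommGroup B] [Module K B] (v w : Cot K H M ⊗[K] B)
    (h : ∀ k, (cotComp K H M k).rTensor B v = (cotComp K H M k).rTensor B w) : v = w := by
  apply (TensorProduct.comm K (Cot K H M) B).injective
  apply tensor_cot_ext
  intro k
  rw [← LinearMap.comm_comp_rTensor_comp_comm_eq] 
  simp only [LinearMap.comp_apply, LinearEquiv.coe_coe, TensorProduct.comm_comm, h]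

theorem compH_comul (x : Cot K H M) :
    (compH K H M).lTensor (Cot K H M) (comul x) = cotRho K H M x :=
  cotComp_comul 0 x

theorem compM_comul (x : Cot K H M) :
    (compM K H M).lTensor (Cot K H M) (comul x) = cotTau K H M x :=
  cotComp_comul 1 x

variable {C : Type*} [AddCommGroup C] [Module K C] [Coalgebra K C]

theorem coassoc_map {A B : Type*} [AddCommGroup A] [Module K A] [AddCommGroup B] [Module K B]
    (f : C →ₗ[K] A) (g : C →ₗ[K] B) (c : C) :
    TensorProduct.assoc K C A B ((f.lTensor C ∘ₗ comul).rTensor B (g.lTensor C (comul c))) =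
      (TensorProduct.map f g ∘ₗ comul).lTensor C (comul c) := by
  rw [LinearMap.lTensor_comp, LinearMap.comp_apply, ← Coalgebra.coassoc_apply,
    LinearMap.rTensor_comp, LinearMap.comp_apply, ← lTensor_rTensor]
  generalize (comul (R := K)).rTensor C (comul c) = v
  exact LinearMap.congr_fun (f := (TensorProduct.assoc K C A B).toLinearMap ∘ₗ
      (f.lTensor C).rTensor B ∘ₗ g.lTensor (C ⊗[K] C))
    (g := (TensorProduct.map f g).lTensor C ∘ₗ (TensorProduct.assoc K C C C).toLinearMap)
    (TensorProduct.ext_threefold fun _ _ _ => rfl) v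

theorem counit_map {A : Type*} [AddCommGroup A] [Module K A] (f : C →ₗ[K] A) (c : C) :
    TensorProduct.lid K A ((counit (R := K)).rTensor A (f.lTensor C (comul c))) = f c := by
  rw [← lTensor_rTensor, Coalgebra.rTensor_counit_comul, LinearMap.lTensor_tmul,
    TensorProduct.lid_tmul, one_smul]

/-- Linear maps from a coalgebra `C` to `H` and to `M` that are a coalgebra map and
a bicomodule map. -/
structure BicomodulePair (f₀ : C →ₗ[K] H) (f₁ : C →ₗ[K] M) : Prop where
  comul_f₀ : ∀ c, comul (f₀ c) = TensorProduct.map f₀ f₀ (comul c)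
  counit_f₀ : ∀ c, counit (R := K) (f₀ c) = counit (R := K) c
  lcoact_f₁ : ∀ c, lcoact (f₁ c) = TensorProduct.map f₀ f₁ (comul (R := K) c)
  rcoact_f₁ : ∀ c, rcoact (f₁ c) = TensorProduct.map f₁ f₀ (comul (R := K) c)

variable {f₀ : C →ₗ[K] H} {f₁ : C →ₗ[K] M}

namespace BicomodulePair

/-- Splitting off tensor factors in `C` through `f₀` and `f₁`. -/
noncomputable def splitting (p : BicomodulePair f₀ f₁) : Splitting K H M C where
  rho := f₀.lTensor C ∘ₗ comul
  tau := f₁.lTensor C ∘ₗ comul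
  rho_rho c := by
    rw [LinearMap.comp_apply, coassoc_map,
      lTensor_congr (F' := TensorProduct.map f₀ f₀ ∘ₗ comul) (f' := LinearMap.id) p.comul_f₀,
      LinearMap.lTensor_id, LinearMap.id_apply]
  rho_tau c := by
    rw [LinearMap.comp_apply, coassoc_map,
      lTensor_congr (F' := TensorProduct.map f₀ f₁ ∘ₗ comul) (f' := LinearMap.id) p.lcoact_f₁,
      LinearMap.lTensor_id, LinearMap.id_apply]
  tau_rho c := by
    rw [LinearMap.comp_apply, coassoc_map, LinearMap.comp_apply,
      lTensor_congr (F' := TensorProduct.map f₁ f₀ ∘ₗ comul) (f' := LinearMap.id) p.rcoact_f₁,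
      LinearMap.lTensor_id, LinearMap.id_apply]

/-- The component `C → M^{□ k}` of the map `C → Cot_H(M)` given by `f₀` and `f₁`. -/
noncomputable def component (p : BicomodulePair f₀ f₁) (k : ℕ) : C →ₗ[K] CotPow K H M k :=
  (TensorProduct.lid K (CotPow K H M k)).toLinearMap ∘ₗ
    (counit (R := K) (A := C)).rTensor (CotPow K H M k) ∘ₗ p.splitting.split k

theorem component_apply (p : BicomodulePair f₀ f₁) (k : ℕ) (c : C) :
    p.component k c = TensorProduct.lid K _
      ((counit (R := K) (A := C)).rTensor (CotPow K H M k) (p.splitting.split k c)) := rfl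

theorem component_zero (p : BicomodulePair f₀ f₁) (c : C) : p.component 0 c = f₀ c :=
  counit_map f₀ c

theorem component_one (p : BicomodulePair f₀ f₁) (c : C) : p.component 1 c = f₁ c :=
  counit_map f₁ c

theorem lid_assoc {A B X : Type*} [AddCommGroup A] [Module K A] [AddCommGroup B] [Module K B]
    [AddCommGroup X] [Module K X]
    (e : X →ₗ[K] K) (v : (X ⊗[K] A) ⊗[K] B) :
    TensorProduct.lid K _ (e.rTensor (A ⊗[K] B) (TensorProduct.assoc K X A B v)) =
      ((TensorProduct.lid K A).toLinearMap ∘ₗ e.rTensor A).rTensor B v :=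
  LinearMap.congr_fun (f := (TensorProduct.lid K _).toLinearMap ∘ₗ e.rTensor (A ⊗[K] B) ∘ₗ
      (TensorProduct.assoc K X A B).toLinearMap)
    (g := ((TensorProduct.lid K A).toLinearMap ∘ₗ e.rTensor A).rTensor B)
    (TensorProduct.ext_threefold fun x a b => by
      simp [TensorProduct.smul_tmul']) v

theorem lid_lTensor {A B X : Type*} [AddCommGroup A] [Module K A] [AddCommGroup B] [Module K B]
    [AddCommGroup X] [Module K X] (e : X →ₗ[K] K) (g : A →ₗ[K] B) (v : X ⊗[K] A) :
    TensorProduct.lid K _ (e.rTensor B (g.lTensor X v)) =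
      g (TensorProduct.lid K _ (e.rTensor A v)) :=
  LinearMap.congr_fun (f := (TensorProduct.lid K _).toLinearMap ∘ₗ e.rTensor B ∘ₗ g.lTensor X)
    (g := g ∘ₗ (TensorProduct.lid K _).toLinearMap ∘ₗ e.rTensor A)
    (TensorProduct.ext' fun x a => by simp) v

theorem component_def (p : BicomodulePair f₀ f₁) (k : ℕ) : p.component k =
    ((TensorProduct.lid K (CotPow K H M k)).toLinearMap ∘ₗ
      (counit (R := K) (A := C)).rTensor (CotPow K H M k)) ∘ₗ p.splitting.split k := rfl

theorem splitting_tau (p : BicomodulePair f₀ f₁) (c : C) :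
    p.splitting.tau c = f₁.lTensor C (comul c) := rfl

theorem splitting_rho (p : BicomodulePair f₀ f₁) (c : C) :
    p.splitting.rho c = f₀.lTensor C (comul c) := rfl

theorem map_eq {A B : Type*} [AddCommGroup A] [Module K A] [AddCommGroup B] [Module K B]
    (f : C →ₗ[K] A) (g : C →ₗ[K] B) (v : C ⊗[K] C) :
    TensorProduct.map f g v = f.rTensor B (g.lTensor C v) := by
  rw [← LinearMap.comp_apply, LinearMap.rTensor_comp_lTensor]

theorem incl_component (p : BicomodulePair f₀ f₁) (k : ℕ) (c : C) :
    incl K H M k (p.component (k + 2) c) =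
      TensorProduct.map (p.component (k + 1)) f₁ (comul c) := by
  rw [component_apply, ← lid_lTensor, Splitting.incl_split, lid_assoc, map_eq,
    component_def p (k + 1), LinearMap.rTensor_comp, LinearMap.comp_apply, splitting_tau,
    LinearMap.rTensor_comp, LinearMap.rTensor_comp, LinearMap.comp_apply, LinearMap.comp_apply]

theorem coact_component (p : BicomodulePair f₀ f₁) (k : ℕ) (c : C) :
    (cotPow K H M k).coact (p.component k c) =
      TensorProduct.map (p.component k) f₀ (comul c) := by
  rw [component_apply, ← lid_lTensor, Splitting.coact_split, lid_assoc, map_eq,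
    component_def p k, LinearMap.rTensor_comp, LinearMap.comp_apply, splitting_rho,
    LinearMap.rTensor_comp, LinearMap.rTensor_comp, LinearMap.comp_apply, LinearMap.comp_apply]

theorem split_eq (p : BicomodulePair f₀ f₁) (k : ℕ) (c : C) :
    p.splitting.split k c = (p.component k).lTensor C (comul c) := by
  induction k generalizing c with
  | zero =>
    have : p.component 0 = f₀ := LinearMap.ext p.component_zero
    rw [this]; rfl
  | succ k ih =>
    cases k with
    | zero =>
      have : p.component 1 = f₁ := LinearMap.ext p.component_one
      rw [this]; rfl
    | succ k =>
      apply lTensor_injective _ _ (incl_injective K H M k)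
      rw [Splitting.incl_split, lTensor_congr (F' := TensorProduct.map (p.component (k + 1)) f₁ ∘ₗ
        comul) (f' := LinearMap.id) (p.incl_component k), LinearMap.lTensor_id, LinearMap.id_apply,
        ← coassoc_map]
      have ih' : p.splitting.split (k + 1) = (p.component (k + 1)).lTensor C ∘ₗ comul :=
        LinearMap.ext ih
      rw [ih', splitting_tau]

/-- The coalgebra map `C → Cot_H(M)` given by `f₀` and `f₁`, as a linear map. -/
noncomputable def liftLinear (p : BicomodulePair f₀ f₁)
    (h : ∀ c, ∃ N : ℕ, ∀ k, N < k → p.component k c = 0) : C →ₗ[K] Cot K H M :=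
  toDirectSum p.component h

theorem cotComp_liftLinear (p : BicomodulePair f₀ f₁)
    (h : ∀ c, ∃ N : ℕ, ∀ k, N < k → p.component k c = 0) (k : ℕ) (c : C) :
    cotComp K H M k (p.liftLinear h c) = p.component k c :=
  component_toDirectSum _ _ c k

theorem cotSplit_liftLinear (p : BicomodulePair f₀ f₁)
    (h : ∀ c, ∃ N : ℕ, ∀ k, N < k → p.component k c = 0) (k : ℕ) (c : C) :
    cotSplit K H M k (p.liftLinear h c) = (p.liftLinear h).rTensor _ (p.splitting.split k c) := by
  have hc : ∀ {B : Type u} [AddCommGroup B] [Module K B] (k : ℕ) (g : C →ₗ[K] B) (c : C),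
      (cotComp K H M k).rTensor B ((p.liftLinear h).rTensor B (g.lTensor C (comul c))) =
        TensorProduct.map (p.component k) g (comul c) := by
    intro B _ _ k g c
    rw [rTensor_congr (F' := p.component k) (f' := LinearMap.id) (p.cotComp_liftLinear h k),
      LinearMap.rTensor_id, LinearMap.id_apply, map_eq]
  apply Splitting.split_naturality
  · intro x
    apply tensor_cot_ext_left
    intro k
    refine (cotComp_rho k _).trans (Eq.trans ?_ (hc k f₀ x).symm)
    rw [cotComp_liftLinear, coact_component]
  · intro x
    apply tensor_cot_ext_left
    intro k
    refine Eq.trans ?_ (hc k f₁ x).symm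
    cases k with
    | zero =>
      refine (compH_tau (K := K) (H := H) (M := M) _).trans ?_
      have h1 : compM K H M (p.liftLinear h x) = f₁ x :=
        (p.cotComp_liftLinear h 1 x).trans (p.component_one x)
      have h0 : p.component 0 = f₀ := LinearMap.ext p.component_zero
      rw [h1, p.lcoact_f₁, h0]
      rfl
    | succ k =>
      refine (cotComp_tau k _).trans ?_
      rw [cotComp_liftLinear, incl_component]

/-- The coalgebra map `C → Cot_H(M)` given by `f₀` and `f₁`. -/
noncomputable def lift (p : BicomodulePair f₀ f₁)
    (h : ∀ c, ∃ N : ℕ, ∀ k, N < k → p.component k c = 0) : C →ₗc[K] Cot K H M where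
  toLinearMap := p.liftLinear h
  counit_comp := by
    ext c
    have h0 : compH K H M (p.liftLinear h c) = f₀ c :=
        (p.cotComp_liftLinear h 0 c).trans (p.component_zero c)
    rw [cot_counit_def, LinearMap.comp_apply, cotCounit, LinearMap.comp_apply, h0, p.counit_f₀]
  map_comp_comul := by
    ext c
    apply tensor_cot_ext
    intro k
    rw [LinearMap.comp_apply, LinearMap.comp_apply, cot_comul_def, cotComp_comul,
      cotSplit_liftLinear, split_eq, map_eq, lTensor_rTensor,
      lTensor_congr (F' := p.component k) (f' := LinearMap.id) (p.cotComp_liftLinear h k),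
      LinearMap.lTensor_id, LinearMap.id_apply]

theorem cotComp_lift (p : BicomodulePair f₀ f₁)
    (h : ∀ c, ∃ N : ℕ, ∀ k, N < k → p.component k c = 0) (k : ℕ) (c : C) :
    cotComp K H M k (p.lift h c) = p.component k c :=
  p.cotComp_liftLinear h k c

theorem compH_lift (p : BicomodulePair f₀ f₁)
    (h : ∀ c, ∃ N : ℕ, ∀ k, N < k → p.component k c = 0) (c : C) :
    compH K H M (p.lift h c) = f₀ c :=
  (p.cotComp_liftLinear h 0 c).trans (p.component_zero c)

theorem compM_lift (p : BicomodulePair f₀ f₁)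
    (h : ∀ c, ∃ N : ℕ, ∀ k, N < k → p.component k c = 0) (c : C) :
    compM K H M (p.lift h c) = f₁ c :=
  (p.cotComp_liftLinear h 1 c).trans (p.component_one c)

end BicomodulePair

/-- A coalgebra map to `Cot_H(M)` is determined by its components in degrees `0` and `1`. -/
theorem cot_coalgHom_ext {φ ψ : C →ₗc[K] Cot K H M}
    (h0 : ∀ c, compH K H M (φ c) = compH K H M (ψ c))
    (h1 : ∀ c, compM K H M (φ c) = compM K H M (ψ c)) : φ = ψ := by
  have key : ∀ k c, cotComp K H M k (φ c) = cotComp K H M k (ψ c) := by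
    intro k
    induction k with
    | zero => exact h0
    | succ k ih =>
      cases k with
      | zero => exact h1
      | succ k =>
        have ht : ∀ (θ : C →ₗc[K] Cot K H M) c,
            incl K H M k (cotComp K H M (k + 2) (θ c)) =
            TensorProduct.map (cotComp K H M (k + 1) ∘ₗ θ.toLinearMap)
              (compM K H M ∘ₗ θ.toLinearMap) (comul c) := by
          intro θ c
          have h2 : TensorProduct.map θ.toLinearMap θ.toLinearMap (comul c) = comul (θ c) :=
            LinearMap.congr_fun θ.map_comp_comul c
          rw [← cotComp_tau, ← compM_comul, ← h2, TensorProduct.map_comp, LinearMap.comp_apply,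
            ← LinearMap.comp_apply, LinearMap.rTensor_comp_lTensor]
        intro c
        apply incl_injective K H M k
        rw [ht, ht, show cotComp K H M (k + 1) ∘ₗ φ.toLinearMap =
            cotComp K H M (k + 1) ∘ₗ ψ.toLinearMap from LinearMap.ext ih,
          show compM K H M ∘ₗ φ.toLinearMap = compM K H M ∘ₗ ψ.toLinearMap from LinearMap.ext h1]
  exact CoalgHom.ext fun c => cot_ext fun k => key k c

end Lift

section Mul

variable {K : Type w} {H M : Type u} [Field K] [Ring H] [HopfAlgebra K H]
  [AddCommGroup M] [Module K M] [HopfBimodule K H M]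

open HopfBimodule

theorem map₂_ract_one {A : Type*} [Ring A] [Algebra K A] (v : A ⊗[K] M) :
    TensorProduct.map₂ (LinearMap.mul K A) (ract (K := K) (H := H) (M := M)) v (1 ⊗ₜ 1) = v := by
  induction v with
  | zero => simp only [LinearMap.map_zero, LinearMap.zero_apply]
  | add a b ha hb => simp only [LinearMap.map_add, LinearMap.add_apply, ha, hb]
  | tmul h m => simp [TensorProduct.map₂_apply_tmul, ract_one]

theorem map₂_ract_one' {A : Type*} [Ring A] [Algebra K A] (v : M ⊗[K] A) :
    TensorProduct.map₂ (ract (K := K) (H := H) (M := M)) (LinearMap.mul K A) v (1 ⊗ₜ 1) = v := by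
  induction v with
  | zero => simp only [LinearMap.map_zero, LinearMap.zero_apply]
  | add a b ha hb => simp only [LinearMap.map_add, LinearMap.add_apply, ha, hb]
  | tmul h m => simp [TensorProduct.map₂_apply_tmul, ract_one]

theorem map₂_lact_one {A : Type*} [Ring A] [Algebra K A] (v : A ⊗[K] M) :
    TensorProduct.map₂ (LinearMap.mul K A) (lact (K := K) (H := H) (M := M)) (1 ⊗ₜ 1) v = v := by
  induction v with
  | zero => simp only [LinearMap.map_zero, LinearMap.zero_apply]
  | add a b ha hb => simp only [LinearMap.map_add, LinearMap.add_apply, ha, hb]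
  | tmul h m => simp [TensorProduct.map₂_apply_tmul, one_lact]

theorem map₂_lact_one' {A : Type*} [Ring A] [Algebra K A] (v : M ⊗[K] A) :
    TensorProduct.map₂ (lact (K := K) (H := H) (M := M)) (LinearMap.mul K A) (1 ⊗ₜ 1) v = v := by
  induction v with
  | zero => simp only [LinearMap.map_zero, LinearMap.zero_apply]
  | add a b ha hb => simp only [LinearMap.map_add, LinearMap.add_apply, ha, hb]
  | tmul h m => simp [TensorProduct.map₂_apply_tmul, one_lact]

theorem comul_one' : comul (R := K) (1 : H) = 1 ⊗ₜ 1 := Bialgebra.comul_one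

theorem lcoact_lact (h : H) (m : M) : lcoact (K := K) (H := H) (lact (K := K) h m) =
    TensorProduct.map₂ (LinearMap.mul K H) lact (comul h) (lcoact m) := by
  have := lcoact_act (K := K) h m (1 : H)
  rwa [ract_one, comul_one', map₂_ract_one] at this

theorem lcoact_ract (m : M) (h : H) : lcoact (K := K) (H := H) (ract (K := K) m h) =
    TensorProduct.map₂ (LinearMap.mul K H) ract (lcoact m) (comul h) := by
  have := lcoact_act (K := K) (1 : H) m h
  rwa [one_lact, comul_one', map₂_lact_one] at this

theorem rcoact_lact (h : H) (m : M) : rcoact (K := K) (H := H) (lact (K := K) h m) =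
    TensorProduct.map₂ lact (LinearMap.mul K H) (comul h) (rcoact m) := by
  have := rcoact_act (K := K) h m (1 : H)
  rwa [ract_one, comul_one', map₂_ract_one'] at this

theorem rcoact_ract (m : M) (h : H) : rcoact (K := K) (H := H) (ract (K := K) m h) =
    TensorProduct.map₂ ract (LinearMap.mul K H) (rcoact m) (comul h) := by
  have := rcoact_act (K := K) (1 : H) m h
  rwa [one_lact, comul_one', map₂_lact_one'] at this

theorem comul_compH (x : Cot K H M) :
    comul (compH K H M x) = TensorProduct.map (compH K H M) (compH K H M) (comul (R := K) x) := by
  have h : (compH K H M).rTensor H (cotRho K H M x) = comul (compH K H M x) := cotComp_rho 0 x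
  rw [BicomodulePair.map_eq, compH_comul, h]

theorem lcoact_compM (x : Cot K H M) :
    lcoact (compM K H M x) = TensorProduct.map (compH K H M) (compM K H M) (comul (R := K) x) := by
  rw [BicomodulePair.map_eq, compM_comul, compH_tau]

theorem rcoact_compM (x : Cot K H M) :
    rcoact (compM K H M x) = TensorProduct.map (compM K H M) (compH K H M) (comul (R := K) x) := by
  have h : (compM K H M).rTensor H (cotRho K H M x) = rcoact (compM K H M x) := cotComp_rho 1 x
  rw [BicomodulePair.map_eq, compH_comul, h]

variable (K H M)

/-- The degree `0` part `x ⊗ y ↦ x₀ y₀` of the multiplication. -/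
noncomputable def mulH : Cot K H M ⊗[K] Cot K H M →ₗ[K] H :=
  LinearMap.mul' K H ∘ₗ TensorProduct.map (compH K H M) (compH K H M)

/-- The degree `1` part `x ⊗ y ↦ x₀.y₁ + x₁.y₀` of the multiplication. -/
noncomputable def mulM : Cot K H M ⊗[K] Cot K H M →ₗ[K] M :=
  TensorProduct.lift lact ∘ₗ TensorProduct.map (compH K H M) (compM K H M) +
    TensorProduct.lift ract ∘ₗ TensorProduct.map (compM K H M) (compH K H M)

variable {K H M}

theorem mulH_tmul (x y : Cot K H M) :
    mulH K H M (x ⊗ₜ y) = compH K H M x * compH K H M y := rfl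

theorem mulM_tmul (x y : Cot K H M) :
    mulM K H M (x ⊗ₜ y) = lact (K := K) (compH K H M x) (compM K H M y) +
      ract (K := K) (compM K H M x) (compH K H M y) := rfl

/-- A bilinear map on pure tensors of comultiplications. -/
theorem map_comul_tmul {A B : Type*} [AddCommGroup A] [Module K A] [AddCommGroup B] [Module K B]
    {A₁ A₂ B₁ B₂ : Type*} [AddCommGroup A₁] [Module K A₁] [AddCommGroup A₂] [Module K A₂]
    [AddCommGroup B₁] [Module K B₁] [AddCommGroup B₂] [Module K B₂]
    (f₁ : Cot K H M →ₗ[K] A₁) (f₂ : Cot K H M →ₗ[K] A₂) (g₁ : Cot K H M →ₗ[K] B₁)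
    (g₂ : Cot K H M →ₗ[K] B₂) (s : A₁ →ₗ[K] A₂ →ₗ[K] A) (t : B₁ →ₗ[K] B₂ →ₗ[K] B)
    (x y : Cot K H M) :
    TensorProduct.map (TensorProduct.lift s ∘ₗ TensorProduct.map f₁ f₂)
      (TensorProduct.lift t ∘ₗ TensorProduct.map g₁ g₂) (comul (R := K) (x ⊗ₜ[K] y)) =
    TensorProduct.map₂ s t (TensorProduct.map f₁ g₁ (comul (R := K) x))
      (TensorProduct.map f₂ g₂ (comul (R := K) y)) := by
  rw [TensorProduct.comul_tmul]
  generalize comul (R := K) x = u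
  generalize comul (R := K) y = v
  induction u with
  | zero => simp only [LinearMap.map_zero, LinearEquiv.map_zero, TensorProduct.zero_tmul,
      LinearMap.zero_apply]
  | add a b ha hb =>
    simp only [LinearMap.map_add, LinearEquiv.map_add, TensorProduct.add_tmul,
      LinearMap.add_apply, ha, hb]
  | tmul a b =>
    induction v with
    | zero => simp only [LinearMap.map_zero, LinearEquiv.map_zero, TensorProduct.tmul_zero]
    | add a b ha hb =>
      simp only [LinearMap.map_add, LinearEquiv.map_add, TensorProduct.tmul_add, ha, hb]
    | tmul c d => rfl

theorem pair_ext {A : Type*} [AddCommGroup A] [Module K A]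
    {f g : Cot K H M ⊗[K] Cot K H M →ₗ[K] A}
    (h : ∀ x y, f (x ⊗ₜ y) = g (x ⊗ₜ y)) (c) : f c = g c :=
  LinearMap.congr_fun (TensorProduct.ext' h) c

theorem mulH_eq : mulH K H M = TensorProduct.lift (LinearMap.mul K H) ∘ₗ
    TensorProduct.map (compH K H M) (compH K H M) := rfl

theorem mul_eq_map₂ {A : Type*} [Ring A] [Algebra K A] (u v : A ⊗[K] A) :
    u * v = TensorProduct.map₂ (LinearMap.mul K A) (LinearMap.mul K A) u v := by
  induction u with
  | zero => simp only [LinearMap.map_zero, LinearMap.zero_apply, zero_mul]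
  | add a b ha hb => simp only [LinearMap.map_add, LinearMap.add_apply, add_mul, ha, hb]
  | tmul a b =>
    induction v with
    | zero => simp only [LinearMap.map_zero, mul_zero]
    | add a b ha hb => simp only [LinearMap.map_add, mul_add, ha, hb]
    | tmul c d =>
      rw [Algebra.TensorProduct.tmul_mul_tmul, TensorProduct.map₂_apply_tmul]
      rfl

theorem mulPair : BicomodulePair (mulH K H M) (mulM K H M) where
  comul_f₀ := pair_ext (f := comul ∘ₗ mulH K H M)
      (g := TensorProduct.map (mulH K H M) (mulH K H M) ∘ₗ comul) fun x y => by
    rw [LinearMap.comp_apply, LinearMap.comp_apply, mulH_tmul, Bialgebra.comul_mul, comul_compH,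
      comul_compH, mulH_eq, map_comul_tmul, mul_eq_map₂]
  counit_f₀ := pair_ext (f := counit ∘ₗ mulH K H M) (g := counit) fun x y => by
    rw [LinearMap.comp_apply, mulH_tmul, Bialgebra.counit_mul, TensorProduct.counit_tmul,
      smul_eq_mul, mul_comm]
    rfl
  lcoact_f₁ := pair_ext (f := lcoact ∘ₗ mulM K H M)
      (g := TensorProduct.map (mulH K H M) (mulM K H M) ∘ₗ comul) fun x y => by
    rw [LinearMap.comp_apply, LinearMap.comp_apply, mulM_tmul, LinearMap.map_add, lcoact_lact,
      lcoact_ract, comul_compH, comul_compH, lcoact_compM, lcoact_compM, mulH_eq, mulM,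
      TensorProduct.map_add_right, LinearMap.add_apply, map_comul_tmul, map_comul_tmul]
  rcoact_f₁ := pair_ext (f := rcoact ∘ₗ mulM K H M)
      (g := TensorProduct.map (mulM K H M) (mulH K H M) ∘ₗ comul) fun x y => by
    rw [LinearMap.comp_apply, LinearMap.comp_apply, mulM_tmul, LinearMap.map_add, rcoact_lact,
      rcoact_ract, comul_compH, comul_compH, rcoact_compM, rcoact_compM, mulH_eq, mulM,
      TensorProduct.map_add_left, LinearMap.add_apply, map_comul_tmul, map_comul_tmul]

theorem cotTau_of_succ (b : ℕ) (y : CotPow K H M (b + 1)) :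
    ∃ v : CotPow K H M b ⊗[K] M,
      cotTau K H M (cotOf K H M (b + 1) y) = (cotOf K H M b).rTensor M v := by
  cases b with
  | zero => exact ⟨_, cotTau_ofM (K := K) (H := H) (M := M) y⟩
  | succ b => exact ⟨_, cotTau_of b y⟩

theorem mulPair_tau (x y : Cot K H M) :
    mulPair.splitting.tau (x ⊗ₜ[K] y) =
      (TensorProduct.lift (lact (K := K) (H := H) (M := M))).lTensor _
        (TensorProduct.tensorTensorTensorComm K _ _ _ _ (cotRho K H M x ⊗ₜ cotTau K H M y)) +
      (TensorProduct.lift (ract (K := K) (H := H) (M := M))).lTensor _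
        (TensorProduct.tensorTensorTensorComm K _ _ _ _ (cotTau K H M x ⊗ₜ cotRho K H M y)) := by
  rw [BicomodulePair.splitting_tau, TensorProduct.comul_tmul, ← compH_comul, ← compH_comul,
    ← compM_comul, ← compM_comul]
  generalize comul (R := K) x = u
  generalize comul (R := K) y = v
  induction u with
  | zero => simp only [LinearMap.map_zero, LinearEquiv.map_zero, TensorProduct.zero_tmul, add_zero]
  | add a b ha hb =>
    simp only [LinearMap.map_add, LinearEquiv.map_add, TensorProduct.add_tmul, ha, hb]
    abel
  | tmul a b =>
    induction v with
    | zero =>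
      simp only [LinearMap.map_zero, LinearEquiv.map_zero, TensorProduct.tmul_zero, add_zero]
    | add a b ha hb =>
      simp only [LinearMap.map_add, LinearEquiv.map_add, TensorProduct.tmul_add, ha, hb]
      abel
    | tmul c d =>
      exact TensorProduct.tmul_add _ _ _

theorem rTensor_ttt_eq_zero {X₁ X₂ A B D Y : Type*} [AddCommGroup X₁] [Module K X₁]
    [AddCommGroup X₂] [Module K X₂] [AddCommGroup A] [Module K A] [AddCommGroup B] [Module K B]
    [AddCommGroup D] [Module K D] [AddCommGroup Y] [Module K Y]
    (L : Cot K H M ⊗[K] Cot K H M →ₗ[K] Y) (s : A ⊗[K] B →ₗ[K] D)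
    (f : X₁ →ₗ[K] Cot K H M) (g : X₂ →ₗ[K] Cot K H M) (h : ∀ x y, L (f x ⊗ₜ g y) = 0)
    (u : X₁ ⊗[K] A) (v : X₂ ⊗[K] B) :
    L.rTensor D (s.lTensor _ (TensorProduct.tensorTensorTensorComm K _ _ _ _
      (f.rTensor A u ⊗ₜ g.rTensor B v))) = 0 := by
  induction u with
  | zero => simp only [LinearMap.map_zero, LinearEquiv.map_zero, TensorProduct.zero_tmul]
  | add a b ha hb =>
    simp only [LinearMap.map_add, LinearEquiv.map_add, TensorProduct.add_tmul, ha, hb, add_zero]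
  | tmul a b =>
    induction v with
    | zero => simp only [LinearMap.map_zero, LinearEquiv.map_zero, TensorProduct.tmul_zero]
    | add a b ha hb =>
      simp only [LinearMap.map_add, LinearEquiv.map_add, TensorProduct.tmul_add, ha, hb, add_zero]
    | tmul c d =>
      simp only [LinearMap.rTensor_tmul, TensorProduct.tensorTensorTensorComm_tmul,
        LinearMap.lTensor_tmul, h, TensorProduct.zero_tmul]

theorem mulPair_component_of (k a b : ℕ) (h : k ≠ a + b) (x : CotPow K H M a)
    (y : CotPow K H M b) :
    mulPair.component k (cotOf K H M a x ⊗ₜ[K] cotOf K H M b y) = 0 := by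
  induction k generalizing a b with
  | zero =>
    rw [BicomodulePair.component_zero, mulH_tmul]
    by_cases ha : a = 0
    · rw [compH_of (by omega : b ≠ 0), mul_zero]; rfl
    · rw [compH_of ha, zero_mul]; rfl
  | succ k ih =>
    cases k with
    | zero =>
      rw [BicomodulePair.component_one, mulM_tmul]
      have h1 : lact (K := K) (compH K H M (cotOf K H M a x)) (compM K H M (cotOf K H M b y)) =
          0 := by
        by_cases ha : a = 0
        · rw [compM_of (by omega : b ≠ 1), LinearMap.map_zero]
        · rw [compH_of ha, LinearMap.map_zero, LinearMap.zero_apply]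
      have h2 : ract (K := K) (compM K H M (cotOf K H M a x)) (compH K H M (cotOf K H M b y)) =
          0 := by
        by_cases hb : b = 0
        · rw [compM_of (by omega : a ≠ 1), LinearMap.map_zero, LinearMap.zero_apply]
        · rw [compH_of hb, LinearMap.map_zero]
      rw [h1, h2, add_zero]; rfl
    | succ k =>
      apply incl_injective K H M k
      rw [BicomodulePair.incl_component, BicomodulePair.map_eq,
        ← BicomodulePair.splitting_tau mulPair, mulPair_tau, LinearMap.map_add, LinearMap.map_zero,
        cotRho_of, cotRho_of]
      have h1 : (mulPair.component (k + 1)).rTensor M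
          ((TensorProduct.lift (lact (K := K) (H := H) (M := M))).lTensor _
          (TensorProduct.tensorTensorTensorComm K _ _ _ _
            ((cotOf K H M a).rTensor H ((cotPow K H M a).coact x) ⊗ₜ
              cotTau K H M (cotOf K H M b y)))) = 0 := by
        cases b with
        | zero =>
          have h0 : cotTau K H M (cotOf K H M 0 y) = 0 := cotTau_ofH (K := K) (H := H) (M := M) y
          rw [h0, TensorProduct.tmul_zero, LinearEquiv.map_zero, LinearMap.map_zero,
            LinearMap.map_zero]
        | succ b =>
          obtain ⟨v, hv⟩ := cotTau_of_succ b y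
          rw [hv]
          exact rTensor_ttt_eq_zero _ _ _ _ (fun x y => ih a b (by omega) x y) _ _
      have h2 : (mulPair.component (k + 1)).rTensor M
          ((TensorProduct.lift (ract (K := K) (H := H) (M := M))).lTensor _
          (TensorProduct.tensorTensorTensorComm K _ _ _ _
            (cotTau K H M (cotOf K H M a x) ⊗ₜ
              (cotOf K H M b).rTensor H ((cotPow K H M b).coact y)))) = 0 := by
        cases a with
        | zero =>
          have h0 : cotTau K H M (cotOf K H M 0 x) = 0 := cotTau_ofH (K := K) (H := H) (M := M) x
          rw [h0, TensorProduct.zero_tmul, LinearEquiv.map_zero, LinearMap.map_zero,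
            LinearMap.map_zero]
        | succ a =>
          obtain ⟨v, hv⟩ := cotTau_of_succ a x
          rw [hv]
          exact rTensor_ttt_eq_zero _ _ _ _ (fun x y => ih a b (by omega) x y) _ _
      rw [h1, h2, add_zero]

theorem mulPair_finite (c : Cot K H M ⊗[K] Cot K H M) :
    ∃ N : ℕ, ∀ k, N < k → mulPair.component k c = 0 := by
  have hadd : ∀ c d : Cot K H M ⊗[K] Cot K H M,
      (∃ N : ℕ, ∀ k, N < k → mulPair.component k c = 0) →
      (∃ N : ℕ, ∀ k, N < k → mulPair.component k d = 0) →
      ∃ N : ℕ, ∀ k, N < k → mulPair.component k (c + d) = 0 := by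
    rintro c d ⟨N, hN⟩ ⟨N', hN'⟩
    refine ⟨max N N', fun k hk => ?_⟩
    rw [LinearMap.map_add, hN k (by omega), hN' k (by omega), add_zero]
  have hzero : ∃ N : ℕ, ∀ k, N < k →
      mulPair.component k (0 : Cot K H M ⊗[K] Cot K H M) = 0 :=
    ⟨0, fun k _ => LinearMap.map_zero _⟩
  induction c with
  | zero => exact hzero
  | add c d hc hd => exact hadd c d hc hd
  | tmul x y =>
    induction x using cot_ind with
    | hz => rw [TensorProduct.zero_tmul]; exact hzero
    | ha a b ha hb => rw [TensorProduct.add_tmul]; exact hadd _ _ ha hb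
    | ho a x =>
      induction y using cot_ind with
      | hz => rw [TensorProduct.tmul_zero]; exact hzero
      | ha a b ha hb => rw [TensorProduct.tmul_add]; exact hadd _ _ ha hb
      | ho b y => exact ⟨a + b, fun k hk => mulPair_component_of k a b (by omega) x y⟩

variable (K H M) in
/-- The multiplication of `Cot_H(M)`: the coalgebra map `Cot_H(M) ⊗ Cot_H(M) → Cot_H(M)`
whose degree `0` and `1` parts are given by the multiplication of `H` and the two actions
of `H` on `M`. -/
noncomputable def cotMul : Cot K H M ⊗[K] Cot K H M →ₗc[K] Cot K H M :=
  mulPair.lift mulPair_finite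

theorem compH_cotMul (x y : Cot K H M) :
    compH K H M (cotMul K H M (x ⊗ₜ y)) = compH K H M x * compH K H M y :=
  mulPair.compH_lift _ _

theorem compM_cotMul (x y : Cot K H M) :
    compM K H M (cotMul K H M (x ⊗ₜ y)) = lact (K := K) (compH K H M x) (compM K H M y) +
      ract (K := K) (compM K H M x) (compH K H M y) :=
  mulPair.compM_lift _ _

theorem cotComp_cotMul_of (k a b : ℕ) (h : k ≠ a + b) (x : CotPow K H M a)
    (y : CotPow K H M b) :
    cotComp K H M k (cotMul K H M (cotOf K H M a x ⊗ₜ cotOf K H M b y)) = 0 :=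
  (mulPair.cotComp_lift _ _ _).trans (mulPair_component_of k a b h x y)

end Mul

section CotBialgebra

variable {K : Type w} {H M : Type u} [Field K] [Ring H] [HopfAlgebra K H]
  [AddCommGroup M] [Module K M] [HopfBimodule K H M]

open HopfBimodule

theorem cotMul_assoc (x y z : Cot K H M) :
    cotMul K H M (cotMul K H M (x ⊗ₜ y) ⊗ₜ z) = cotMul K H M (x ⊗ₜ cotMul K H M (y ⊗ₜ z)) := by
  have key : (cotMul K H M).comp ((Coalgebra.TensorProduct.map (cotMul K H M)
        (CoalgHom.id K (Cot K H M)))) =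
      ((cotMul K H M).comp (Coalgebra.TensorProduct.map (CoalgHom.id K (Cot K H M))
        (cotMul K H M))).comp
        (Coalgebra.TensorProduct.assoc K K (Cot K H M) (Cot K H M) (Cot K H M)).toCoalgHom := by
    have h0 : ∀ x y z : Cot K H M,
        compH K H M (cotMul K H M (cotMul K H M (x ⊗ₜ y) ⊗ₜ z)) =
        compH K H M (cotMul K H M (x ⊗ₜ cotMul K H M (y ⊗ₜ z))) := by
      intro x y z
      rw [compH_cotMul, compH_cotMul, compH_cotMul, compH_cotMul, mul_assoc]
    have h1 : ∀ x y z : Cot K H M,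
        compM K H M (cotMul K H M (cotMul K H M (x ⊗ₜ y) ⊗ₜ z)) =
        compM K H M (cotMul K H M (x ⊗ₜ cotMul K H M (y ⊗ₜ z))) := by
      intro x y z
      rw [compM_cotMul, compM_cotMul, compM_cotMul, compM_cotMul, compH_cotMul, compH_cotMul,
        mul_lact, ract_mul, LinearMap.map_add, LinearMap.map_add, LinearMap.add_apply, lact_ract,
        add_assoc]
    apply cot_coalgHom_ext
    · exact fun c => LinearMap.congr_fun (f := compH K H M ∘ₗ CoalgHom.toLinearMap _)
        (g := compH K H M ∘ₗ CoalgHom.toLinearMap _)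
        (TensorProduct.ext_threefold h0) c
    · exact fun c => LinearMap.congr_fun (f := compM K H M ∘ₗ CoalgHom.toLinearMap _)
        (g := compM K H M ∘ₗ CoalgHom.toLinearMap _)
        (TensorProduct.ext_threefold h1) c
  exact DFunLike.congr_fun key ((x ⊗ₜ y) ⊗ₜ z)

theorem comul_ofH (h : H) :
    comul (R := K) (ofH K H M h) = TensorProduct.map (ofH K H M) (ofH K H M) (comul h) := by
  apply tensor_cot_ext
  intro k
  rw [cot_comul_def, cotComp_comul, BicomodulePair.map_eq, ← lTensor_rTensor,
    ← LinearMap.lTensor_comp_apply]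
  cases k with
  | zero =>
    have h1 : compH K H M ∘ₗ ofH K H M = LinearMap.id := LinearMap.ext fun x => compH_ofH (K := K) (M := M) x
    have h2 : ∀ w : Cot K H M ⊗[K] H, (compH K H M ∘ₗ ofH K H M).lTensor (Cot K H M) w = w := by
      intro w
      rw [h1, LinearMap.lTensor_id, LinearMap.id_apply]
    exact (cotRho_ofH h).trans (h2 _).symm
  | succ k =>
    have h1 : cotComp K H M (k + 1) ∘ₗ ofH K H M = 0 :=
      LinearMap.ext fun x => cotComp_ofH (K := K) (M := M) (Nat.succ_ne_zero k) x
    rw [h1, LinearMap.lTensor_zero, LinearMap.zero_apply]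
    exact cotSplit_of_lt (Nat.succ_pos k) h

theorem counit_ofH (h : H) : counit (R := K) (ofH K H M h) = counit (R := K) h :=
  congrArg (counit (R := K)) (compH_ofH (K := K) (M := M) h)

theorem one_cotMul (x : Cot K H M) : cotMul K H M (ofH K H M 1 ⊗ₜ x) = x := by
  have hc : ∀ y : Cot K H M ⊗[K] Cot K H M, TensorProduct.map
      (TensorProduct.mk K (Cot K H M) (Cot K H M) (ofH K H M 1))
      (TensorProduct.mk K (Cot K H M) (Cot K H M) (ofH K H M 1)) y =
      TensorProduct.tensorTensorTensorComm K _ _ _ _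
        ((ofH K H M 1 ⊗ₜ[K] ofH K H M 1) ⊗ₜ[K] y) :=
    LinearMap.congr_fun (f := TensorProduct.map
      (TensorProduct.mk K (Cot K H M) (Cot K H M) (ofH K H M 1))
      (TensorProduct.mk K (Cot K H M) (Cot K H M) (ofH K H M 1)))
      (g := (TensorProduct.tensorTensorTensorComm K _ _ _ _).toLinearMap ∘ₗ
        TensorProduct.mk K _ _ (ofH K H M 1 ⊗ₜ[K] ofH K H M 1))
      (TensorProduct.ext' fun _ _ => rfl)
  let j : Cot K H M →ₗc[K] Cot K H M ⊗[K] Cot K H M :=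
    { TensorProduct.mk K (Cot K H M) (Cot K H M) (ofH K H M 1) with
      counit_comp := LinearMap.ext fun x => by
        change counit (R := K) (ofH K H M 1 ⊗ₜ[K] x) = _
        rw [TensorProduct.counit_tmul, counit_ofH, Bialgebra.counit_one, smul_eq_mul, mul_one]
      map_comp_comul := LinearMap.ext fun x => by
        change TensorProduct.map
          (TensorProduct.mk K (Cot K H M) (Cot K H M) (ofH K H M 1))
          (TensorProduct.mk K (Cot K H M) (Cot K H M) (ofH K H M 1)) (comul (R := K) x) =
          comul (R := K) (ofH K H M 1 ⊗ₜ[K] x)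
        rw [hc, TensorProduct.comul_tmul, comul_ofH, comul_one', TensorProduct.map_tmul]
        rfl }
  have key : (cotMul K H M).comp j = CoalgHom.id K (Cot K H M) := by
    apply cot_coalgHom_ext
    · intro c
      change compH K H M (cotMul K H M (ofH K H M 1 ⊗ₜ c)) = _
      rw [compH_cotMul, compH_ofH, one_mul]; rfl
    · intro c
      change compM K H M (cotMul K H M (ofH K H M 1 ⊗ₜ c)) = _
      rw [compM_cotMul, compH_ofH, compM_ofH, LinearMap.map_zero, LinearMap.zero_apply, one_lact,
        add_zero]; rfl
  exact DFunLike.congr_fun key x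

theorem cotMul_one (x : Cot K H M) : cotMul K H M (x ⊗ₜ ofH K H M 1) = x := by
  let f := (TensorProduct.mk K (Cot K H M) (Cot K H M)).flip (ofH K H M 1)
  have hc : ∀ y : Cot K H M ⊗[K] Cot K H M, TensorProduct.map f f y =
      TensorProduct.tensorTensorTensorComm K _ _ _ _
        (y ⊗ₜ[K] (ofH K H M 1 ⊗ₜ[K] ofH K H M 1)) :=
    LinearMap.congr_fun (f := TensorProduct.map f f)
      (g := (TensorProduct.tensorTensorTensorComm K _ _ _ _).toLinearMap ∘ₗ
        (TensorProduct.mk K _ _).flip (ofH K H M 1 ⊗ₜ[K] ofH K H M 1))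
      (TensorProduct.ext' fun _ _ => rfl)
  let j : Cot K H M →ₗc[K] Cot K H M ⊗[K] Cot K H M :=
    { f with
      counit_comp := LinearMap.ext fun x => by
        change counit (R := K) (x ⊗ₜ[K] ofH K H M 1) = _
        rw [TensorProduct.counit_tmul, counit_ofH, Bialgebra.counit_one, smul_eq_mul, one_mul]
      map_comp_comul := LinearMap.ext fun x => by
        change TensorProduct.map f f (comul (R := K) x) = comul (R := K) (x ⊗ₜ[K] ofH K H M 1)
        rw [hc, TensorProduct.comul_tmul, comul_ofH, comul_one', TensorProduct.map_tmul]
        rfl }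
  have key : (cotMul K H M).comp j = CoalgHom.id K (Cot K H M) := by
    apply cot_coalgHom_ext
    · intro c
      change compH K H M (cotMul K H M (c ⊗ₜ ofH K H M 1)) = _
      rw [compH_cotMul, compH_ofH, mul_one]; rfl
    · intro c
      change compM K H M (cotMul K H M (c ⊗ₜ ofH K H M 1)) = _
      rw [compM_cotMul, compH_ofH, compM_ofH, LinearMap.map_zero, ract_one, zero_add]; rfl
  exact DFunLike.congr_fun key x

/-- The ring structure of `Cot_H(M)`, with multiplication `cotMul` and unit `1 ∈ H`. -/
noncomputable instance : Ring (Cot K H M) :=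
  { (inferInstance : AddCommGroup (Cot K H M)) with
    mul := fun x y => cotMul K H M (x ⊗ₜ y)
    one := ofH K H M 1
    mul_assoc := cotMul_assoc
    one_mul := one_cotMul
    mul_one := cotMul_one
    left_distrib := fun x y z => by
      change cotMul K H M (x ⊗ₜ (y + z)) = cotMul K H M (x ⊗ₜ y) + cotMul K H M (x ⊗ₜ z)
      rw [TensorProduct.tmul_add, map_add]
    right_distrib := fun x y z => by
      change cotMul K H M ((x + y) ⊗ₜ z) = cotMul K H M (x ⊗ₜ z) + cotMul K H M (y ⊗ₜ z)
      rw [TensorProduct.add_tmul, map_add]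
    zero_mul := fun x => by
      change cotMul K H M (0 ⊗ₜ x) = 0
      rw [TensorProduct.zero_tmul, map_zero]
    mul_zero := fun x => by
      change cotMul K H M (x ⊗ₜ 0) = 0
      rw [TensorProduct.tmul_zero, map_zero] }

theorem cot_mul_def (x y : Cot K H M) : x * y = cotMul K H M (x ⊗ₜ y) := rfl

theorem cot_one_def : (1 : Cot K H M) = ofH K H M 1 := rfl

noncomputable instance : Algebra K (Cot K H M) :=
  Algebra.ofModule
    (fun r x y => by
      rw [cot_mul_def, cot_mul_def, ← TensorProduct.smul_tmul', map_smul])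
    (fun r x y => by
      rw [cot_mul_def, cot_mul_def, TensorProduct.tmul_smul, map_smul])

theorem cot_comul_mul (x y : Cot K H M) :
    comul (R := K) (x * y) = comul (R := K) x * comul (R := K) y := by
  have h : comul (R := K) (cotMul K H M (x ⊗ₜ y)) =
      TensorProduct.map (cotMul K H M).toLinearMap (cotMul K H M).toLinearMap
        (comul (R := K) (x ⊗ₜ[K] y)) :=
    (CoalgHomClass.map_comp_comul_apply (cotMul K H M) (x ⊗ₜ y)).symm
  rw [cot_mul_def, h, TensorProduct.comul_tmul]
  generalize comul (R := K) x = u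
  generalize comul (R := K) y = v
  induction u with
  | zero => simp only [LinearMap.map_zero, LinearEquiv.map_zero, TensorProduct.zero_tmul, zero_mul]
  | add a b ha hb =>
    simp only [LinearMap.map_add, LinearEquiv.map_add, TensorProduct.add_tmul, add_mul, ha, hb]
  | tmul a b =>
    induction v with
    | zero =>
      simp only [LinearMap.map_zero, LinearEquiv.map_zero, TensorProduct.tmul_zero, mul_zero]
    | add a b ha hb =>
      simp only [LinearMap.map_add, LinearEquiv.map_add, TensorProduct.tmul_add, mul_add, ha, hb]
    | tmul c d =>
      rw [Algebra.TensorProduct.tmul_mul_tmul]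
      rfl

noncomputable instance : Bialgebra K (Cot K H M) :=
  Bialgebra.mk' K (Cot K H M)
    ((counit_ofH (K := K) (M := M) (1 : H)).trans Bialgebra.counit_one)
    (fun {x y} => by
      have h : counit (R := K) (cotMul K H M (x ⊗ₜ y)) = counit (R := K) (x ⊗ₜ[K] y) :=
        CoalgHomClass.counit_comp_apply (cotMul K H M) (x ⊗ₜ y)
      rw [cot_mul_def, h, TensorProduct.counit_tmul, smul_eq_mul, mul_comm])
    (by
      rw [cot_one_def, comul_ofH, comul_one', TensorProduct.map_tmul]
      rfl)
    (fun {x y} => cot_comul_mul x y)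

/-- Products of homogeneous elements are homogeneous. -/
theorem cotComp_mul_of (k a b : ℕ) (h : k ≠ a + b) (x : CotPow K H M a)
    (y : CotPow K H M b) : cotComp K H M k (cotOf K H M a x * cotOf K H M b y) = 0 :=
  cotComp_cotMul_of k a b h x y

theorem ofH_mul (g h : H) : ofH K H M (g * h) = ofH K H M g * ofH K H M h := by
  apply cot_ext
  intro n
  by_cases hn : n = 0
  · subst hn
    have h1 : compH K H M (ofH K H M g * ofH K H M h) = g * h := by
      rw [cot_mul_def, compH_cotMul, compH_ofH, compH_ofH]
    exact (compH_ofH (K := K) (M := M) (g * h)).trans h1.symm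
  · exact (cotComp_ofH hn (g * h)).trans (cotComp_mul_of n 0 0 hn g h).symm

end CotBialgebra

section CotHopfAlgebra

variable {K : Type w} {H M : Type u} [Field K] [Ring H] [HopfAlgebra K H]
  [AddCommGroup M] [Module K M] [HopfBimodule K H M]

open HopfBimodule WithConv

theorem cotComp_cotSplit_of (j k n : ℕ) (h : j + k ≠ n) (x : CotPow K H M n) :
    (cotComp K H M j).rTensor (CotPow K H M k) (cotSplit K H M k (cotOf K H M n x)) = 0 := by
  induction k generalizing n with
  | zero =>
    have h1 : (cotComp K H M j).rTensor H (cotRho K H M (cotOf K H M n x)) = 0 := by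
      rw [cotRho_of]
      exact rTensor_eq_zero (fun y => cotComp_cotOf_ne (by omega) y) _
    exact h1
  | succ k ih =>
    have h1 : cotTau K H M (cotOf K H M n x) = 0 ∨ ∃ m, n = m + 1 ∧
        ∃ v : CotPow K H M m ⊗[K] M, cotTau K H M (cotOf K H M n x) =
          (cotOf K H M m).rTensor M v := by
      cases n with
      | zero => exact Or.inl (cotTau_ofH (K := K) (H := H) (M := M) x)
      | succ m => exact Or.inr ⟨m, rfl, cotTau_of_succ m x⟩
    cases k with
    | zero =>
      have h2 : (cotComp K H M j).rTensor M (cotTau K H M (cotOf K H M n x)) = 0 := by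
        obtain h1 | ⟨m, rfl, v, hv⟩ := h1
        · rw [h1, LinearMap.map_zero]
        · rw [hv]
          exact rTensor_eq_zero (fun y => cotComp_cotOf_ne (by omega) y) _
      exact h2
    | succ k =>
      apply lTensor_injective _ _ (incl_injective K H M k)
      rw [lTensor_rTensor, incl_cotSplit, LinearMap.map_zero]
      obtain h1 | ⟨m, rfl, v, hv⟩ := h1
      · rw [h1, LinearMap.map_zero, LinearEquiv.map_zero, LinearMap.map_zero]
      · rw [hv, ← assoc_rTensor_rTensor, ← LinearMap.rTensor_comp_apply,
          rTensor_eq_zero (fun y => ih m (by omega) y), LinearEquiv.map_zero]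

theorem cotSplit_of_eq (j k : ℕ) (x : CotPow K H M (j + k)) :
    cotSplit K H M k (cotOf K H M (j + k) x) = (cotOf K H M j).rTensor (CotPow K H M k)
      ((cotComp K H M j).rTensor (CotPow K H M k)
        (cotSplit K H M k (cotOf K H M (j + k) x))) := by
  apply tensor_cot_ext_left
  intro i
  by_cases hi : i = j
  · subst hi
    rw [← LinearMap.rTensor_comp_apply, (LinearMap.ext fun y => cotComp_cotOf i y :
      cotComp K H M i ∘ₗ cotOf K H M i = LinearMap.id), LinearMap.rTensor_id, LinearMap.id_apply]
  · rw [cotComp_cotSplit_of i k (j + k) (by omega), rTensor_eq_zero]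
    exact fun y => cotComp_cotOf_ne hi y

/-- The comultiplication respects the degrees. -/
theorem comul_cotOf (n : ℕ) (x : CotPow K H M n) :
    ∃ v : ∀ p : ℕ × ℕ, CotPow K H M p.1 ⊗[K] CotPow K H M p.2,
      comul (R := K) (cotOf K H M n x) = ∑ p ∈ Finset.HasAntidiagonal.antidiagonal n,
        TensorProduct.map (cotOf K H M p.1) (cotOf K H M p.2) (v p) := by
  refine ⟨fun p => (cotComp K H M p.1).rTensor (CotPow K H M p.2)
        (cotSplit K H M p.2 (cotOf K H M n x)), ?_⟩
  rw [cot_comul_def, cotComul_of, ← Finset.Nat.sum_antidiagonal_swap,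
    Finset.Nat.sum_antidiagonal_eq_sum_range_succ_mk]
  refine Finset.sum_congr rfl fun k hk => ?_
  obtain ⟨j, rfl⟩ : ∃ j, n = j + k := ⟨n - k, by have := Finset.mem_range.1 hk; omega⟩
  simp only [Prod.swap, Nat.add_sub_cancel]
  have hm : TensorProduct.map (cotOf K H M j) (cotOf K H M k) =
      (cotOf K H M k).lTensor (Cot K H M) ∘ₗ (cotOf K H M j).rTensor (CotPow K H M k) :=
    (LinearMap.lTensor_comp_rTensor _ _ _).symm
  have e : j + k - k = j := Nat.add_sub_cancel j k
  rw [e, hm, LinearMap.comp_apply, ← cotSplit_of_eq]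

/-- The convolution algebra of endomorphisms. -/
abbrev CotConv (K : Type w) (H M : Type u) [Field K] [Ring H] [HopfAlgebra K H]
    [AddCommGroup M] [Module K M] [HopfBimodule K H M] : Type u :=
  WithConv (Cot K H M →ₗ[K] Cot K H M)

theorem conv_congr (f g f' g' : CotConv K H M) (n : ℕ)
    (h : ∀ p ∈ Finset.HasAntidiagonal.antidiagonal n, ∀ x y,
      f.ofConv (cotOf K H M p.1 x) * g.ofConv (cotOf K H M p.2 y) =
      f'.ofConv (cotOf K H M p.1 x) * g'.ofConv (cotOf K H M p.2 y)) (x : CotPow K H M n) :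
    (f * g).ofConv (cotOf K H M n x) = (f' * g').ofConv (cotOf K H M n x) := by
  change LinearMap.mul' K _ (TensorProduct.map f.ofConv g.ofConv (comul _)) =
    LinearMap.mul' K _ (TensorProduct.map f'.ofConv g'.ofConv (comul _))
  obtain ⟨v, hv⟩ := comul_cotOf n x
  rw [hv, map_sum, map_sum, map_sum, map_sum]
  refine Finset.sum_congr rfl fun p hp => ?_
  generalize v p = w
  induction w with
  | zero => simp only [LinearMap.map_zero]
  | add a b ha hb => simp only [LinearMap.map_add, ha, hb]
  | tmul a b => exact h p hp a b

theorem conv_pow_of_lt (f : CotConv K H M) (hf : ∀ x, f.ofConv (ofH K H M x) = 0) (k n : ℕ)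
    (h : n < k) (x : CotPow K H M n) : (f ^ k).ofConv (cotOf K H M n x) = 0 := by
  induction k generalizing n with
  | zero => omega
  | succ k ih =>
    rw [pow_succ']
    refine (conv_congr f (f ^ k) 0 0 n (fun p hp y z => ?_) x).trans ?_
    · rw [Finset.HasAntidiagonal.mem_antidiagonal] at hp
      rw [ofConv_zero, LinearMap.zero_apply, zero_mul]
      by_cases h1 : p.2 < k
      · rw [ih p.2 h1, mul_zero]
      · obtain ⟨i, j⟩ := p
        obtain rfl : i = 0 := by simp only at hp h1; omega
        have h2 : f.ofConv (cotOf K H M 0 y) = 0 := hf y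
        rw [h2, zero_mul]
    · rw [mul_zero, ofConv_zero, LinearMap.zero_apply]

/-- The geometric series. -/
noncomputable def convGeom (f : CotConv K H M) : CotConv K H M :=
  toConv (DirectSum.toModule K ℕ _ fun n =>
    (∑ k ∈ Finset.range (n + 1), f ^ k).ofConv ∘ₗ cotOf K H M n)

theorem convGeom_of (f : CotConv K H M) (n : ℕ) (x : CotPow K H M n) :
    (convGeom f).ofConv (cotOf K H M n x) =
      (∑ k ∈ Finset.range (n + 1), f ^ k).ofConv (cotOf K H M n x) :=
  DirectSum.toModule_lof (φ := fun n =>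
    (∑ k ∈ Finset.range (n + 1), f ^ k).ofConv ∘ₗ cotOf K H M n) K n x

theorem convGeom_of_le (f : CotConv K H M) (hf : ∀ x, f.ofConv (ofH K H M x) = 0) (m n : ℕ)
    (h : n ≤ m) (x : CotPow K H M n) :
    (convGeom f).ofConv (cotOf K H M n x) =
      (∑ k ∈ Finset.range (m + 1), f ^ k).ofConv (cotOf K H M n x) := by
  rw [convGeom_of]
  induction m, h using Nat.le_induction with
  | base => rfl
  | succ m hm ih =>
    rw [Finset.sum_range_succ _ (m + 1), ofConv_add, LinearMap.add_apply, ← ih,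
      conv_pow_of_lt f hf (m + 1) n (by omega), add_zero]

theorem conv_isUnit (f : CotConv K H M) (hf : ∀ x, f.ofConv (ofH K H M x) = 0) :
    IsUnit (1 - f) := by
  have h1 : (1 - f) * convGeom f = 1 := by
    apply ofConv_injective
    apply cot_hom_ext
    intro n x
    rw [conv_congr (1 - f) (convGeom f) (1 - f) (∑ k ∈ Finset.range (n + 1), f ^ k) n
      (fun p hp y z => by
        rw [convGeom_of_le f hf n p.2 (by rw [Finset.HasAntidiagonal.mem_antidiagonal] at hp; omega)]) x,
      mul_neg_geom_sum, ofConv_sub, LinearMap.sub_apply, conv_pow_of_lt f hf _ _ (by omega),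
      sub_zero]
  have h2 : convGeom f * (1 - f) = 1 := by
    apply ofConv_injective
    apply cot_hom_ext
    intro n x
    rw [conv_congr (convGeom f) (1 - f) (∑ k ∈ Finset.range (n + 1), f ^ k) (1 - f) n
      (fun p hp y z => by
        rw [convGeom_of_le f hf n p.1 (by rw [Finset.HasAntidiagonal.mem_antidiagonal] at hp; omega)]) x,
      geom_sum_mul_neg, ofConv_sub, LinearMap.sub_apply, conv_pow_of_lt f hf _ _ (by omega),
      sub_zero]
  exact ⟨⟨1 - f, convGeom f, h1, h2⟩, rfl⟩

theorem ofH_algebraMap (r : K) : ofH K H M (algebraMap K H r) = algebraMap K (Cot K H M) r := by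
  rw [Algebra.algebraMap_eq_smul_one, map_smul, Algebra.algebraMap_eq_smul_one, cot_one_def]

/-- The antipode of `H`, extended by zero. -/
noncomputable def preAntipode : CotConv K H M :=
  toConv (ofH K H M ∘ₗ HopfAlgebra.antipode K ∘ₗ compH K H M)

theorem id_mul_preAntipode (x : H) :
    (toConv LinearMap.id * preAntipode : CotConv K H M).ofConv (ofH K H M x) =
      (1 : CotConv K H M).ofConv (ofH K H M x) := by
  change LinearMap.mul' K _ (TensorProduct.map LinearMap.id
    (ofH K H M ∘ₗ HopfAlgebra.antipode K ∘ₗ compH K H M) (comul (R := K) (ofH K H M x))) =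
    algebraMap K _ (counit (R := K) (ofH K H M x))
  rw [counit_ofH, ← ofH_algebraMap, ← HopfAlgebra.mul_antipode_lTensor_comul_apply, comul_ofH]
  generalize comul (R := K) x = w
  induction w with
  | zero => simp only [LinearMap.map_zero]
  | add a b ha hb => simp only [LinearMap.map_add, ha, hb]
  | tmul a b =>
    change ofH K H M a * ofH K H M (HopfAlgebra.antipode K (compH K H M (ofH K H M b))) =
      ofH K H M (a * HopfAlgebra.antipode K b)
    rw [compH_ofH, ofH_mul]

theorem preAntipode_mul_id (x : H) :
    (preAntipode * toConv LinearMap.id : CotConv K H M).ofConv (ofH K H M x) =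
      (1 : CotConv K H M).ofConv (ofH K H M x) := by
  change LinearMap.mul' K _ (TensorProduct.map
    (ofH K H M ∘ₗ HopfAlgebra.antipode K ∘ₗ compH K H M) LinearMap.id
      (comul (R := K) (ofH K H M x))) = algebraMap K _ (counit (R := K) (ofH K H M x))
  rw [counit_ofH, ← ofH_algebraMap, ← HopfAlgebra.mul_antipode_rTensor_comul_apply, comul_ofH]
  generalize comul (R := K) x = w
  induction w with
  | zero => simp only [LinearMap.map_zero]
  | add a b ha hb => simp only [LinearMap.map_add, ha, hb]
  | tmul a b =>
    change ofH K H M (HopfAlgebra.antipode K (compH K H M (ofH K H M a))) * ofH K H M b =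
      ofH K H M (HopfAlgebra.antipode K a * b)
    rw [compH_ofH, ofH_mul]

theorem id_isUnit : IsUnit (toConv LinearMap.id : CotConv K H M) := by
  have h1 : IsUnit (toConv LinearMap.id * preAntipode : CotConv K H M) := by
    have := conv_isUnit (1 - toConv LinearMap.id * preAntipode : CotConv K H M) fun x => by
      rw [ofConv_sub, LinearMap.sub_apply, id_mul_preAntipode, sub_self]
    rwa [sub_sub_cancel] at this
  have h2 : IsUnit (preAntipode * toConv LinearMap.id : CotConv K H M) := by
    have := conv_isUnit (1 - preAntipode * toConv LinearMap.id : CotConv K H M) fun x => by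
      rw [ofConv_sub, LinearMap.sub_apply, preAntipode_mul_id, sub_self]
    rwa [sub_sub_cancel] at this
  obtain ⟨a, ha⟩ := h1.exists_right_inv
  obtain ⟨b, hb⟩ := h2.exists_left_inv
  rw [mul_assoc] at ha
  rw [← mul_assoc] at hb
  have hab := left_inv_eq_right_inv hb ha
  exact ⟨⟨toConv LinearMap.id, preAntipode * a, ha, by rw [← hab]; exact hb⟩, rfl⟩

/-- The antipode of `Cot_H(M)`: the inverse of the identity for the convolution product. -/
noncomputable def cotAntipode (K : Type w) (H M : Type u) [Field K] [Ring H] [HopfAlgebra K H]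
    [AddCommGroup M] [Module K M] [HopfBimodule K H M] : Cot K H M →ₗ[K] Cot K H M :=
  ((id_isUnit (K := K) (H := H) (M := M)).unit⁻¹ : (CotConv K H M)ˣ).1.ofConv

/-- The cotensor Hopf algebra `Cot_H(M)`. -/
noncomputable instance : HopfAlgebra K (Cot K H M) :=
  HopfAlgebra.ofConvInverse (cotAntipode K H M)
    (id_isUnit (K := K) (H := H) (M := M)).val_inv_mul
    (id_isUnit (K := K) (H := H) (M := M)).mul_val_inv

end CotHopfAlgebra

/-- A grading `B = ⨁ B_n` of the algebra `B` makes the Hopf algebra `B` a graded Hopf algebra when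
`Δ(B_n) ⊆ ∑_{i + j = n} B_i ⊗ B_j`, `ε(B_n) = 0` for `n > 0` and `S(B_n) ⊆ B_n`. -/
class GradedHopfAlgebra {K B : Type*} [Field K] [Ring B] [HopfAlgebra K B]
    (𝒜 : ℕ → Submodule K B) [GradedAlgebra 𝒜] : Prop where
  comul_mem : ∀ n, ∀ b ∈ 𝒜 n, comul (R := K) b ∈ ⨆ p ∈ Finset.HasAntidiagonal.antidiagonal n,
    LinearMap.range (TensorProduct.map (𝒜 p.1).subtype (𝒜 p.2).subtype)
  counit_eq_zero : ∀ n, 0 < n → ∀ b ∈ 𝒜 n, counit (R := K) b = 0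
  antipode_mem : ∀ n, ∀ b ∈ 𝒜 n, HopfAlgebra.antipode K b ∈ 𝒜 n

section Couple

variable {K B : Type*} [Field K] [Ring B] [HopfAlgebra K B]
  (𝒜 : ℕ → Submodule K B) [GradedAlgebra 𝒜]

/-- The projection of `B` onto `B_n`. -/
noncomputable def gradeProj (n : ℕ) : B →ₗ[K] 𝒜 n :=
  DirectSum.component K ℕ (fun n => 𝒜 n) n ∘ₗ (DirectSum.decomposeLinearEquiv 𝒜).toLinearMap

theorem gradeProj_coe (n : ℕ) (x : 𝒜 n) : gradeProj 𝒜 n (x : B) = x := by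
  have h : DirectSum.decompose 𝒜 (x : B) = DirectSum.of (fun n => 𝒜 n) n x :=
    DirectSum.decompose_coe 𝒜 x
  change DirectSum.component K ℕ (fun n => 𝒜 n) n (DirectSum.decompose 𝒜 (x : B)) = x
  rw [h]
  exact DirectSum.component.lof_self (M := fun n => 𝒜 n) K n x

theorem gradeProj_coe_ne {m n : ℕ} (hmn : m ≠ n) (x : 𝒜 n) : gradeProj 𝒜 m (x : B) = 0 := by
  have h : DirectSum.decompose 𝒜 (x : B) = DirectSum.of (fun n => 𝒜 n) n x :=
    DirectSum.decompose_coe 𝒜 x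
  change DirectSum.component K ℕ (fun n => 𝒜 n) m (DirectSum.decompose 𝒜 (x : B)) = 0
  rw [h]
  have := DirectSum.component.of (R := K) (M := fun n => 𝒜 n) m n x
  rw [dif_neg (Ne.symm hmn)] at this
  exact this

theorem graded_hom_ext {A : Type*} [AddCommGroup A] [Module K A] {f g : B →ₗ[K] A}
    (h : ∀ n (x : 𝒜 n), f x = g x) : f = g := by
  ext b
  induction b using DirectSum.Decomposition.inductionOn 𝒜 with
  | zero => rw [map_zero, map_zero]
  | homogeneous x => exact h _ x
  | add a b ha hb => rw [map_add, map_add, ha, hb]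

/-- The component `B → B_i ⊗ B_j` of the comultiplication. -/
noncomputable def gradeComul (i j : ℕ) : B →ₗ[K] 𝒜 i ⊗[K] 𝒜 j :=
  TensorProduct.map (gradeProj 𝒜 i) (gradeProj 𝒜 j) ∘ₗ comul

/-- Multiplication of elements of `B_n` by elements of `B_0` on the left. -/
noncomputable def gradeLact (n : ℕ) : 𝒜 0 →ₗ[K] 𝒜 n →ₗ[K] 𝒜 n :=
  LinearMap.mk₂ K (fun a x => ⟨(a : B) * x, by
      have := SetLike.mul_mem_graded a.2 x.2; rwa [zero_add] at this⟩)
    (fun a b x => Subtype.ext (add_mul (a : B) b x))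
    (fun r a x => Subtype.ext (smul_mul_assoc r (a : B) x))
    (fun a x y => Subtype.ext (mul_add (a : B) x y))
    (fun r a x => Subtype.ext (mul_smul_comm r (a : B) x))

/-- Multiplication of elements of `B_n` by elements of `B_0` on the right. -/
noncomputable def gradeRact (n : ℕ) : 𝒜 n →ₗ[K] 𝒜 0 →ₗ[K] 𝒜 n :=
  LinearMap.mk₂ K (fun x a => ⟨(x : B) * a, by
      have := SetLike.mul_mem_graded x.2 a.2; rwa [add_zero] at this⟩)
    (fun x y a => Subtype.ext (add_mul (x : B) y a))
    (fun r x a => Subtype.ext (smul_mul_assoc r (x : B) a))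
    (fun x a b => Subtype.ext (mul_add (x : B) a b))
    (fun r x a => Subtype.ext (mul_smul_comm r (x : B) a))

theorem coe_gradeLact (n : ℕ) (a : 𝒜 0) (x : 𝒜 n) : (gradeLact 𝒜 n a x : B) = a * x := rfl

theorem coe_gradeRact (n : ℕ) (x : 𝒜 n) (a : 𝒜 0) : (gradeRact 𝒜 n x a : B) = x * a := rfl

theorem gradeProj_mul_left (n : ℕ) (a : 𝒜 0) (b : B) :
    gradeProj 𝒜 n (a * b) = gradeLact 𝒜 n a (gradeProj 𝒜 n b) := by
  induction b using DirectSum.Decomposition.inductionOn 𝒜 with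
  | zero => rw [mul_zero, map_zero, map_zero]
  | add x y hx hy => rw [mul_add, map_add, map_add, map_add, hx, hy]
  | @homogeneous i x =>
    rw [← coe_gradeLact]
    by_cases h : n = i
    · subst h
      rw [gradeProj_coe, gradeProj_coe]
    · rw [gradeProj_coe_ne 𝒜 h, gradeProj_coe_ne 𝒜 h, map_zero]

theorem gradeProj_mul_right (n : ℕ) (b : B) (a : 𝒜 0) :
    gradeProj 𝒜 n (b * a) = gradeRact 𝒜 n (gradeProj 𝒜 n b) a := by
  induction b using DirectSum.Decomposition.inductionOn 𝒜 with
  | zero => rw [zero_mul, map_zero, map_zero, LinearMap.zero_apply]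
  | add x y hx hy => rw [add_mul, map_add, map_add, map_add, LinearMap.add_apply, hx, hy]
  | @homogeneous i x =>
    rw [← coe_gradeRact]
    by_cases h : n = i
    · subst h
      rw [gradeProj_coe, gradeProj_coe]
    · rw [gradeProj_coe_ne 𝒜 h, gradeProj_coe_ne 𝒜 h, map_zero, LinearMap.zero_apply]

variable [GradedHopfAlgebra 𝒜]

theorem gradeComul_coe_ne (i j n : ℕ) (h : i + j ≠ n) (x : 𝒜 n) :
    gradeComul 𝒜 i j (x : B) = 0 := by
  have h1 : (⨆ p ∈ Finset.HasAntidiagonal.antidiagonal n,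
      LinearMap.range (TensorProduct.map (𝒜 p.1).subtype (𝒜 p.2).subtype)) ≤
      LinearMap.ker (TensorProduct.map (gradeProj 𝒜 i) (gradeProj 𝒜 j)) := by
    refine iSup₂_le fun p hp => ?_
    rw [Finset.HasAntidiagonal.mem_antidiagonal] at hp
    rintro _ ⟨v, rfl⟩
    rw [LinearMap.mem_ker]
    induction v with
    | zero => rw [LinearMap.map_zero, LinearMap.map_zero]
    | add a b ha hb => rw [LinearMap.map_add, LinearMap.map_add, ha, hb, add_zero]
    | tmul a b =>
      rw [TensorProduct.map_tmul, TensorProduct.map_tmul, Submodule.subtype_apply,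
        Submodule.subtype_apply]
      by_cases hi : i = p.1
      · rw [gradeProj_coe_ne 𝒜 (by omega : j ≠ p.2), TensorProduct.tmul_zero]
      · rw [gradeProj_coe_ne 𝒜 hi, TensorProduct.zero_tmul]
  exact h1 (GradedHopfAlgebra.comul_mem n _ x.2)

theorem gradeComul_proj (i j n : ℕ) (h : i + j = n) (b : B) :
    gradeComul 𝒜 i j (gradeProj 𝒜 n b : B) = gradeComul 𝒜 i j b := by
  induction b using DirectSum.Decomposition.inductionOn 𝒜 with
  | zero => rw [map_zero, Submodule.coe_zero]
  | add x y hx hy => rw [map_add, Submodule.coe_add, map_add, map_add, hx, hy]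
  | @homogeneous m x =>
    by_cases hm : n = m
    · subst hm
      rw [gradeProj_coe]
    · rw [gradeProj_coe_ne 𝒜 hm, gradeComul_coe_ne 𝒜 i j m (by omega), Submodule.coe_zero,
        map_zero]

theorem gradeCounit_proj (b : B) : counit (R := K) (gradeProj 𝒜 0 b : B) = counit (R := K) b := by
  induction b using DirectSum.Decomposition.inductionOn 𝒜 with
  | zero => rw [map_zero, Submodule.coe_zero]
  | add x y hx hy => rw [map_add, Submodule.coe_add, map_add, map_add, hx, hy]
  | @homogeneous m x =>
    by_cases hm : 0 = m
    · subst hm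
      rw [gradeProj_coe]
    · rw [gradeProj_coe_ne 𝒜 hm, Submodule.coe_zero, map_zero,
        GradedHopfAlgebra.counit_eq_zero m (by omega) _ x.2]

theorem gradeComul_coassoc (i j k m n : ℕ) (hm : i + j = m) (hn : j + k = n) (b : B) :
    TensorProduct.assoc K (𝒜 i) (𝒜 j) (𝒜 k)
      ((gradeComul 𝒜 i j ∘ₗ (𝒜 m).subtype).rTensor (𝒜 k) (gradeComul 𝒜 m k b)) =
    (gradeComul 𝒜 j k ∘ₗ (𝒜 n).subtype).lTensor (𝒜 i) (gradeComul 𝒜 i n b) := by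
  have h1 : ∀ v : B ⊗[K] B, (gradeComul 𝒜 i j ∘ₗ (𝒜 m).subtype).rTensor (𝒜 k)
      (TensorProduct.map (gradeProj 𝒜 m) (gradeProj 𝒜 k) v) =
      TensorProduct.map (TensorProduct.map (gradeProj 𝒜 i) (gradeProj 𝒜 j)) (gradeProj 𝒜 k)
        ((comul (R := K)).rTensor B v) := by
    intro v
    induction v with
    | zero => simp only [LinearMap.map_zero]
    | add a b ha hb => simp only [LinearMap.map_add, ha, hb]
    | tmul a b =>
      have := gradeComul_proj 𝒜 i j m hm a
      exact congrArg (fun z => z ⊗ₜ[K] gradeProj 𝒜 k b) this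
  have h2 : ∀ v : B ⊗[K] B, (gradeComul 𝒜 j k ∘ₗ (𝒜 n).subtype).lTensor (𝒜 i)
      (TensorProduct.map (gradeProj 𝒜 i) (gradeProj 𝒜 n) v) =
      TensorProduct.map (gradeProj 𝒜 i) (TensorProduct.map (gradeProj 𝒜 j) (gradeProj 𝒜 k))
        ((comul (R := K)).lTensor B v) := by
    intro v
    induction v with
    | zero => simp only [LinearMap.map_zero]
    | add a b ha hb => simp only [LinearMap.map_add, ha, hb]
    | tmul a b =>
      have := gradeComul_proj 𝒜 j k n hn b
      exact congrArg (fun z => gradeProj 𝒜 i a ⊗ₜ[K] z) this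
  have h3 : ∀ v : (B ⊗[K] B) ⊗[K] B, TensorProduct.assoc K (𝒜 i) (𝒜 j) (𝒜 k)
      (TensorProduct.map (TensorProduct.map (gradeProj 𝒜 i) (gradeProj 𝒜 j)) (gradeProj 𝒜 k) v) =
      TensorProduct.map (gradeProj 𝒜 i) (TensorProduct.map (gradeProj 𝒜 j) (gradeProj 𝒜 k))
        (TensorProduct.assoc K B B B v) :=
    LinearMap.congr_fun (f := (TensorProduct.assoc K _ _ _).toLinearMap ∘ₗ
        TensorProduct.map (TensorProduct.map (gradeProj 𝒜 i) (gradeProj 𝒜 j)) (gradeProj 𝒜 k))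
      (g := TensorProduct.map (gradeProj 𝒜 i)
        (TensorProduct.map (gradeProj 𝒜 j) (gradeProj 𝒜 k)) ∘ₗ
          (TensorProduct.assoc K B B B).toLinearMap)
      (TensorProduct.ext_threefold fun _ _ _ => rfl)
  change TensorProduct.assoc K (𝒜 i) (𝒜 j) (𝒜 k)
      ((gradeComul 𝒜 i j ∘ₗ (𝒜 m).subtype).rTensor (𝒜 k)
        (TensorProduct.map (gradeProj 𝒜 m) (gradeProj 𝒜 k) (comul b))) =
    (gradeComul 𝒜 j k ∘ₗ (𝒜 n).subtype).lTensor (𝒜 i)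
      (TensorProduct.map (gradeProj 𝒜 i) (gradeProj 𝒜 n) (comul b))
  rw [h1, h2, h3, Coalgebra.coassoc_apply]

theorem gradeComul_counit_left (n : ℕ) (b : B) :
    (counit (R := K) (A := B) ∘ₗ (𝒜 0).subtype).rTensor (𝒜 n) (gradeComul 𝒜 0 n b) =
      1 ⊗ₜ gradeProj 𝒜 n b := by
  have h1 : ∀ v : B ⊗[K] B, (counit (R := K) (A := B) ∘ₗ (𝒜 0).subtype).rTensor (𝒜 n)
      (TensorProduct.map (gradeProj 𝒜 0) (gradeProj 𝒜 n) v) =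
      (gradeProj 𝒜 n).lTensor K ((counit (R := K)).rTensor B v) := by
    intro v
    induction v with
    | zero => simp only [LinearMap.map_zero]
    | add a b ha hb => simp only [LinearMap.map_add, ha, hb]
    | tmul a b =>
      exact congrArg (fun z => z ⊗ₜ[K] gradeProj 𝒜 n b) (gradeCounit_proj 𝒜 a)
  refine (h1 _).trans ?_
  rw [Coalgebra.rTensor_counit_comul, LinearMap.lTensor_tmul]

theorem gradeComul_counit_right (n : ℕ) (b : B) :
    (counit (R := K) (A := B) ∘ₗ (𝒜 0).subtype).lTensor (𝒜 n) (gradeComul 𝒜 n 0 b) =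
      gradeProj 𝒜 n b ⊗ₜ 1 := by
  have h1 : ∀ v : B ⊗[K] B, (counit (R := K) (A := B) ∘ₗ (𝒜 0).subtype).lTensor (𝒜 n)
      (TensorProduct.map (gradeProj 𝒜 n) (gradeProj 𝒜 0) v) =
      (gradeProj 𝒜 n).rTensor K ((counit (R := K)).lTensor B v) := by
    intro v
    induction v with
    | zero => simp only [LinearMap.map_zero]
    | add a b ha hb => simp only [LinearMap.map_add, ha, hb]
    | tmul a b =>
      exact congrArg (fun z => gradeProj 𝒜 n a ⊗ₜ[K] z) (gradeCounit_proj 𝒜 b)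
  refine (h1 _).trans ?_
  rw [Coalgebra.lTensor_counit_comul, LinearMap.rTensor_tmul]

/-- `B_0` is a subcoalgebra. -/
theorem comul_coe_zero (a : 𝒜 0) : comul (R := K) (a : B) =
    TensorProduct.map (𝒜 0).subtype (𝒜 0).subtype (gradeComul 𝒜 0 0 (a : B)) := by
  have h := GradedHopfAlgebra.comul_mem (𝒜 := 𝒜) 0 _ a.2
  rw [Finset.Nat.antidiagonal_zero, Finset.iSup_singleton] at h
  obtain ⟨v, hv⟩ := h
  change _ = TensorProduct.map (𝒜 0).subtype (𝒜 0).subtype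
    (TensorProduct.map (gradeProj 𝒜 0) (gradeProj 𝒜 0) (comul (R := K) (a : B)))
  rw [← hv]
  generalize hw : (v : 𝒜 0 ⊗[K] 𝒜 0) = w
  clear hv hw v
  induction w with
  | zero => simp only [LinearMap.map_zero]
  | add a b ha hb => simp only [LinearMap.map_add, ← ha, ← hb]
  | tmul a b =>
    simp only [TensorProduct.map_tmul, Submodule.subtype_apply, gradeProj_coe]

theorem gradeComul_mul_left (i j : ℕ) (a : 𝒜 0) (b : B) :
    gradeComul 𝒜 i j (a * b) = TensorProduct.map₂ (gradeLact 𝒜 i) (gradeLact 𝒜 j)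
      (gradeComul 𝒜 0 0 (a : B)) (gradeComul 𝒜 i j b) := by
  have h1 : ∀ (v : 𝒜 0 ⊗[K] 𝒜 0) (w : B ⊗[K] B),
      TensorProduct.map (gradeProj 𝒜 i) (gradeProj 𝒜 j)
        (TensorProduct.map (𝒜 0).subtype (𝒜 0).subtype v * w) =
      TensorProduct.map₂ (gradeLact 𝒜 i) (gradeLact 𝒜 j) v
        (TensorProduct.map (gradeProj 𝒜 i) (gradeProj 𝒜 j) w) := by
    intro v w
    induction v with
    | zero => simp only [LinearMap.map_zero, zero_mul, LinearMap.zero_apply]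
    | add a b ha hb => simp only [LinearMap.map_add, add_mul, LinearMap.add_apply, ha, hb]
    | tmul a b =>
      induction w with
      | zero => simp only [LinearMap.map_zero, mul_zero]
      | add a b ha hb => simp only [LinearMap.map_add, mul_add, ha, hb]
      | tmul c d =>
        rw [TensorProduct.map_tmul, Algebra.TensorProduct.tmul_mul_tmul, TensorProduct.map_tmul,
          Submodule.subtype_apply, Submodule.subtype_apply, gradeProj_mul_left,
          gradeProj_mul_left, TensorProduct.map_tmul, TensorProduct.map₂_apply_tmul,
          TensorProduct.map_tmul]
  change TensorProduct.map _ _ (comul (R := K) ((a : B) * b)) = _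
  rw [Bialgebra.comul_mul, comul_coe_zero, h1]
  rfl

theorem gradeComul_mul_right (i j : ℕ) (b : B) (a : 𝒜 0) :
    gradeComul 𝒜 i j (b * a) = TensorProduct.map₂ (gradeRact 𝒜 i) (gradeRact 𝒜 j)
      (gradeComul 𝒜 i j b) (gradeComul 𝒜 0 0 (a : B)) := by
  have h1 : ∀ (w : B ⊗[K] B) (v : 𝒜 0 ⊗[K] 𝒜 0),
      TensorProduct.map (gradeProj 𝒜 i) (gradeProj 𝒜 j)
        (w * TensorProduct.map (𝒜 0).subtype (𝒜 0).subtype v) =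
      TensorProduct.map₂ (gradeRact 𝒜 i) (gradeRact 𝒜 j)
        (TensorProduct.map (gradeProj 𝒜 i) (gradeProj 𝒜 j) w) v := by
    intro w v
    induction v with
    | zero => simp only [LinearMap.map_zero, mul_zero]
    | add a b ha hb => simp only [LinearMap.map_add, mul_add, ha, hb]
    | tmul a b =>
      induction w with
      | zero => simp only [LinearMap.map_zero, zero_mul, LinearMap.zero_apply]
      | add a b ha hb => simp only [LinearMap.map_add, add_mul, LinearMap.add_apply, ha, hb]
      | tmul c d =>
        rw [TensorProduct.map_tmul, Algebra.TensorProduct.tmul_mul_tmul, TensorProduct.map_tmul,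
          Submodule.subtype_apply, Submodule.subtype_apply, gradeProj_mul_right,
          gradeProj_mul_right, TensorProduct.map_tmul, TensorProduct.map₂_apply_tmul,
          TensorProduct.map_tmul]
  change TensorProduct.map _ _ (comul (R := K) (b * (a : B))) = _
  rw [Bialgebra.comul_mul, comul_coe_zero, h1]
  rfl

/-- The coalgebra structure of `B_0`. -/
noncomputable instance : Coalgebra K (𝒜 0) where
  comul := gradeComul 𝒜 0 0 ∘ₗ (𝒜 0).subtype
  counit := counit (R := K) (A := B) ∘ₗ (𝒜 0).subtype
  coassoc := LinearMap.ext fun a => gradeComul_coassoc 𝒜 0 0 0 0 0 rfl rfl (a : B)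
  rTensor_counit_comp_comul := LinearMap.ext fun a =>
    (gradeComul_counit_left 𝒜 0 (a : B)).trans (by rw [gradeProj_coe]; rfl)
  lTensor_counit_comp_comul := LinearMap.ext fun a =>
    (gradeComul_counit_right 𝒜 0 (a : B)).trans (by rw [gradeProj_coe]; rfl)

theorem grade_map_comul (a : 𝒜 0) : TensorProduct.map (𝒜 0).subtype (𝒜 0).subtype
    (comul (R := K) a) = comul (R := K) (a : B) :=
  (comul_coe_zero 𝒜 a).symm

instance : SMulCommClass K (𝒜 0) (𝒜 0) := @Algebra.to_smulCommClass K (𝒜 0) _ _ _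

instance : IsScalarTower K (𝒜 0) (𝒜 0) := @IsScalarTower.right K (𝒜 0) _ _ _

theorem gradeLact_zero : gradeLact 𝒜 0 = LinearMap.mul K (𝒜 0) :=
  LinearMap.ext₂ fun _ _ => Subtype.ext rfl

theorem gradeRact_zero : gradeRact 𝒜 0 = LinearMap.mul K (𝒜 0) :=
  LinearMap.ext₂ fun _ _ => Subtype.ext rfl

theorem grade_mul_eq_map₂ (u v : 𝒜 0 ⊗[K] 𝒜 0) :
    u * v = TensorProduct.map₂ (gradeLact 𝒜 0) (gradeLact 𝒜 0) u v := by
  rw [gradeLact_zero]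
  exact mul_eq_map₂ (A := 𝒜 0) u v

/-- The bialgebra structure of `B_0`. -/
noncomputable instance : Bialgebra K (𝒜 0) :=
  Bialgebra.mk' K (𝒜 0)
    (by
      change counit (R := K) (1 : B) = 1
      exact Bialgebra.counit_one)
    (fun {x y} => by
      change counit (R := K) ((x : B) * y) = counit (R := K) (x : B) * counit (R := K) (y : B)
      exact Bialgebra.counit_mul (x : B) y)
    (by
      have h : comul (R := K) (1 : B) = 1 := Bialgebra.comul_one
      change TensorProduct.map (gradeProj 𝒜 0) (gradeProj 𝒜 0) (comul (R := K) (1 : B)) = 1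
      rw [h, Algebra.TensorProduct.one_def, TensorProduct.map_tmul]
      have h1 : gradeProj 𝒜 0 1 = 1 := gradeProj_coe 𝒜 0 1
      rw [h1]; rfl)
    (fun {x y} => by
      change gradeComul 𝒜 0 0 ((x : B) * y) = gradeComul 𝒜 0 0 (x : B) * gradeComul 𝒜 0 0 (y : B)
      rw [gradeComul_mul_left, grade_mul_eq_map₂])

/-- The Hopf algebra structure of `B_0`. -/
noncomputable instance : HopfAlgebra K (𝒜 0) where
  antipode := LinearMap.restrict (HopfAlgebra.antipode K)
    (GradedHopfAlgebra.antipode_mem (𝒜 := 𝒜) 0)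
  mul_antipode_rTensor_comul := LinearMap.ext fun a => Subtype.ext (by
    refine Eq.trans ?_ (HopfAlgebra.mul_antipode_rTensor_comul_apply (R := K) (a : B))
    rw [comul_coe_zero]
    change ((LinearMap.mul' K (𝒜 0) ((LinearMap.restrict (HopfAlgebra.antipode K)
      (GradedHopfAlgebra.antipode_mem (𝒜 := 𝒜) 0)).rTensor (𝒜 0)
        (gradeComul 𝒜 0 0 (a : B))) : 𝒜 0) : B) = _
    generalize gradeComul 𝒜 0 0 (a : B) = w
    induction w with
    | zero => simp only [LinearMap.map_zero, Submodule.coe_zero]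
    | add a b ha hb => simp only [LinearMap.map_add, Submodule.coe_add, ha, hb]
    | tmul a b => rfl)
  mul_antipode_lTensor_comul := LinearMap.ext fun a => Subtype.ext (by
    refine Eq.trans ?_ (HopfAlgebra.mul_antipode_lTensor_comul_apply (R := K) (a : B))
    rw [comul_coe_zero]
    change ((LinearMap.mul' K (𝒜 0) ((LinearMap.restrict (HopfAlgebra.antipode K)
      (GradedHopfAlgebra.antipode_mem (𝒜 := 𝒜) 0)).lTensor (𝒜 0)
        (gradeComul 𝒜 0 0 (a : B))) : 𝒜 0) : B) = _
    generalize gradeComul 𝒜 0 0 (a : B) = w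
    induction w with
    | zero => simp only [LinearMap.map_zero, Submodule.coe_zero]
    | add a b ha hb => simp only [LinearMap.map_add, Submodule.coe_add, ha, hb]
    | tmul a b => rfl)

/-- The couple `(B_0, B_1)` associated with a graded Hopf algebra `B`: `B_0` acts on `B_1` by
multiplication, and the coactions are the components `B_1 → B_0 ⊗ B_1` and `B_1 → B_1 ⊗ B_0` of
the comultiplication. -/
noncomputable instance : HopfBimodule K (𝒜 0) (𝒜 1) where
  lact := gradeLact 𝒜 1
  ract := gradeRact 𝒜 1
  lcoact := gradeComul 𝒜 0 1 ∘ₗ (𝒜 1).subtype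
  rcoact := gradeComul 𝒜 1 0 ∘ₗ (𝒜 1).subtype
  one_lact m := Subtype.ext (one_mul (m : B))
  mul_lact g h m := Subtype.ext (mul_assoc (g : B) h m)
  ract_one m := Subtype.ext (mul_one (m : B))
  ract_mul m g h := Subtype.ext (mul_assoc (m : B) g h).symm
  lact_ract g m h := Subtype.ext (mul_assoc (g : B) m h)
  lcoact_coassoc m := gradeComul_coassoc 𝒜 0 0 1 0 1 rfl rfl (m : B)
  lcoact_counit m := by
    refine (congrArg (TensorProduct.lid K (𝒜 1))
      (gradeComul_counit_left 𝒜 1 (m : B))).trans ?_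
    rw [gradeProj_coe, TensorProduct.lid_tmul, one_smul]
  rcoact_coassoc m := gradeComul_coassoc 𝒜 1 0 0 1 0 rfl rfl (m : B)
  rcoact_counit m := by
    refine (congrArg (TensorProduct.rid K (𝒜 1))
      (gradeComul_counit_right 𝒜 1 (m : B))).trans ?_
    rw [gradeProj_coe, TensorProduct.rid_tmul, one_smul]
  lcoact_rcoact m := gradeComul_coassoc 𝒜 0 1 0 1 1 rfl rfl (m : B)
  lcoact_act g m h := by
    refine (gradeComul_mul_right 𝒜 0 1 ((g : B) * m) h).trans ?_
    rw [gradeComul_mul_left, gradeRact_zero, gradeLact_zero]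
    rfl
  rcoact_act g m h := by
    refine (gradeComul_mul_right 𝒜 1 0 ((g : B) * m) h).trans ?_
    rw [gradeComul_mul_left, gradeRact_zero, gradeLact_zero]
    rfl

/-- The associated couple is characterized by `Δ(m) = ρ_l(m) + ρ_r(m)` for `m ∈ B_1`. -/
theorem comul_coe_one (m : 𝒜 1) : comul (R := K) (m : B) =
    TensorProduct.map (𝒜 0).subtype (𝒜 1).subtype
      (HopfBimodule.lcoact (K := K) (H := 𝒜 0) m) +
    TensorProduct.map (𝒜 1).subtype (𝒜 0).subtype
      (HopfBimodule.rcoact (K := K) (H := 𝒜 0) m) := by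
  have key : ∀ w ∈ (⨆ p ∈ Finset.HasAntidiagonal.antidiagonal 1,
      LinearMap.range (TensorProduct.map (𝒜 p.1).subtype (𝒜 p.2).subtype)),
      w = TensorProduct.map (𝒜 0).subtype (𝒜 1).subtype
        (TensorProduct.map (gradeProj 𝒜 0) (gradeProj 𝒜 1) w) +
      TensorProduct.map (𝒜 1).subtype (𝒜 0).subtype
        (TensorProduct.map (gradeProj 𝒜 1) (gradeProj 𝒜 0) w) := by
    have h1 : (⨆ p ∈ Finset.HasAntidiagonal.antidiagonal 1,
      LinearMap.range (TensorProduct.map (𝒜 p.1).subtype (𝒜 p.2).subtype)) ≤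
        LinearMap.eqLocus LinearMap.id
        (TensorProduct.map (𝒜 0).subtype (𝒜 1).subtype ∘ₗ
          TensorProduct.map (gradeProj 𝒜 0) (gradeProj 𝒜 1) +
        TensorProduct.map (𝒜 1).subtype (𝒜 0).subtype ∘ₗ
          TensorProduct.map (gradeProj 𝒜 1) (gradeProj 𝒜 0)) := by
      refine iSup₂_le fun p hp => ?_
      rintro _ ⟨v, rfl⟩
      rw [LinearMap.mem_eqLocus]
      induction v with
      | zero => simp only [LinearMap.map_zero]
      | add a b ha hb => rw [LinearMap.map_add, LinearMap.map_add, LinearMap.map_add, ha, hb]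
      | tmul a b =>
        rw [Finset.HasAntidiagonal.mem_antidiagonal] at hp
        obtain ⟨i, j⟩ := p
        obtain ⟨rfl, rfl⟩ | ⟨rfl, rfl⟩ : (i = 0 ∧ j = 1) ∨ (i = 1 ∧ j = 0) := by
          simp only at hp; omega
        · simp only [LinearMap.add_apply, LinearMap.comp_apply, TensorProduct.map_tmul,
            Submodule.subtype_apply, LinearMap.id_apply, gradeProj_coe,
            gradeProj_coe_ne 𝒜 (by decide : (1 : ℕ) ≠ 0), TensorProduct.zero_tmul,
            LinearMap.map_zero, add_zero]
        · simp only [LinearMap.add_apply, LinearMap.comp_apply, TensorProduct.map_tmul,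
            Submodule.subtype_apply, LinearMap.id_apply, gradeProj_coe,
            gradeProj_coe_ne 𝒜 (by decide : (0 : ℕ) ≠ 1), TensorProduct.zero_tmul,
            LinearMap.map_zero, zero_add]
    exact fun w hw => h1 hw
  exact key _ (GradedHopfAlgebra.comul_mem 1 _ m.2)

end Couple

/-- The wedge `V ∧_C W = Δ⁻¹(V ⊗ C + C ⊗ W)` of two subspaces of a coalgebra `C`. -/
noncomputable def wedge {K C : Type*} [Field K] [AddCommGroup C] [Module K C] [Coalgebra K C]
    (V W : Submodule K C) : Submodule K C :=
  Submodule.comap (comul (R := K))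
    (LinearMap.range (V.subtype.rTensor C) ⊔ LinearMap.range (W.subtype.lTensor C))

/-- The subspace `M^{□ n}` of degree `n` of `Cot_H(M)`. -/
noncomputable def cotGrade (K : Type w) (H M : Type u) [Field K] [Ring H] [HopfAlgebra K H]
    [AddCommGroup M] [Module K M] [HopfBimodule K H M] (n : ℕ) : Submodule K (Cot K H M) :=
  LinearMap.range (cotOf K H M n)

/-- A bialgebra map between Hopf algebras with given homogeneous subspaces is a morphism of graded
Hopf algebras when it commutes with the antipodes and preserves the degrees. -/
structure IsGradedHopfHom {K B C : Type*} [Field K] [Ring B] [HopfAlgebra K B] [Ring C]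
    [HopfAlgebra K C] (𝒜 : ℕ → Submodule K B) (𝒞 : ℕ → Submodule K C) (f : B →ₐc[K] C) : Prop where
  map_antipode : ∀ b, f (HopfAlgebra.antipode K b) = HopfAlgebra.antipode K (f b)
  map_mem : ∀ n, ∀ b ∈ 𝒜 n, f b ∈ 𝒞 n

end CotHopf

/-!
The projections `B → B_0` and `B → B_1` are a coalgebra map and a bicomodule map over it
(`gradeProj_bicomodulePair`), so by the universal property of the cotensor coalgebra they are the
components of degrees `0` and `1` of a coalgebra map `B → Cot_{B_0}(B_1)`. Its component of degree
`k ≥ 1` is an iterated comultiplication followed by projections onto `B_1`; as `Δ` is graded, it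
vanishes on `B_n` for `n ≠ k` (`coupleComponent_coe_ne`), which gives the finiteness that the
universal property asks for and shows that the map preserves degrees. A coalgebra map to
`Cot_{B_0}(B_1)` is determined by its components of degrees `0` and `1`: applied to maps on `B ⊗ B`
this gives multiplicativity (`coupleCoalgHom_mul`), applied to maps on `B` it gives uniqueness
(`coalgHom_eq_coupleCoalgHom`). A bialgebra map commutes with the antipodes
(`bialgHom_map_antipode`).

If the map is injective and `Δ(b) ∈ B_0 ⊗ B + B ⊗ B_0`, the component of the image of `b` in degree
`k + 2` vanishes: it is obtained from `Δ(b)` by applying to the two factors the component of degree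
`k + 1` and the projection onto `B_1`, which both kill `B_0`. Hence `b` and the sum of its components
in `B_0` and `B_1` have the same image. Conversely, let `B_0 ∧ B_0 = B_0 ⊕ B_1`, and let `x ∈ B_n`,
`n ≥ 2`, be in the kernel. By induction the map is injective on `B_i` for `i < n`, hence so is its
tensor product with itself on `B_i ⊗ B_j` for `i, j < n`, and the components of `Δ(x)` in the
latter spaces vanish. So `x ∈ B_0 ∧ B_0 = B_0 ⊕ B_1`, which meets `B_n` in `0`.
-/

namespace CotHopf

/-! ### Bialgebra maps and antipodes -/

section Antipode

open WithConv

/-- The maps `f ∘ S` and `S ∘ f` are a left and a right inverse of `f` for the convolution product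
of linear maps `B → C`. -/
theorem bialgHom_map_antipode {K B C : Type*} [Field K] [Ring B] [HopfAlgebra K B] [Ring C]
    [HopfAlgebra K C] (f : B →ₐc[K] C) (b : B) :
    f (HopfAlgebra.antipode K b) = HopfAlgebra.antipode K (f b) := by
  let g : B →ₐ[K] C := (f : B →ₐ[K] C)
  let c : B →ₗc[K] C := f.toCoalgHom
  have hl : toConv (g.toLinearMap ∘ₗ HopfAlgebra.antipode K) * toConv g.toLinearMap = 1 := by
    have h := LinearMap.algHom_comp_convMul_distrib g (toConv (HopfAlgebra.antipode K (A := B)))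
      (toConv LinearMap.id)
    rw [LinearMap.antipode_mul_id] at h
    refine (congrArg toConv h).symm.trans (WithConv.ext (LinearMap.ext fun x => ?_))
    exact AlgHom.commutes g (counit (R := K) x)
  have hr : toConv c.toLinearMap * toConv (HopfAlgebra.antipode K ∘ₗ c.toLinearMap) = 1 := by
    have h := LinearMap.convMul_comp_coalgHom_distrib (toConv LinearMap.id)
      (toConv (HopfAlgebra.antipode K (A := C))) c
    rw [LinearMap.id_mul_antipode] at h
    refine (congrArg toConv h).symm.trans (WithConv.ext (LinearMap.ext fun x => ?_))
    exact congrArg (algebraMap K C) (CoalgHomClass.counit_comp_apply c x)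
  exact LinearMap.congr_fun (congrArg ofConv (left_inv_eq_right_inv hl hr)) b

end Antipode

/-! ### Homogeneous components of products and coproducts -/

section Grading

variable {K B : Type*} [Field K] [Ring B] [HopfAlgebra K B]
  (𝒜 : ℕ → Submodule K B) [GradedAlgebra 𝒜]

theorem gradeProj_mul_coe_ne {k m n : ℕ} (h : k ≠ m + n) (x : 𝒜 m) (y : 𝒜 n) :
    gradeProj 𝒜 k ((x : B) * y) = 0 :=
  gradeProj_coe_ne 𝒜 h ⟨(x : B) * y, SetLike.mul_mem_graded x.2 y.2⟩

theorem gradeProj_zero_mul (x y : B) :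
    gradeProj 𝒜 0 (x * y) = gradeProj 𝒜 0 x * gradeProj 𝒜 0 y := by
  induction x using DirectSum.Decomposition.inductionOn 𝒜 with
  | zero => rw [zero_mul, map_zero, zero_mul]
  | add a b ha hb => rw [add_mul, map_add, map_add, ha, hb, add_mul]
  | @homogeneous m x =>
    rcases Nat.eq_zero_or_pos m with rfl | hm
    · rw [gradeProj_mul_left, gradeProj_coe]
      exact Subtype.ext rfl
    · rw [gradeProj_coe_ne 𝒜 hm.ne, zero_mul]
      induction y using DirectSum.Decomposition.inductionOn 𝒜 with
      | zero => rw [mul_zero, map_zero]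
      | add a b ha hb => rw [mul_add, map_add, ha, hb, add_zero]
      | @homogeneous n y => exact gradeProj_mul_coe_ne 𝒜 (by omega) x y

theorem gradeProj_one_mul (x y : B) :
    gradeProj 𝒜 1 (x * y) = gradeLact 𝒜 1 (gradeProj 𝒜 0 x) (gradeProj 𝒜 1 y) +
      gradeRact 𝒜 1 (gradeProj 𝒜 1 x) (gradeProj 𝒜 0 y) := by
  induction x using DirectSum.Decomposition.inductionOn 𝒜 with
  | zero => simp only [zero_mul, map_zero, LinearMap.zero_apply, add_zero]
  | add a b ha hb => simp only [add_mul, map_add, LinearMap.add_apply, ha, hb]; abel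
  | @homogeneous m x =>
    rcases Nat.eq_zero_or_pos m with rfl | hm
    · rw [gradeProj_mul_left, gradeProj_coe, gradeProj_coe_ne 𝒜 one_ne_zero, map_zero,
        LinearMap.zero_apply, add_zero]
    · rw [gradeProj_coe_ne 𝒜 hm.ne, map_zero, LinearMap.zero_apply, zero_add]
      induction y using DirectSum.Decomposition.inductionOn 𝒜 with
      | zero => simp only [mul_zero, map_zero]
      | add a b ha hb => simp only [mul_add, map_add, ha, hb]
      | @homogeneous n y =>
        rcases Nat.eq_zero_or_pos n with rfl | hn
        · rw [gradeProj_mul_right, gradeProj_coe]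
        · rw [gradeProj_mul_coe_ne 𝒜 (by omega) x y, gradeProj_coe_ne 𝒜 hn.ne, map_zero]

variable {X Y : Type*} [AddCommGroup X] [Module K X] [AddCommGroup Y] [Module K Y]

theorem comp_gradeProj_of_forall_ne {f : B →ₗ[K] X} {i : ℕ}
    (hf : ∀ n, i ≠ n → ∀ x : 𝒜 n, f x = 0) : f = (f ∘ₗ (𝒜 i).subtype) ∘ₗ gradeProj 𝒜 i := by
  refine graded_hom_ext 𝒜 fun n x => ?_
  by_cases h : i = n
  · subst h
    rw [LinearMap.comp_apply, gradeProj_coe]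
    rfl
  · rw [hf n h, LinearMap.comp_apply, gradeProj_coe_ne 𝒜 h, map_zero]

/-- A tensor product of homogeneous maps sees only one component of the comultiplication. -/
theorem map_comul_eq_map_gradeComul {f : B →ₗ[K] X} {g : B →ₗ[K] Y} {i j : ℕ}
    (hf : ∀ n, i ≠ n → ∀ x : 𝒜 n, f x = 0) (hg : ∀ n, j ≠ n → ∀ x : 𝒜 n, g x = 0) (b : B) :
    TensorProduct.map f g (comul b) =
      TensorProduct.map (f ∘ₗ (𝒜 i).subtype) (g ∘ₗ (𝒜 j).subtype) (gradeComul 𝒜 i j b) := by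
  conv_lhs => rw [comp_gradeProj_of_forall_ne 𝒜 hf, comp_gradeProj_of_forall_ne 𝒜 hg,
    TensorProduct.map_comp]
  rfl

end Grading

/-! ### The wedge of `B_0` with itself -/

section GradedComul

theorem map_comul_eq_zero_of_mem_wedge {K C X Y : Type*} [Field K] [AddCommGroup C]
    [Module K C] [Coalgebra K C] [AddCommGroup X] [Module K X] [AddCommGroup Y] [Module K Y]
    {V W : Submodule K C} {f : C →ₗ[K] X} {g : C →ₗ[K] Y}
    (hf : ∀ x : V, f x = 0) (hg : ∀ x : W, g x = 0) {c : C} (hc : c ∈ wedge V W) :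
    TensorProduct.map f g (comul c) = 0 := by
  have hle : LinearMap.range (V.subtype.rTensor C) ⊔ LinearMap.range (W.subtype.lTensor C) ≤
      LinearMap.ker (TensorProduct.map f g) := by
    refine sup_le ?_ ?_
    · rintro _ ⟨v, rfl⟩
      refine LinearMap.congr_fun (f := TensorProduct.map f g ∘ₗ V.subtype.rTensor C) (g := 0)
        (TensorProduct.ext' fun x y => ?_) v
      exact (congrArg (· ⊗ₜ[K] g y) (hf x)).trans (TensorProduct.zero_tmul _ _)
    · rintro _ ⟨v, rfl⟩
      refine LinearMap.congr_fun (f := TensorProduct.map f g ∘ₗ W.subtype.lTensor C) (g := 0)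
        (TensorProduct.ext' fun x y => ?_) v
      exact (congrArg (f x ⊗ₜ[K] ·) (hg y)).trans (TensorProduct.tmul_zero _ _)
  exact LinearMap.mem_ker.1 (hle hc)

variable {K B : Type*} [Field K] [Ring B] [HopfAlgebra K B]
  (𝒜 : ℕ → Submodule K B) [GradedAlgebra 𝒜] [GradedHopfAlgebra 𝒜]

theorem comul_coe_eq_sum (n : ℕ) (x : 𝒜 n) : comul (R := K) (x : B) =
    ∑ p ∈ Finset.HasAntidiagonal.antidiagonal n,
      TensorProduct.map (𝒜 p.1).subtype (𝒜 p.2).subtype (gradeComul 𝒜 p.1 p.2 (x : B)) := by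
  have h : (⨆ p ∈ Finset.HasAntidiagonal.antidiagonal n,
      LinearMap.range (TensorProduct.map (𝒜 p.1).subtype (𝒜 p.2).subtype)) ≤
      LinearMap.eqLocus LinearMap.id (∑ p ∈ Finset.HasAntidiagonal.antidiagonal n,
        TensorProduct.map (𝒜 p.1).subtype (𝒜 p.2).subtype ∘ₗ
          TensorProduct.map (gradeProj 𝒜 p.1) (gradeProj 𝒜 p.2)) := by
    refine iSup₂_le fun p hp => ?_
    rintro _ ⟨v, rfl⟩
    rw [LinearMap.mem_eqLocus]
    induction v with
    | zero => simp only [LinearMap.map_zero]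
    | add a b ha hb => rw [LinearMap.map_add, LinearMap.map_add, LinearMap.map_add, ha, hb]
    | tmul a b =>
      rw [LinearMap.sum_apply, Finset.sum_eq_single_of_mem p hp]
      · simp only [LinearMap.comp_apply, TensorProduct.map_tmul, Submodule.subtype_apply,
          LinearMap.id_apply, gradeProj_coe]
      · intro q hq hqp
        rw [Finset.HasAntidiagonal.mem_antidiagonal] at hp hq
        have h1 : q.1 ≠ p.1 := fun e => hqp (Prod.ext e (by omega))
        simp only [LinearMap.comp_apply, TensorProduct.map_tmul, Submodule.subtype_apply,
          gradeProj_coe_ne 𝒜 h1, TensorProduct.zero_tmul, LinearMap.map_zero]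
  have h2 := h (GradedHopfAlgebra.comul_mem n _ x.2)
  rw [LinearMap.mem_eqLocus, LinearMap.sum_apply] at h2
  exact h2

theorem mem_wedge_of_gradeComul_eq_zero (n : ℕ) (x : 𝒜 n)
    (h : ∀ i j, i + j = n → 0 < i → 0 < j → gradeComul 𝒜 i j (x : B) = 0) :
    (x : B) ∈ wedge (K := K) (𝒜 0) (𝒜 0) := by
  change comul (R := K) (x : B) ∈
    LinearMap.range ((𝒜 0).subtype.rTensor B) ⊔ LinearMap.range ((𝒜 0).subtype.lTensor B)
  rw [comul_coe_eq_sum]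
  refine Submodule.sum_mem _ fun p hp => ?_
  rw [Finset.HasAntidiagonal.mem_antidiagonal] at hp
  obtain ⟨i, j⟩ := p
  rcases Nat.eq_zero_or_pos i with rfl | hi
  · refine Submodule.mem_sup_left ⟨(𝒜 j).subtype.lTensor (𝒜 0) (gradeComul 𝒜 0 j (x : B)), ?_⟩
    rw [← LinearMap.comp_apply, LinearMap.rTensor_comp_lTensor]
  rcases Nat.eq_zero_or_pos j with rfl | hj
  · refine Submodule.mem_sup_right ⟨(𝒜 i).subtype.rTensor (𝒜 0) (gradeComul 𝒜 i 0 (x : B)), ?_⟩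
    rw [← LinearMap.comp_apply, LinearMap.lTensor_comp_rTensor]
  · rw [h i j hp hi hj, map_zero]
    exact Submodule.zero_mem _

theorem sup_le_wedge : 𝒜 0 ⊔ 𝒜 1 ≤ wedge (K := K) (𝒜 0) (𝒜 0) :=
  sup_le
    (fun b hb => mem_wedge_of_gradeComul_eq_zero 𝒜 0 ⟨b, hb⟩ fun _ _ _ _ _ => by omega)
    (fun b hb => mem_wedge_of_gradeComul_eq_zero 𝒜 1 ⟨b, hb⟩ fun _ _ _ _ _ => by omega)

end GradedComul

/-! ### The morphism to the cotensor Hopf algebra -/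

section CoupleMap

variable {K : Type w} {B : Type u} [Field K] [Ring B] [HopfAlgebra K B]
  (𝒜 : ℕ → Submodule K B) [GradedAlgebra 𝒜] [GradedHopfAlgebra 𝒜]

theorem gradeProj_bicomodulePair : BicomodulePair (gradeProj 𝒜 0) (gradeProj 𝒜 1) where
  comul_f₀ c := gradeComul_proj 𝒜 0 0 0 rfl c
  counit_f₀ c := gradeCounit_proj 𝒜 c
  lcoact_f₁ c := gradeComul_proj 𝒜 0 1 1 rfl c
  rcoact_f₁ c := gradeComul_proj 𝒜 1 0 1 rfl c

/-- The component `B → B_1^{□ k}` of the morphism to the cotensor Hopf algebra: for `k ≥ 2` it is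
the iterated comultiplication `B → B^{⊗ k}` followed by the projection onto `B_1` in each factor. -/
noncomputable def coupleComponent (k : ℕ) : B →ₗ[K] CotPow K (𝒜 0) (𝒜 1) k :=
  (gradeProj_bicomodulePair 𝒜).component k

theorem incl_coupleComponent (k : ℕ) (b : B) :
    incl K (𝒜 0) (𝒜 1) k (coupleComponent 𝒜 (k + 2) b) =
      TensorProduct.map (coupleComponent 𝒜 (k + 1)) (gradeProj 𝒜 1) (comul b) :=
  (gradeProj_bicomodulePair 𝒜).incl_component k b

theorem coupleComponent_coe_ne {k n : ℕ} (h : k ≠ n) (x : 𝒜 n) :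
    coupleComponent 𝒜 k (x : B) = 0 := by
  induction k generalizing n with
  | zero => exact ((gradeProj_bicomodulePair 𝒜).component_zero _).trans (gradeProj_coe_ne 𝒜 h x)
  | succ k ih =>
    cases k with
    | zero => exact ((gradeProj_bicomodulePair 𝒜).component_one _).trans (gradeProj_coe_ne 𝒜 h x)
    | succ k =>
      apply incl_injective K (𝒜 0) (𝒜 1) k
      rw [incl_coupleComponent, map_comul_eq_map_gradeComul 𝒜 (i := k + 1) (j := 1)
        (fun n hn x => ih hn x) (fun n hn x => gradeProj_coe_ne 𝒜 hn x),
        gradeComul_coe_ne 𝒜 _ _ n h, map_zero, map_zero]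

theorem coupleComponent_finite (b : B) : ∃ N : ℕ, ∀ k, N < k → coupleComponent 𝒜 k b = 0 := by
  induction b using DirectSum.Decomposition.inductionOn 𝒜 with
  | zero => exact ⟨0, fun k _ => map_zero _⟩
  | add a b ha hb =>
    obtain ⟨N, hN⟩ := ha
    obtain ⟨N', hN'⟩ := hb
    exact ⟨max N N', fun k hk => by rw [map_add, hN k (by omega), hN' k (by omega), add_zero]⟩
  | @homogeneous n x => exact ⟨n, fun k hk => coupleComponent_coe_ne 𝒜 hk.ne' x⟩

/-- The coalgebra map `B → Cot_{B_0}(B_1)` whose components in degrees `0` and `1` are the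
projections onto `B_0` and `B_1`. -/
noncomputable def coupleCoalgHom : B →ₗc[K] Cot K (𝒜 0) (𝒜 1) :=
  (gradeProj_bicomodulePair 𝒜).lift (coupleComponent_finite 𝒜)

theorem cotComp_coupleCoalgHom (k : ℕ) (b : B) :
    cotComp K (𝒜 0) (𝒜 1) k (coupleCoalgHom 𝒜 b) = coupleComponent 𝒜 k b :=
  (gradeProj_bicomodulePair 𝒜).cotComp_lift _ k b

theorem compH_coupleCoalgHom (b : B) :
    compH K (𝒜 0) (𝒜 1) (coupleCoalgHom 𝒜 b) = gradeProj 𝒜 0 b :=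
  (gradeProj_bicomodulePair 𝒜).compH_lift _ b

theorem compM_coupleCoalgHom (b : B) :
    compM K (𝒜 0) (𝒜 1) (coupleCoalgHom 𝒜 b) = gradeProj 𝒜 1 b :=
  (gradeProj_bicomodulePair 𝒜).compM_lift _ b

theorem coupleCoalgHom_coe (n : ℕ) (x : 𝒜 n) :
    coupleCoalgHom 𝒜 (x : B) = cotOf K (𝒜 0) (𝒜 1) n (coupleComponent 𝒜 n (x : B)) := by
  refine cot_ext fun k => ?_
  rw [cotComp_coupleCoalgHom]
  by_cases h : k = n
  · subst h
    rw [cotComp_cotOf]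
  · rw [cotComp_cotOf_ne h, coupleComponent_coe_ne 𝒜 h]

theorem coupleCoalgHom_coe_zero (x : 𝒜 0) :
    coupleCoalgHom 𝒜 (x : B) = ofH K (𝒜 0) (𝒜 1) x :=
  (coupleCoalgHom_coe 𝒜 0 x).trans (congrArg (ofH K (𝒜 0) (𝒜 1))
    (((gradeProj_bicomodulePair 𝒜).component_zero _).trans (gradeProj_coe 𝒜 0 x)))

theorem coupleCoalgHom_coe_one (x : 𝒜 1) :
    coupleCoalgHom 𝒜 (x : B) = ofM K (𝒜 0) (𝒜 1) x :=
  (coupleCoalgHom_coe 𝒜 1 x).trans (congrArg (ofM K (𝒜 0) (𝒜 1))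
    (((gradeProj_bicomodulePair 𝒜).component_one _).trans (gradeProj_coe 𝒜 1 x)))

/-- Both sides are coalgebra maps `B ⊗ B → Cot_{B_0}(B_1)` with the same components in degrees `0`
and `1`. -/
theorem coupleCoalgHom_mul (x y : B) :
    coupleCoalgHom 𝒜 (x * y) = coupleCoalgHom 𝒜 x * coupleCoalgHom 𝒜 y := by
  have key : (coupleCoalgHom 𝒜).comp (Bialgebra.mulCoalgHom K B) =
      (cotMul K (𝒜 0) (𝒜 1)).comp
        (Coalgebra.TensorProduct.map (coupleCoalgHom 𝒜) (coupleCoalgHom 𝒜)) := by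
    apply cot_coalgHom_ext
    · refine LinearMap.congr_fun (f := compH K (𝒜 0) (𝒜 1) ∘ₗ CoalgHom.toLinearMap _)
        (g := compH K (𝒜 0) (𝒜 1) ∘ₗ CoalgHom.toLinearMap _) (TensorProduct.ext' fun x y => ?_)
      refine (compH_coupleCoalgHom 𝒜 (x * y)).trans
        (Eq.trans ?_ (compH_cotMul (coupleCoalgHom 𝒜 x) (coupleCoalgHom 𝒜 y)).symm)
      rw [compH_coupleCoalgHom, compH_coupleCoalgHom, gradeProj_zero_mul]
    · refine LinearMap.congr_fun (f := compM K (𝒜 0) (𝒜 1) ∘ₗ CoalgHom.toLinearMap _)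
        (g := compM K (𝒜 0) (𝒜 1) ∘ₗ CoalgHom.toLinearMap _) (TensorProduct.ext' fun x y => ?_)
      refine (compM_coupleCoalgHom 𝒜 (x * y)).trans
        (Eq.trans ?_ (compM_cotMul (coupleCoalgHom 𝒜 x) (coupleCoalgHom 𝒜 y)).symm)
      rw [compH_coupleCoalgHom, compH_coupleCoalgHom, compM_coupleCoalgHom, compM_coupleCoalgHom,
        gradeProj_one_mul]
      rfl
  exact DFunLike.congr_fun key (x ⊗ₜ y)

/-- The morphism `B → Cot_{B_0}(B_1)` as a bialgebra map. -/
noncomputable def coupleHom : B →ₐc[K] Cot K (𝒜 0) (𝒜 1) where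
  toCoalgHom := coupleCoalgHom 𝒜
  map_one' := coupleCoalgHom_coe_zero 𝒜 1
  map_mul' := coupleCoalgHom_mul 𝒜

/-! ### Injectivity -/

theorem coupleComponent_injective_of_wedge_eq
    (hw : wedge (K := K) (𝒜 0) (𝒜 0) = 𝒜 0 ⊔ 𝒜 1) (n : ℕ) :
    Function.Injective (coupleComponent 𝒜 n ∘ₗ (𝒜 n).subtype) := by
  induction n using Nat.strong_induction_on with
  | _ n ih =>
    rw [injective_iff_map_eq_zero]
    intro x hx
    rw [LinearMap.comp_apply, Submodule.subtype_apply] at hx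
    have hz : coupleCoalgHom 𝒜 (x : B) = 0 := by rw [coupleCoalgHom_coe, hx, map_zero]
    have hmem : (x : B) ∈ 𝒜 0 ⊔ 𝒜 1 := by
      rw [← hw]
      refine mem_wedge_of_gradeComul_eq_zero 𝒜 n x fun i j hij hi hj => ?_
      -- Over a field the tensor product of the injective components in degrees `i, j < n` is
      -- injective.
      apply TensorProduct.map_injective_of_flat_flat _ _ (ih i (by omega)) (ih j (by omega))
      rw [← map_comul_eq_map_gradeComul 𝒜 (fun n hn x => coupleComponent_coe_ne 𝒜 hn x)
        (fun n hn x => coupleComponent_coe_ne 𝒜 hn x), map_zero]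
      have hc : ∀ k, coupleComponent 𝒜 k =
          cotComp K (𝒜 0) (𝒜 1) k ∘ₗ (coupleCoalgHom 𝒜).toLinearMap :=
        fun k => LinearMap.ext fun b => (cotComp_coupleCoalgHom 𝒜 k b).symm
      have hd : TensorProduct.map (coupleCoalgHom 𝒜).toLinearMap (coupleCoalgHom 𝒜).toLinearMap
          (comul (x : B)) = comul (coupleCoalgHom 𝒜 (x : B)) :=
        LinearMap.congr_fun (coupleCoalgHom 𝒜).map_comp_comul (x : B)
      rw [hc, hc, TensorProduct.map_comp, LinearMap.comp_apply, hd, hz, map_zero, map_zero]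
    obtain ⟨a, ha, b, hb, hab⟩ := Submodule.mem_sup.1 hmem
    match n, x, hz, hab with
    | 0, x, hz, _ =>
      rw [coupleCoalgHom_coe_zero] at hz
      rw [← compH_ofH (K := K) (M := 𝒜 1) x, hz, map_zero]
    | 1, x, hz, _ =>
      rw [coupleCoalgHom_coe_one] at hz
      rw [← compM_ofM (K := K) (H := 𝒜 0) x, hz, map_zero]
    | n + 2, x, _, hab =>
      rw [← gradeProj_coe 𝒜 (n + 2) x, ← hab, map_add,
        gradeProj_coe_ne 𝒜 (by omega) (⟨a, ha⟩ : 𝒜 0),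
        gradeProj_coe_ne 𝒜 (by omega) (⟨b, hb⟩ : 𝒜 1), add_zero]

theorem coupleCoalgHom_injective_of_wedge_eq
    (hw : wedge (K := K) (𝒜 0) (𝒜 0) = 𝒜 0 ⊔ 𝒜 1) : Function.Injective (coupleCoalgHom 𝒜) := by
  rw [injective_iff_map_eq_zero]
  intro b hb
  have h : ∀ n, gradeProj 𝒜 n b = 0 := by
    intro n
    apply coupleComponent_injective_of_wedge_eq 𝒜 hw n
    have h1 := comp_gradeProj_of_forall_ne 𝒜 (fun m hm x => coupleComponent_coe_ne 𝒜 (k := n) hm x)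
    rw [map_zero, ← LinearMap.comp_apply, ← h1, ← cotComp_coupleCoalgHom, hb, map_zero]
  apply (DirectSum.decomposeLinearEquiv 𝒜).injective
  rw [map_zero]
  exact DirectSum.ext_component K fun n => (h n).trans (map_zero _).symm

/-- For `b` in the wedge every component of degree at least `2` of the image of `b` vanishes, so
that `b` has the same image as the sum of its components in degrees `0` and `1`. -/
theorem wedge_eq_of_coupleCoalgHom_injective (hi : Function.Injective (coupleCoalgHom 𝒜)) :
    wedge (K := K) (𝒜 0) (𝒜 0) = 𝒜 0 ⊔ 𝒜 1 := by
  refine le_antisymm (fun b hb => ?_) (sup_le_wedge 𝒜)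
  have h : b = (gradeProj 𝒜 0 b : B) + (gradeProj 𝒜 1 b : B) := by
    apply hi
    rw [map_add, coupleCoalgHom_coe_zero, coupleCoalgHom_coe_one]
    refine cot_ext fun k => ?_
    rw [map_add]
    match k with
    | 0 =>
      rw [cotComp_ofM (by omega), add_zero]
      exact (compH_coupleCoalgHom 𝒜 b).trans (compH_ofH _).symm
    | 1 =>
      rw [cotComp_ofH (by omega), zero_add]
      exact (compM_coupleCoalgHom 𝒜 b).trans (compM_ofM _).symm
    | k + 2 =>
      rw [cotComp_ofH (by omega), cotComp_ofM (by omega), add_zero, cotComp_coupleCoalgHom]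
      apply incl_injective K (𝒜 0) (𝒜 1) k
      rw [incl_coupleComponent, map_zero]
      exact map_comul_eq_zero_of_mem_wedge (fun x => coupleComponent_coe_ne 𝒜 (by omega) x)
        (fun x => gradeProj_coe_ne 𝒜 (by omega) x) hb
  rw [h]
  exact Submodule.add_mem_sup (gradeProj 𝒜 0 b).2 (gradeProj 𝒜 1 b).2

/-- A graded coalgebra map that is the identity on `B_0 ⊕ B_1` has the projections onto `B_0` and
`B_1` as its components in degrees `0` and `1`, and these determine it. -/
theorem coalgHom_eq_coupleCoalgHom (j : B →ₗc[K] Cot K (𝒜 0) (𝒜 1))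
    (hj : ∀ n, ∀ b ∈ 𝒜 n, j b ∈ cotGrade K (𝒜 0) (𝒜 1) n)
    (h0 : ∀ b : 𝒜 0, j (b : B) = ofH K (𝒜 0) (𝒜 1) b)
    (h1 : ∀ b : 𝒜 1, j (b : B) = ofM K (𝒜 0) (𝒜 1) b) : j = coupleCoalgHom 𝒜 := by
  have hne : ∀ k n, k ≠ n → ∀ x : 𝒜 n, cotComp K (𝒜 0) (𝒜 1) k (j (x : B)) = 0 := by
    intro k n hkn x
    obtain ⟨y, hy⟩ := hj n x x.2
    rw [← hy, cotComp_cotOf_ne hkn]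
  apply cot_coalgHom_ext
  · refine LinearMap.congr_fun (f := compH K (𝒜 0) (𝒜 1) ∘ₗ j.toLinearMap)
      (g := compH K (𝒜 0) (𝒜 1) ∘ₗ (coupleCoalgHom 𝒜).toLinearMap)
      (graded_hom_ext 𝒜 fun n x => ?_)
    change compH K (𝒜 0) (𝒜 1) (j (x : B)) = compH K (𝒜 0) (𝒜 1) (coupleCoalgHom 𝒜 (x : B))
    rw [compH_coupleCoalgHom]
    by_cases hn : 0 = n
    · subst hn
      rw [h0, compH_ofH, gradeProj_coe]
    · exact (hne 0 n hn x).trans (gradeProj_coe_ne 𝒜 hn x).symm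
  · refine LinearMap.congr_fun (f := compM K (𝒜 0) (𝒜 1) ∘ₗ j.toLinearMap)
      (g := compM K (𝒜 0) (𝒜 1) ∘ₗ (coupleCoalgHom 𝒜).toLinearMap)
      (graded_hom_ext 𝒜 fun n x => ?_)
    change compM K (𝒜 0) (𝒜 1) (j (x : B)) = compM K (𝒜 0) (𝒜 1) (coupleCoalgHom 𝒜 (x : B))
    rw [compM_coupleCoalgHom]
    by_cases hn : 1 = n
    · subst hn
      rw [h1, compM_ofM, gradeProj_coe]
    · exact (hne 1 n hn x).trans (gradeProj_coe_ne 𝒜 hn x).symm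

end CoupleMap

end CotHopf

theorem proposition2p3 {K : Type w} {B : Type u} [Field K] [Ring B] [HopfAlgebra K B]
    (𝒜 : ℕ → Submodule K B) [GradedAlgebra 𝒜] [CotHopf.GradedHopfAlgebra 𝒜] :
    ∃ i : B →ₐc[K] CotHopf.Cot K (𝒜 0) (𝒜 1),
      (CotHopf.IsGradedHopfHom 𝒜 (CotHopf.cotGrade K (𝒜 0) (𝒜 1)) i ∧
        (∀ b : 𝒜 0, i (b : B) = CotHopf.ofH K (𝒜 0) (𝒜 1) b) ∧
        ∀ b : 𝒜 1, i (b : B) = CotHopf.ofM K (𝒜 0) (𝒜 1) b) ∧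
      (∀ j : B →ₐc[K] CotHopf.Cot K (𝒜 0) (𝒜 1),
        CotHopf.IsGradedHopfHom 𝒜 (CotHopf.cotGrade K (𝒜 0) (𝒜 1)) j →
        (∀ b : 𝒜 0, j (b : B) = CotHopf.ofH K (𝒜 0) (𝒜 1) b) →
        (∀ b : 𝒜 1, j (b : B) = CotHopf.ofM K (𝒜 0) (𝒜 1) b) → j = i) ∧
      (Function.Injective i ↔ CotHopf.wedge (K := K) (𝒜 0) (𝒜 0) = 𝒜 0 ⊔ 𝒜 1) := by
  refine ⟨CotHopf.coupleHom 𝒜, ⟨⟨CotHopf.bialgHom_map_antipode _, fun n b hb => ?_⟩,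
    CotHopf.coupleCoalgHom_coe_zero 𝒜, CotHopf.coupleCoalgHom_coe_one 𝒜⟩, fun j hj h0 h1 => ?_,
    CotHopf.wedge_eq_of_coupleCoalgHom_injective 𝒜, CotHopf.coupleCoalgHom_injective_of_wedge_eq 𝒜⟩
  · exact ⟨_, (CotHopf.coupleCoalgHom_coe 𝒜 n ⟨b, hb⟩).symm⟩
  · have h := CotHopf.coalgHom_eq_coupleCoalgHom 𝒜 j.toCoalgHom hj.map_mem h0 h1
    exact DFunLike.ext _ _ fun b => DFunLike.congr_fun h b
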